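/- Let $\mathbf S$ be a small site. *Picard prestack* means: a category fibred in groupoids over $\mathbf S$ whose fibres are strictly commutative Picard categories (symmetric monoidal groupoids $(\mathcal P,+,e)$ in which every object is invertible and the commutativity isomorphism $x+x\to x+x$ is the identity for every $x$), with symmetric monoidal pull-back functors and coherence isomorphisms compatible with $+$; a *Picard stack* is a Picard prestack which is a stack. An *additive functor* is a morphism of fibred categories with symmetric monoidal structures on the fibres compatible with pull-back; isomorphisms of additive functors are natural isomorphisms compatible with pull-back and with $+$. An additive functor $j:\mathcal P\to\mathcal A$ *exhibits $\mathcal A$ as the stack generated by $\mathcal P$* if $\mathcal A$ is a stack, $j$ is locally faithful and locally full (it identifies the sheaf associated with $\underline{\mathrm{Hom}}(x,y)$ with $\underline{\mathrm{Hom}}(j(x),j(y))$), and every object of $\mathcal A$ is locally isomorphic to an object in the image of $j$. For a complex $K$ of abelian sheaves on $\mathbf S$, let $pst(K)$ be the Picard prestack such that the objects of $pst(K)(U)$ are the elements of $K^0(U)$ and the arrows $x\to y$ are the $k\in K^{-1}(U)$ with $d^K k=y-x$, with addition induced by that of $K$; $st(K)$ denotes the stack generated by $pst(K)$. A morphism of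 complexes $f:K\to L$ induces an additive functor $pst(f):pst(K)\to pst(L)$. For an additive functor $F:\mathcal P\to\mathcal Q$ of Picard stacks, $\ker(F)(U)$ is the category of pairs $(p,\varphi)$ with $p\in\mathcal P(U)$ and $\varphi:F(p)\cong e$, an arrow $(p,\varphi)\to(p',\varphi')$ being an arrow $\alpha:p\to p'$ with $\varphi'\circ F(\alpha)=\varphi$. Let $\mathrm{coker}'(F)$ be the Picard prestack whose objects over $U$ are those of $\mathcal Q(U)$ and whose arrows $q\to q'$ are the isomorphism classes of pairs $(p,\alpha)$ with $p\in\mathcal P(U)$ and $\alpha:q+F(p)\to q'$; $\mathrm{coker}(F)$ is the stack generated by $\mathrm{coker}'(F)$. **Lemma.** Let $K=[K^{-1}\xrightarrow{d^K}K^0]$ and $L=[L^{-1}\xrightarrow{d^L}L^0]$ be complexes of abelian sheaves on $\mathbf S$ concentrated in degrees $-1$ and $0$, let $f=(f^{-1},f^0):K\to L$ be a morphism of complexes, let $j_K:pst(K)\to st(K)$ and $j_L:pst(L)\to st(L)$ exhibit $st(K)$ and $st(L)$ as the generated stacks, and let $F:st(K)\to st(L)$ be an additive functor induced by $f$, i.e.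 $F\circ j_K\cong j_L\circ pst(f)$ as additive functors. Let $MC(f)$ be the mapping cone of $f$ and $\tau$ the good truncation. 1. $\ker(F)$ is $st\big(\tau_{\le 0}(MC(f)[-1])\big)$: there is an additive functor $pst\big(\tau_{\le 0}(MC(f)[-1])\big)\to\ker(F)$ exhibiting $\ker(F)$ as the generated stack (in particular, $\ker(F)$ is a stack). 2. $\mathrm{coker}(F)$ is $st\big(\tau_{\ge -1}MC(f)\big)$: for every additive functor exhibiting a Picard stack $\mathcal A$ as the stack generated by $\mathrm{coker}'(F)$, there is an additive functor $pst\big(\tau_{\ge -1}MC(f)\big)\to\mathcal A$ exhibiting $\mathcal A$ as the stack generated by $pst\big(\tau_{\ge -1}MC(f)\big)$. 3. There are isomorphisms of complexes $$\tau_{\le 0}(MC(f)[-1])\cong\big[K^{-1}\xrightarrow{(f^{-1},-d^K)}\ker\big((d^L,f^0):L^{-1}\oplus K^0\to L^0\big)\big],$$ $$\tau_{\ge -1}MC(f)\cong\big[\mathrm{coker}\big((f^{-1},-d^K):K^{-1}\to L^{-1}\oplus K^0\big)\xrightarrow{(d^L,f^0)}L^0\big],$$ where the complexes on the right are concentrated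 in degrees $-1$ and $0$. -/

import Mathlib

open CategoryTheory MonoidalCategory Opposite

universe w v u

/-!
Strictly commutative Picard prestacks and stacks over a site, additive functors, kernels and
cokernels, and the Picard prestacks attached to complexes of abelian sheaves.
-/

namespace PicardStack

universe v₁ v₂ u₁ u₂ v₁' v₂' u₁' u₂' v₁'' v₂'' u₁'' u₂''

set_option linter.unusedSectionVars false
set_option linter.unusedSimpArgs false

section Coker

variable {P : Type u₁} [Category.{v₁} P] [MonoidalCategory P] [SymmetricCategory P]
  {Q : Type u₂} [Category.{v₂} Q] [MonoidalCategory Q] [SymmetricCategory Q]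

open Functor.LaxMonoidal Functor.OplaxMonoidal Functor.Monoidal

/-- A pair `(p, α)` consisting of an object `p` of `P` and an arrow `α : q + F(p) ⟶ q'`. -/
structure CokerPair (F : P ⥤ Q) (q q' : Q) where
  p : P
  α : q ⊗ F.obj p ⟶ q'

/-- Isomorphisms of pairs `(p, α)` and `(p', α')` are isomorphisms `γ : p ≅ p'` which are compatible
with `α` and `α'`. -/
def cokerSetoid (F : P ⥤ Q) (q q' : Q) : Setoid (CokerPair F q q') where
  r a b := ∃ γ : a.p ≅ b.p, q ◁ F.map γ.hom ≫ b.α = a.α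
  iseqv :=
    { refl := fun a => ⟨Iso.refl _, by simp⟩
      symm := by
        rintro a b ⟨γ, h⟩
        refine ⟨γ.symm, ?_⟩
        rw [← h, ← whiskerLeft_comp_assoc, ← F.map_comp]
        simp
      trans := by
        rintro a b c ⟨γ, h⟩ ⟨δ, h'⟩
        refine ⟨γ ≪≫ δ, ?_⟩
        rw [← h, ← h']
        simp }

/-- The objects of the (fibre of the pre-)cokernel of `F : P ⥤ Q` are the objects of `Q`. -/
structure CokerObj (F : P ⥤ Q) where
  as : Q

namespace CokerObj

/-- The arrows `q ⟶ q'` are the isomorphism classes of pairs `(p, α : q + F(p) ⟶ q')`. -/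
def Hom {F : P ⥤ Q} (X Y : CokerObj F) := Quotient (cokerSetoid F X.as Y.as)

variable {F : P ⥤ Q}

/-- The class of a pair. -/
def mkHom {X Y : CokerObj F} (p : P) (α : X.as ⊗ F.obj p ⟶ Y.as) : Hom X Y :=
  Quotient.mk _ ⟨p, α⟩

lemma mkHom_eq {X Y : CokerObj F} {p p' : P} {α : X.as ⊗ F.obj p ⟶ Y.as}
    {α' : X.as ⊗ F.obj p' ⟶ Y.as} (γ : p ≅ p') (h : X.as ◁ F.map γ.hom ≫ α' = α) :
    mkHom p α = mkHom p' α' :=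
  Quotient.sound ⟨γ, h⟩

variable [F.Braided]

/-- The arrow `q + F(p + p') ≅ (q + F(p)) + F(p') ⟶ q' + F(p') ⟶ q''`. -/
def compAux {X Y Z : CokerObj F} (p p' : P) (α : X.as ⊗ F.obj p ⟶ Y.as)
    (α' : Y.as ⊗ F.obj p' ⟶ Z.as) : X.as ⊗ F.obj (p ⊗ p') ⟶ Z.as :=
  X.as ◁ δ F p p' ≫ (α_ _ _ _).inv ≫ α ▷ F.obj p' ≫ α'

/-- Composition: `(p, α)` followed by `(p', α')` is `(p + p', α'')`. -/
def comp {X Y Z : CokerObj F} (f : Hom X Y) (g : Hom Y Z) : Hom X Z :=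
  Quotient.liftOn₂ f g (fun a b => mkHom (a.p ⊗ b.p) (compAux a.p b.p a.α b.α)) (by
    rintro ⟨p, α⟩ ⟨q, β⟩ ⟨p', α'⟩ ⟨q', β'⟩ ⟨γ, h⟩ ⟨γ', h'⟩
    dsimp at h h' γ γ'
    subst h h'
    refine mkHom_eq (γ ⊗ᵢ γ') ?_
    have hn := δ_natural F γ.hom γ'.hom
    dsimp only [compAux]
    rw [tensorIso_hom, ← whiskerLeft_comp_assoc, ← hn, comp_whiskerRight, Category.assoc,
      ← whisker_exchange_assoc, MonoidalCategory.tensorHom_def]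
    monoidal)

instance : Category (CokerObj F) where
  Hom X Y := Hom X Y
  id X := mkHom (𝟙_ P) (X.as ◁ η F ≫ (ρ_ _).hom)
  comp f g := comp f g
  id_comp := by
    rintro X Y ⟨p, α⟩
    refine mkHom_eq (λ_ p) ?_
    dsimp only [compAux]
    rw [← Functor.OplaxMonoidal.left_unitality_hom]
    monoidal
  comp_id := by
    rintro X Y ⟨p, α⟩
    refine mkHom_eq (ρ_ p) ?_
    dsimp only [compAux]
    rw [← Functor.OplaxMonoidal.right_unitality_hom, ← whisker_exchange_assoc,
      rightUnitor_naturality]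
    monoidal
  assoc := by
    rintro X Y Z W ⟨p, α⟩ ⟨q, β⟩ ⟨r, γ⟩
    refine mkHom_eq (α_ p q r) ?_
    have h := Functor.OplaxMonoidal.associativity F p q r
    dsimp only [compAux]
    rw [← whisker_exchange_assoc, ← associator_inv_naturality_right_assoc,
      ← whiskerLeft_comp_assoc, ← whiskerLeft_comp_assoc, Category.assoc, ← h]
    monoidal

/-- The arrow `q ⟶ q'` of the cokernel given by `p` and `α : q + F(p) ⟶ q'`. -/
def homMk {X Y : CokerObj F} (p : P) (α : X.as ⊗ F.obj p ⟶ Y.as) : X ⟶ Y :=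
  mkHom p α

lemma homMk_eq {X Y : CokerObj F} {p p' : P} {α : X.as ⊗ F.obj p ⟶ Y.as}
    {α' : X.as ⊗ F.obj p' ⟶ Y.as} (γ : p ≅ p') (h : X.as ◁ F.map γ.hom ≫ α' = α) :
    homMk p α = homMk p' α' := mkHom_eq γ h

lemma homMk_surjective {X Y : CokerObj F} (f : X ⟶ Y) :
    ∃ (p : P) (α : X.as ⊗ F.obj p ⟶ Y.as), f = homMk p α := by
  obtain ⟨p, α⟩ := f
  exact ⟨p, α, rfl⟩

lemma homMk_comp_homMk {X Y Z : CokerObj F} (p p' : P) (α : X.as ⊗ F.obj p ⟶ Y.as)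
    (α' : Y.as ⊗ F.obj p' ⟶ Z.as) :
    homMk p α ≫ homMk p' α' =
      homMk (p ⊗ p') (X.as ◁ δ F p p' ≫ (α_ _ _ _).inv ≫ α ▷ F.obj p' ≫ α') := rfl

/-- The arrow of the cokernel given by an arrow of `Q`. -/
def ofHom {X Y : CokerObj F} (α : X.as ⟶ Y.as) : X ⟶ Y :=
  homMk (𝟙_ P) (X.as ◁ η F ≫ (ρ_ X.as).hom ≫ α)

@[simp] lemma ofHom_id (X : CokerObj F) : ofHom (𝟙 X.as) = 𝟙 X := by
  simp only [ofHom, Category.comp_id]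
  rfl

lemma ofHom_comp_homMk {X Y Z : CokerObj F} (θ : X.as ⟶ Y.as) (p : P)
    (α : Y.as ⊗ F.obj p ⟶ Z.as) : ofHom θ ≫ homMk p α = homMk p (θ ▷ F.obj p ≫ α) := by
  rw [ofHom, homMk_comp_homMk]
  refine homMk_eq (λ_ p) ?_
  rw [← Functor.OplaxMonoidal.left_unitality_hom]
  monoidal

lemma homMk_comp_ofHom {X Y Z : CokerObj F} (p : P) (α : X.as ⊗ F.obj p ⟶ Y.as)
    (θ : Y.as ⟶ Z.as) : homMk p α ≫ ofHom θ = homMk p (α ≫ θ) := by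
  rw [ofHom, homMk_comp_homMk]
  refine homMk_eq (ρ_ p) ?_
  rw [← Functor.OplaxMonoidal.right_unitality_hom, ← whisker_exchange_assoc,
    rightUnitor_naturality_assoc]
  monoidal

lemma ofHom_comp {X Y Z : CokerObj F} (α : X.as ⟶ Y.as) (β : Y.as ⟶ Z.as) :
    ofHom (α ≫ β) = ofHom α ≫ (ofHom β : Y ⟶ Z) := by
  rw [ofHom, ofHom, homMk_comp_ofHom]
  simp

lemma ofHom_comp_assoc {X Y Z W : CokerObj F} (α : X.as ⟶ Y.as) (β : Y.as ⟶ Z.as) (f : Z ⟶ W) :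
    ofHom (α ≫ β) ≫ f = ofHom α ≫ (ofHom β : Y ⟶ Z) ≫ f := by
  rw [ofHom_comp, Category.assoc]

/-- Isomorphisms of `Q` induce isomorphisms in the cokernel. -/
@[simps]
def isoOfIso {X Y : CokerObj F} (e : X.as ≅ Y.as) : X ≅ Y where
  hom := ofHom e.hom
  inv := ofHom e.inv
  hom_inv_id := by rw [← ofHom_comp]; simp
  inv_hom_id := by rw [← ofHom_comp]; simp

variable (F) in
/-- The functor from `Q` to the cokernel which is the identity on objects. -/
@[simps]
def incl : Q ⥤ CokerObj F where
  obj q := ⟨q⟩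
  map α := ofHom α
  map_id _ := ofHom_id _
  map_comp _ _ := ofHom_comp _ _

/-- Left addition of an object to an arrow of the cokernel. -/
def whiskerLeftAux (W : CokerObj F) {X Y : CokerObj F} (f : Hom X Y) :
    Hom (⟨W.as ⊗ X.as⟩ : CokerObj F) ⟨W.as ⊗ Y.as⟩ :=
  Quotient.liftOn f (fun a => mkHom (X := ⟨W.as ⊗ X.as⟩) (Y := ⟨W.as ⊗ Y.as⟩) a.p
    ((α_ _ _ _).hom ≫ W.as ◁ a.α)) (by
      rintro ⟨p, α⟩ ⟨p', α'⟩ ⟨γ, h⟩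
      dsimp at γ h
      subst h
      refine mkHom_eq γ ?_
      dsimp only
      monoidal)

/-- Right addition of an object to an arrow of the cokernel. -/
def whiskerRightAux {X Y : CokerObj F} (f : Hom X Y) (W : CokerObj F) :
    Hom (⟨X.as ⊗ W.as⟩ : CokerObj F) ⟨Y.as ⊗ W.as⟩ :=
  Quotient.liftOn f (fun a => mkHom (X := ⟨X.as ⊗ W.as⟩) (Y := ⟨Y.as ⊗ W.as⟩) a.p
    ((α_ _ _ _).hom ≫ X.as ◁ (β_ _ _).hom ≫ (α_ _ _ _).inv ≫ a.α ▷ W.as)) (by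
      rintro ⟨p, α⟩ ⟨p', α'⟩ ⟨γ, h⟩
      dsimp at γ h
      subst h
      refine mkHom_eq γ ?_
      dsimp only
      rw [associator_naturality_right_assoc, ← whiskerLeft_comp_assoc,
        BraidedCategory.braiding_naturality_right, whiskerLeft_comp_assoc]
      monoidal)

instance : MonoidalCategoryStruct (CokerObj F) where
  tensorObj X Y := ⟨X.as ⊗ Y.as⟩
  whiskerLeft W _ _ f := whiskerLeftAux W f
  whiskerRight f W := whiskerRightAux f W
  tensorHom {_ Y X' _} f g :=
    CategoryStruct.comp (obj := CokerObj F) (whiskerRightAux f X') (whiskerLeftAux Y g)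
  tensorUnit := ⟨𝟙_ Q⟩
  associator X Y Z := isoOfIso (α_ X.as Y.as Z.as)
  leftUnitor X := isoOfIso (λ_ X.as)
  rightUnitor X := isoOfIso (ρ_ X.as)

@[simp] lemma tensorObj_as (X Y : CokerObj F) : (X ⊗ Y).as = X.as ⊗ Y.as := rfl
@[simp] lemma tensorUnit_as : (𝟙_ (CokerObj F)).as = 𝟙_ Q := rfl

lemma associator_hom_eq (X Y Z : CokerObj F) :
    (α_ X Y Z).hom = ofHom (α_ X.as Y.as Z.as).hom := rfl
lemma leftUnitor_hom_eq (X : CokerObj F) : (λ_ X).hom = ofHom (λ_ X.as).hom := rfl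
lemma rightUnitor_hom_eq (X : CokerObj F) : (ρ_ X).hom = ofHom (ρ_ X.as).hom := rfl

lemma tensorHom_eq {X Y X' Y' : CokerObj F} (f : X ⟶ Y) (g : X' ⟶ Y') :
    f ⊗ₘ g = f ▷ X' ≫ Y ◁ g := rfl

lemma whiskerLeft_homMk (W : CokerObj F) {X Y : CokerObj F} (p : P)
    (α : X.as ⊗ F.obj p ⟶ Y.as) :
    W ◁ homMk p α = homMk (X := W ⊗ X) (Y := W ⊗ Y) p ((α_ _ _ _).hom ≫ W.as ◁ α) := rfl

lemma homMk_whiskerRight {X Y : CokerObj F} (p : P) (α : X.as ⊗ F.obj p ⟶ Y.as)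
    (W : CokerObj F) :
    homMk p α ▷ W = homMk (X := X ⊗ W) (Y := Y ⊗ W) p
      ((α_ _ _ _).hom ≫ X.as ◁ (β_ _ _).hom ≫ (α_ _ _ _).inv ≫ α ▷ W.as) := rfl

lemma whiskerLeft_ofHom (W : CokerObj F) {X Y : CokerObj F} (α : X.as ⟶ Y.as) :
    W ◁ ofHom α = ofHom (X := W ⊗ X) (Y := W ⊗ Y) (W.as ◁ α) := by
  rw [ofHom, whiskerLeft_homMk, ofHom]
  congr 1
  dsimp
  monoidal

lemma ofHom_whiskerRight {X Y : CokerObj F} (α : X.as ⟶ Y.as) (W : CokerObj F) :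
    ofHom α ▷ W = ofHom (X := X ⊗ W) (Y := Y ⊗ W) (α ▷ W.as) := by
  rw [ofHom, homMk_whiskerRight, ofHom]
  congr 1
  dsimp
  simp only [comp_whiskerRight, ← associator_inv_naturality_middle_assoc, Category.assoc]
  rw [← whiskerLeft_comp_assoc, ← BraidedCategory.braiding_naturality_right,
    braiding_tensorUnit_right]
  monoidal

lemma whiskerLeft_comp' (W : CokerObj F) {X Y Z : CokerObj F} (f : X ⟶ Y) (g : Y ⟶ Z) :
    W ◁ (f ≫ g) = W ◁ f ≫ W ◁ g := by
  obtain ⟨p, α, rfl⟩ := homMk_surjective f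
  obtain ⟨p', α', rfl⟩ := homMk_surjective g
  simp only [whiskerLeft_homMk, homMk_comp_homMk]
  congr 1
  dsimp
  monoidal

lemma whiskerRight_eq {X Y : CokerObj F} (f : X ⟶ Y) (W : CokerObj F) :
    f ▷ W = ofHom (β_ X.as W.as).hom ≫ W ◁ f ≫
      ofHom (X := W ⊗ Y) (Y := Y ⊗ W) (β_ W.as Y.as).hom := by
  obtain ⟨p, α, rfl⟩ := homMk_surjective f
  rw [homMk_whiskerRight, whiskerLeft_homMk, homMk_comp_ofHom, ofHom_comp_homMk]
  congr 1
  dsimp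
  simp only [Category.assoc]
  rw [BraidedCategory.braiding_naturality_right, BraidedCategory.braiding_tensor_right_hom]
  simp only [Category.assoc, Iso.hom_inv_id_assoc]
  rw [← comp_whiskerRight_assoc, SymmetricCategory.symmetry, id_whiskerRight, Category.id_comp]

lemma exchange' {X Y X' Y' : CokerObj F} (f : X ⟶ Y) (g : X' ⟶ Y') :
    X ◁ g ≫ f ▷ Y' = f ▷ X' ≫ Y ◁ g := by
  obtain ⟨p, a, rfl⟩ := homMk_surjective f
  obtain ⟨p', b, rfl⟩ := homMk_surjective g
  simp only [whiskerLeft_homMk, homMk_whiskerRight, homMk_comp_homMk]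
  symm
  refine homMk_eq (β_ p p') ?_
  rw [Functor.map_braiding]
  dsimp
  have h1 : (X.as ◁ b) ▷ F.obj p ≫ (α_ _ _ _).hom ≫ X.as ◁ (β_ Y'.as (F.obj p)).hom ≫
      (α_ _ _ _).inv ≫ a ▷ Y'.as =
      (α_ _ _ _).hom ≫ X.as ◁ (β_ (X'.as ⊗ F.obj p') (F.obj p)).hom ≫ (α_ _ _ _).inv ≫
        a ▷ _ ≫ Y.as ◁ b := by
    rw [associator_naturality_middle_assoc, ← whiskerLeft_comp_assoc,
      BraidedCategory.braiding_naturality_left, whiskerLeft_comp_assoc,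
      associator_inv_naturality_right_assoc, whisker_exchange]
  have h2 : X'.as ◁ (β_ (F.obj p) (F.obj p')).hom ≫ (α_ _ _ _).inv ≫
      (β_ (X'.as ⊗ F.obj p') (F.obj p)).hom =
      (α_ _ _ _).inv ≫ (β_ X'.as (F.obj p)).hom ▷ F.obj p' ≫ (α_ _ _ _).hom := by
    rw [BraidedCategory.braiding_tensor_left_hom, Iso.inv_hom_id_assoc, ← whiskerLeft_comp_assoc,
      SymmetricCategory.symmetry, whiskerLeft_id, Category.id_comp]
  simp only [comp_whiskerRight, Category.assoc, h1, whiskerLeft_comp, whiskerLeft_μ_δ_assoc]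
  congr 1
  have h3 := congrArg (fun t => X.as ◁ t) h2
  simp only [whiskerLeft_comp] at h3
  have h4 : (X.as ⊗ X'.as) ◁ (β_ (F.obj p) (F.obj p')).hom ≫
      (α_ (X.as ⊗ X'.as) (F.obj p') (F.obj p)).inv ≫ (α_ X.as X'.as (F.obj p')).hom ▷ F.obj p ≫
      (α_ X.as (X'.as ⊗ F.obj p') (F.obj p)).hom ≫
      X.as ◁ (β_ (X'.as ⊗ F.obj p') (F.obj p)).hom =
      (α_ _ _ _).hom ≫ X.as ◁ X'.as ◁ (β_ (F.obj p) (F.obj p')).hom ≫ X.as ◁ (α_ _ _ _).inv ≫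
      X.as ◁ (β_ (X'.as ⊗ F.obj p') (F.obj p)).hom := by monoidal
  rw [reassoc_of% h4, reassoc_of% h3]
  monoidal

lemma whiskerRight_comp' {X Y Z : CokerObj F} (f : X ⟶ Y) (g : Y ⟶ Z) (W : CokerObj F) :
    (f ≫ g) ▷ W = f ▷ W ≫ g ▷ W := by
  simp only [whiskerRight_eq, whiskerLeft_comp', Category.assoc]
  rw [← ofHom_comp_assoc (X := W ⊗ Y) (Y := Y ⊗ W) (Z := W ⊗ Y), SymmetricCategory.symmetry]
  erw [ofHom_id, Category.id_comp]

instance : MonoidalCategory (CokerObj F) where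
  tensorHom_def _ _ := rfl
  id_tensorHom_id X Y := by
    rw [tensorHom_eq, ← ofHom_id, ← ofHom_id, ofHom_whiskerRight, whiskerLeft_ofHom,
      ← ofHom_comp]
    simp [← ofHom_id]
  tensorHom_comp_tensorHom f₁ f₂ g₁ g₂ := by
    simp only [tensorHom_eq, whiskerLeft_comp', whiskerRight_comp', Category.assoc]
    rw [← Category.assoc (_ ◁ f₂), exchange']
    simp
  whiskerLeft_id X Y := by
    rw [← ofHom_id, whiskerLeft_ofHom]
    simp [← ofHom_id]
  id_whiskerRight X Y := by
    rw [← ofHom_id, ofHom_whiskerRight]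
    simp [← ofHom_id]
  associator_naturality {X₁ X₂ X₃ Y₁ Y₂ Y₃} f g h := by
    have h1 : f ▷ X₂ ▷ X₃ ≫ (α_ _ _ _).hom = (α_ _ _ _).hom ≫ f ▷ (X₂ ⊗ X₃) := by
      obtain ⟨p, a, rfl⟩ := homMk_surjective f
      rw [associator_hom_eq, associator_hom_eq]
      simp only [homMk_whiskerRight]
      rw [homMk_comp_ofHom, ofHom_comp_homMk]
      congr 1
      dsimp
      rw [BraidedCategory.braiding_tensor_left_hom]
      monoidal
    have h2 : (Y₁ ◁ g) ▷ X₃ ≫ (α_ _ _ _).hom = (α_ _ _ _).hom ≫ Y₁ ◁ (g ▷ X₃) := by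
      obtain ⟨p, a, rfl⟩ := homMk_surjective g
      rw [associator_hom_eq, associator_hom_eq]
      simp only [homMk_whiskerRight, whiskerLeft_homMk]
      rw [homMk_comp_ofHom, ofHom_comp_homMk]
      congr 1
      dsimp
      monoidal
    have h3 : (Y₁ ⊗ Y₂) ◁ h ≫ (α_ _ _ _).hom = (α_ _ _ _).hom ≫ Y₁ ◁ (Y₂ ◁ h) := by
      obtain ⟨p, a, rfl⟩ := homMk_surjective h
      rw [associator_hom_eq, associator_hom_eq]
      simp only [whiskerLeft_homMk]
      rw [homMk_comp_ofHom, ofHom_comp_homMk]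
      congr 1
      dsimp
      monoidal
    simp only [tensorHom_eq, whiskerLeft_comp', whiskerRight_comp', Category.assoc]
    rw [h3, reassoc_of% h2, reassoc_of% h1]
  leftUnitor_naturality f := by
    obtain ⟨p, a, rfl⟩ := homMk_surjective f
    rw [leftUnitor_hom_eq, leftUnitor_hom_eq, whiskerLeft_homMk]
    rw [homMk_comp_ofHom, ofHom_comp_homMk]
    congr 1
    dsimp
    monoidal
  rightUnitor_naturality f := by
    obtain ⟨p, a, rfl⟩ := homMk_surjective f
    rw [rightUnitor_hom_eq, rightUnitor_hom_eq, homMk_whiskerRight]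
    rw [homMk_comp_ofHom, ofHom_comp_homMk]
    congr 1
    dsimp
    rw [braiding_tensorUnit_left]
    monoidal
  pentagon W X Y Z := by
    simp only [associator_hom_eq, ofHom_whiskerRight, whiskerLeft_ofHom]
    erw [← ofHom_comp, ← ofHom_comp, ← ofHom_comp]
    congr 1
    dsimp
    monoidal
  triangle X Y := by
    simp only [associator_hom_eq, leftUnitor_hom_eq, rightUnitor_hom_eq, ofHom_whiskerRight,
      whiskerLeft_ofHom]
    erw [← ofHom_comp]
    congr 1
    dsimp
    monoidal

end CokerObj
end Coker

section Coker

variable {P : Type u₁} [Category.{v₁} P] [MonoidalCategory P] [SymmetricCategory P]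
  {Q : Type u₂} [Category.{v₂} Q] [MonoidalCategory Q] [SymmetricCategory Q]
open Functor.LaxMonoidal Functor.OplaxMonoidal Functor.Monoidal
namespace CokerObj
variable {F : P ⥤ Q} [F.Braided]

lemma symmetry_comp (X Y : CokerObj F) :
    (ofHom (β_ X.as Y.as).hom : X ⊗ Y ⟶ Y ⊗ X) ≫ ofHom (β_ Y.as X.as).hom = 𝟙 _ := by
  rw [← ofHom_comp, SymmetricCategory.symmetry]
  exact ofHom_id _

lemma symmetry_comp_assoc (X Y : CokerObj F) {Z : CokerObj F} (f : X ⊗ Y ⟶ Z) :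
    (ofHom (β_ X.as Y.as).hom : X ⊗ Y ⟶ Y ⊗ X) ≫ ofHom (β_ Y.as X.as).hom ≫ f = f := by
  rw [← Category.assoc, symmetry_comp, Category.id_comp]

lemma associator_inv_eq (X Y Z : CokerObj F) :
    (α_ X Y Z).inv = ofHom (α_ X.as Y.as Z.as).inv := rfl

instance : BraidedCategory (CokerObj F) where
  braiding X Y := isoOfIso (X := X ⊗ Y) (Y := Y ⊗ X) (β_ X.as Y.as)
  braiding_naturality_right X Y Z f := by
    simp only [whiskerRight_eq, isoOfIso_hom]
    rw [symmetry_comp_assoc]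
  braiding_naturality_left f Z := by
    simp only [whiskerRight_eq, isoOfIso_hom, Category.assoc]
    rw [symmetry_comp, Category.comp_id]
  hexagon_forward X Y Z := by
    simp only [associator_hom_eq, isoOfIso_hom, ofHom_whiskerRight, whiskerLeft_ofHom]
    erw [← ofHom_comp, ← ofHom_comp, ← ofHom_comp, ← ofHom_comp]
    congr 1
    exact BraidedCategory.hexagon_forward _ _ _
  hexagon_reverse X Y Z := by
    simp only [associator_inv_eq, isoOfIso_hom, ofHom_whiskerRight, whiskerLeft_ofHom]
    erw [← ofHom_comp, ← ofHom_comp, ← ofHom_comp, ← ofHom_comp]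
    congr 1
    exact BraidedCategory.hexagon_reverse _ _ _

instance : SymmetricCategory (CokerObj F) where
  symmetry X Y := symmetry_comp X Y

lemma braiding_hom_eq (X Y : CokerObj F) : (β_ X Y).hom = ofHom (β_ X.as Y.as).hom := rfl

lemma isGroupoid [IsGroupoid Q] (hP : ∀ p : P, ∃ p' : P, Nonempty (p ⊗ p' ≅ 𝟙_ P)) :
    IsGroupoid (CokerObj F) where
  all_isIso := by
    intro X Y f
    obtain ⟨p, a, rfl⟩ := homMk_surjective f
    obtain ⟨p', ⟨e⟩⟩ := hP p
    have key : ∀ {X Y : CokerObj F} (p p' : P) (e : p ⊗ p' ≅ 𝟙_ P) (a : X.as ⊗ F.obj p ⟶ Y.as),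
      ∃ g : Y ⟶ X, homMk p a ≫ g = 𝟙 X := by
      intro X Y p p' e a
      refine ⟨homMk p' (inv a ▷ F.obj p' ≫ (α_ _ _ _).hom ≫ X.as ◁ (μ F p p' ≫ F.map e.hom ≫ η F) ≫
        (ρ_ _).hom), ?_⟩
      rw [← ofHom_id, ofHom, homMk_comp_homMk]
      refine homMk_eq e ?_
      simp only [MonoidalCategory.whiskerLeft_comp, ← comp_whiskerRight_assoc, Category.assoc,
        IsIso.hom_inv_id, id_whiskerRight, Category.id_comp, Iso.inv_hom_id_assoc,
        whiskerLeft_δ_μ_assoc, Category.comp_id]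
    have h1 := key p p' e a
    obtain ⟨g, hg⟩ := h1
    obtain ⟨q, b, rfl⟩ := homMk_surjective g
    obtain ⟨q', ⟨e'⟩⟩ := hP q
    obtain ⟨g', hg'⟩ := key q q' e' b
    have : g' = homMk p a := by
      rw [← Category.id_comp g', ← hg, Category.assoc, hg', Category.comp_id]
    subst this
    exact ⟨_, hg, hg'⟩

end CokerObj
end Coker

section Coker
open Functor.LaxMonoidal Functor.OplaxMonoidal Functor.Monoidal

variable {P : Type u₁} [Category.{v₁} P] [MonoidalCategory P] [SymmetricCategory P]
  {Q : Type u₂} [Category.{v₂} Q] [MonoidalCategory Q] [SymmetricCategory Q]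
  {P' : Type u₁'} [Category.{v₁'} P'] [MonoidalCategory P'] [SymmetricCategory P']
  {Q' : Type u₂'} [Category.{v₂'} Q'] [MonoidalCategory Q'] [SymmetricCategory Q']
namespace CokerObj
variable {F : P ⥤ Q} [F.Braided] {F' : P' ⥤ Q'} [F'.Braided]
  (G : P ⥤ P') [G.Braided] (H : Q ⥤ Q') [H.Braided] (θ : G ⋙ F' ⟶ F ⋙ H)

/-- The action on arrows of the functor between cokernels induced by a square. -/
def mapAux {X Y : CokerObj F} (f : Hom X Y) :
    Hom (⟨H.obj X.as⟩ : CokerObj F') ⟨H.obj Y.as⟩ :=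
  Quotient.liftOn f (fun a => mkHom (X := ⟨H.obj X.as⟩) (Y := ⟨H.obj Y.as⟩) (G.obj a.p)
    (H.obj X.as ◁ θ.app a.p ≫ μ H X.as (F.obj a.p) ≫ H.map a.α)) (by
      rintro ⟨p, α⟩ ⟨p', α'⟩ ⟨γ, h⟩
      dsimp at γ h
      subst h
      refine mkHom_eq (G.mapIso γ) ?_
      have := θ.naturality γ.hom
      dsimp at this ⊢
      rw [← whiskerLeft_comp_assoc, this]
      simp [μ_natural_right_assoc])

/-- The functor between cokernels induced by a square which commutes up to a monoidal
isomorphism. -/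
@[reducible]
def map [NatTrans.IsMonoidal θ] : CokerObj F ⥤ CokerObj F' where
  obj X := ⟨H.obj X.as⟩
  map f := mapAux G H θ f
  map_id X := by
    symm
    refine mkHom_eq (εIso G) ?_
    have h := NatTrans.IsMonoidal.unit (τ := θ)
    dsimp at h ⊢
    have h' : F'.map (ε G) ≫ θ.app (𝟙_ P) = η F' ≫ ε H ≫ H.map (ε F) := by
      rw [← cancel_epi (ε F')]
      simpa using h
    rw [← whiskerLeft_comp_assoc, εIso_hom, h']
    simp only [MonoidalCategory.whiskerLeft_comp, Category.assoc, Functor.map_comp]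
    rw [μ_natural_right_assoc, ← H.map_comp_assoc, ← MonoidalCategory.whiskerLeft_comp, ε_η,
      MonoidalCategory.whiskerLeft_id, H.map_id, Category.id_comp,
      ← Functor.LaxMonoidal.right_unitality]
  map_comp f g := by
    obtain ⟨p, a, rfl⟩ := homMk_surjective f
    obtain ⟨p', a', rfl⟩ := homMk_surjective g
    symm
    refine mkHom_eq (μIso G _ _) ?_
    have h := NatTrans.IsMonoidal.tensor (τ := θ) p p'
    dsimp at h ⊢
    have h' : F'.map (μ G p p') ≫ θ.app (p ⊗ p') =
        δ F' (G.obj p) (G.obj p') ≫ (θ.app p ⊗ₘ θ.app p') ≫ μ H (F.obj p) (F.obj p') ≫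
          H.map (μ F p p') := by
      rw [← cancel_epi (μ F' (G.obj p) (G.obj p'))]
      simpa using h
    dsimp only [compAux]
    rw [← whiskerLeft_comp_assoc, μIso_hom, h']
    simp only [MonoidalCategory.whiskerLeft_comp, Category.assoc, Functor.map_comp]
    rw [μ_natural_right_assoc, ← H.map_comp_assoc (_ ◁ μ F p p'),
      ← MonoidalCategory.whiskerLeft_comp, μ_δ,
      MonoidalCategory.whiskerLeft_id, H.map_id, Category.id_comp]
    rw [Functor.LaxMonoidal.associativity_inv_assoc, ← μ_natural_left_assoc]
    simp only [comp_whiskerRight, Category.assoc]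
    rw [← whisker_exchange_assoc, ← whisker_exchange_assoc, MonoidalCategory.tensorHom_def]
    monoidal

variable [NatTrans.IsMonoidal θ]

lemma map_homMk {X Y : CokerObj F} (p : P) (α : X.as ⊗ F.obj p ⟶ Y.as) :
    (map G H θ).map (homMk p α) = homMk (X := (map G H θ).obj X) (Y := (map G H θ).obj Y) (G.obj p)
      (H.obj X.as ◁ θ.app p ≫ μ H X.as (F.obj p) ≫ H.map α) := rfl

lemma map_ofHom {X Y : CokerObj F} (α : X.as ⟶ Y.as) :
    (map G H θ).map (ofHom α) = ofHom (X := (map G H θ).obj X) (Y := (map G H θ).obj Y) (H.map α) := by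
  have h := (map G H θ).map_id X
  rw [← ofHom_id, ofHom, map_homMk] at h
  have : homMk (X := (map G H θ).obj X) (Y := (map G H θ).obj X) (G.obj (𝟙_ P))
      (H.obj X.as ◁ θ.app (𝟙_ P) ≫ μ H X.as (F.obj (𝟙_ P)) ≫
        H.map (X.as ◁ η F ≫ (ρ_ X.as).hom ≫ 𝟙 X.as)) ≫ ofHom (X := (map G H θ).obj X) (Y := (map G H θ).obj Y) (H.map α) = ofHom (X := (map G H θ).obj X) (Y := (map G H θ).obj Y) (H.map α) := by
    rw [h]
    exact Category.id_comp _
  rw [homMk_comp_ofHom] at this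
  rw [← this, ofHom, map_homMk]
  congr 1
  simp only [Functor.map_comp, Category.assoc, CategoryTheory.Functor.map_id, Category.id_comp]

@[simp] lemma map_obj_as (X : CokerObj F) : ((map G H θ).obj X).as = H.obj X.as := rfl

lemma map_whiskerLeft (W : CokerObj F) {X Y : CokerObj F} (f : X ⟶ Y) :
    (map G H θ).obj W ◁ (map G H θ).map f ≫
      ofHom (X := (map G H θ).obj W ⊗ (map G H θ).obj Y) (Y := (map G H θ).obj (W ⊗ Y))
        (μ H W.as Y.as) =
    ofHom (X := (map G H θ).obj W ⊗ (map G H θ).obj X) (Y := (map G H θ).obj (W ⊗ X))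
        (μ H W.as X.as) ≫ (map G H θ).map (W ◁ f) := by
  obtain ⟨p, a, rfl⟩ := homMk_surjective f
  rw [whiskerLeft_homMk, map_homMk, map_homMk, whiskerLeft_homMk, homMk_comp_ofHom,
    ofHom_comp_homMk]
  congr 1
  dsimp
  simp only [MonoidalCategory.whiskerLeft_comp, Category.assoc, Functor.map_comp]
  rw [← whisker_exchange_assoc, Functor.LaxMonoidal.associativity_assoc, ← μ_natural_right]
  monoidal

lemma map_ofHom_braiding (X Y : CokerObj F) :
    ofHom (X := (map G H θ).obj X ⊗ (map G H θ).obj Y) (Y := (map G H θ).obj (X ⊗ Y))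
        (μ H X.as Y.as) ≫ (map G H θ).map (ofHom (β_ X.as Y.as).hom : X ⊗ Y ⟶ Y ⊗ X) =
    (β_ ((map G H θ).obj X) ((map G H θ).obj Y)).hom ≫
      ofHom (X := (map G H θ).obj Y ⊗ (map G H θ).obj X) (Y := (map G H θ).obj (Y ⊗ X))
        (μ H Y.as X.as) := by
  rw [map_ofHom, braiding_hom_eq, ← ofHom_comp, ← ofHom_comp]
  congr 1
  exact Functor.LaxBraided.braided (F := H) X.as Y.as

lemma map_whiskerRight {X Y : CokerObj F} (f : X ⟶ Y) (W : CokerObj F) :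
    (map G H θ).map f ▷ (map G H θ).obj W ≫
      ofHom (X := (map G H θ).obj Y ⊗ (map G H θ).obj W) (Y := (map G H θ).obj (Y ⊗ W))
        (μ H Y.as W.as) =
    ofHom (X := (map G H θ).obj X ⊗ (map G H θ).obj W) (Y := (map G H θ).obj (X ⊗ W))
        (μ H X.as W.as) ≫ (map G H θ).map (f ▷ W) := by
  have h1 := map_ofHom_braiding G H θ X W
  have h2 := map_ofHom_braiding G H θ W Y
  have h3 := map_whiskerLeft G H θ W f
  rw [whiskerRight_eq f, Functor.map_comp, Functor.map_comp, reassoc_of% h1, ← reassoc_of% h3, h2,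
    whiskerRight_eq]
  simp only [Category.assoc]
  rfl

/-- `map` is symmetric monoidal. -/
def mapCore : (map G H θ).CoreMonoidal where
  εIso := isoOfIso (X := 𝟙_ _) (Y := (map G H θ).obj (𝟙_ _)) (εIso H)
  μIso X Y := isoOfIso (X := (map G H θ).obj X ⊗ (map G H θ).obj Y)
    (Y := (map G H θ).obj (X ⊗ Y)) (μIso H X.as Y.as)
  μIso_hom_natural_left f W := map_whiskerRight _ _ _ _ _
  μIso_hom_natural_right W f := map_whiskerLeft _ _ _ _ _
  associativity X Y Z := by
    rw [associator_hom_eq, associator_hom_eq, map_ofHom]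
    simp only [isoOfIso_hom]
    rw [ofHom_whiskerRight, whiskerLeft_ofHom, ← ofHom_comp, ← ofHom_comp, ← ofHom_comp,
      ← ofHom_comp]
    congr 1
    exact Functor.LaxMonoidal.associativity H _ _ _
  left_unitality X := by
    rw [leftUnitor_hom_eq, leftUnitor_hom_eq, map_ofHom]
    simp only [isoOfIso_hom]
    rw [ofHom_whiskerRight, ← ofHom_comp, ← ofHom_comp]
    congr 1
    exact Functor.LaxMonoidal.left_unitality H _
  right_unitality X := by
    rw [rightUnitor_hom_eq, rightUnitor_hom_eq, map_ofHom]
    simp only [isoOfIso_hom]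
    rw [whiskerLeft_ofHom, ← ofHom_comp, ← ofHom_comp]
    congr 1
    exact Functor.LaxMonoidal.right_unitality H _

instance : (map G H θ).Monoidal := (mapCore G H θ).toMonoidal

lemma ε_map : ε (map G H θ) = ofHom (X := 𝟙_ _) (Y := (map G H θ).obj (𝟙_ _)) (ε H) := rfl

lemma μ_map (X Y : CokerObj F) : μ (map G H θ) X Y =
    ofHom (X := (map G H θ).obj X ⊗ (map G H θ).obj Y) (Y := (map G H θ).obj (X ⊗ Y))
      (μ H X.as Y.as) := rfl

instance : (map G H θ).Braided where
  braided X Y := map_ofHom_braiding G H θ X Y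

end CokerObj
end Coker

/-- A strictly commutative Picard category: a symmetric monoidal groupoid in which every object is
invertible and the commutativity isomorphism `x + x ≅ x + x` is the identity for all `x`. -/
class IsStrictPicard (P : Type u₁) [Category.{v₁} P] [MonoidalCategory P] [SymmetricCategory P] :
    Prop extends IsGroupoid P where
  braiding_self (x : P) : (β_ x x).hom = 𝟙 (x ⊗ x)
  exists_inverse (x : P) : ∃ y : P, Nonempty (x ⊗ y ≅ 𝟙_ P)

section Coker
open Functor.LaxMonoidal Functor.OplaxMonoidal Functor.Monoidal

variable {P : Type u₁} [Category.{v₁} P] [MonoidalCategory P] [SymmetricCategory P]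
  {Q : Type u₂} [Category.{v₂} Q] [MonoidalCategory Q] [SymmetricCategory Q]
  {P' : Type u₁'} [Category.{v₁'} P'] [MonoidalCategory P'] [SymmetricCategory P']
  {Q' : Type u₂'} [Category.{v₂'} Q'] [MonoidalCategory Q'] [SymmetricCategory Q']
  {P'' : Type u₁''} [Category.{v₁''} P''] [MonoidalCategory P''] [SymmetricCategory P'']
  {Q'' : Type u₂''} [Category.{v₂''} Q''] [MonoidalCategory Q''] [SymmetricCategory Q'']
namespace CokerObj
variable {F : P ⥤ Q} [F.Braided] {F' : P' ⥤ Q'} [F'.Braided] {F'' : P'' ⥤ Q''} [F''.Braided]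

lemma ofHom_eqToHom {X Y : CokerObj F} (h : X = Y) :
    ofHom (eqToHom (congrArg CokerObj.as h)) = eqToHom h := by
  subst h
  exact ofHom_id X

/-- The isomorphism `𝟙^* ≅ id` of functors on the cokernel. -/
def mapId (G : P ⥤ P) [G.Braided] (H : Q ⥤ Q) [H.Braided] (θ : G ⋙ F ⟶ F ⋙ H)
    [NatTrans.IsMonoidal θ] (g : G ≅ 𝟭 P) (h : H ≅ 𝟭 Q) [NatTrans.IsMonoidal h.hom]
    (comm : ∀ p, θ.app p ≫ h.hom.app (F.obj p) = F.map (g.hom.app p)) :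
    map G H θ ≅ 𝟭 (CokerObj F) :=
  NatIso.ofComponents (fun X => isoOfIso (X := (map G H θ).obj X) (Y := X) (h.app X.as)) (by
    intro X Y f
    obtain ⟨p, a, rfl⟩ := homMk_surjective f
    change (map G H θ).map (homMk p a) ≫ ofHom (X := (map G H θ).obj Y) (Y := Y) (h.hom.app Y.as) =
      ofHom (X := (map G H θ).obj X) (Y := X) (h.hom.app X.as) ≫ homMk p a
    rw [map_homMk, homMk_comp_ofHom, ofHom_comp_homMk]
    refine homMk_eq (g.app p) ?_
    have h1 := NatTrans.IsMonoidal.tensor (τ := h.hom) X.as (F.obj p)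
    have h2 := h.hom.naturality a
    dsimp at h1 h2 ⊢
    rw [Category.comp_id] at h1
    rw [Category.assoc, Category.assoc, h2, reassoc_of% h1, ← comm p,
      MonoidalCategory.whiskerLeft_comp, Category.assoc, MonoidalCategory.tensorHom_def',
      Category.assoc])

/-- The isomorphism `(f g)^* ≅ g^* f^*` of functors on the cokernel. -/
def mapComp (G₁ : P ⥤ P') [G₁.Braided] (H₁ : Q ⥤ Q') [H₁.Braided] (θ₁ : G₁ ⋙ F' ⟶ F ⋙ H₁)
    [NatTrans.IsMonoidal θ₁] (G₂ : P' ⥤ P'') [G₂.Braided] (H₂ : Q' ⥤ Q'') [H₂.Braided]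
    (θ₂ : G₂ ⋙ F'' ⟶ F' ⋙ H₂) [NatTrans.IsMonoidal θ₂]
    (G : P ⥤ P'') [G.Braided] (H : Q ⥤ Q'') [H.Braided] (θ : G ⋙ F'' ⟶ F ⋙ H)
    [NatTrans.IsMonoidal θ] (g : G ≅ G₁ ⋙ G₂) (h : H ≅ H₁ ⋙ H₂) [NatTrans.IsMonoidal h.hom]
    (comm : ∀ p, θ.app p ≫ h.hom.app (F.obj p) =
      F''.map (g.hom.app p) ≫ θ₂.app (G₁.obj p) ≫ H₂.map (θ₁.app p)) :
    map G H θ ≅ map G₁ H₁ θ₁ ⋙ map G₂ H₂ θ₂ :=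
  NatIso.ofComponents (fun X => isoOfIso (X := (map G H θ).obj X)
      (Y := (map G₁ H₁ θ₁ ⋙ map G₂ H₂ θ₂).obj X) (h.app X.as)) (by
    intro X Y f
    obtain ⟨p, a, rfl⟩ := homMk_surjective f
    change (map G H θ).map (homMk p a) ≫ ofHom (X := (map G H θ).obj Y)
        (Y := (map G₂ H₂ θ₂).obj ((map G₁ H₁ θ₁).obj Y)) (h.hom.app Y.as) =
      ofHom (X := (map G H θ).obj X) (Y := (map G₂ H₂ θ₂).obj ((map G₁ H₁ θ₁).obj X))
        (h.hom.app X.as) ≫ (map G₂ H₂ θ₂).map ((map G₁ H₁ θ₁).map (homMk p a))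
    rw [map_homMk, homMk_comp_ofHom, map_homMk, map_homMk, ofHom_comp_homMk]
    refine homMk_eq (g.app p) ?_
    have h1 := NatTrans.IsMonoidal.tensor (τ := h.hom) X.as (F.obj p)
    have h2 := h.hom.naturality a
    dsimp at h1 h2 ⊢
    rw [Category.assoc, Category.assoc, h2, reassoc_of% h1, MonoidalCategory.tensorHom_def',
      Category.assoc, ← whiskerLeft_comp_assoc, comm p]
    simp only [MonoidalCategory.whiskerLeft_comp, Category.assoc, Functor.map_comp]
    rw [← μ_natural_right_assoc]
    simp only [whisker_exchange_assoc, Functor.comp_obj])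

instance (F : P ⥤ Q) [F.Braided] [IsStrictPicard P] [IsStrictPicard Q] :
    IsStrictPicard (CokerObj F) where
  toIsGroupoid := CokerObj.isGroupoid IsStrictPicard.exists_inverse
  braiding_self X := by
    rw [CokerObj.braiding_hom_eq, IsStrictPicard.braiding_self]
    exact CokerObj.ofHom_id _
  exists_inverse X := by
    obtain ⟨y, ⟨e⟩⟩ := IsStrictPicard.exists_inverse X.as
    exact ⟨⟨y⟩, ⟨CokerObj.isoOfIso (X := X ⊗ ⟨y⟩) (Y := 𝟙_ _) e⟩⟩
lemma ofHom_tensorHom {X Y X' Y' : CokerObj F} (a : X.as ⟶ Y.as) (b : X'.as ⟶ Y'.as) :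
    (ofHom a : X ⟶ Y) ⊗ₘ (ofHom b : X' ⟶ Y') = ofHom (X := X ⊗ X') (Y := Y ⊗ Y') (a ⊗ₘ b) := by
  rw [tensorHom_eq, ofHom_whiskerRight, whiskerLeft_ofHom, ← ofHom_comp,
    MonoidalCategory.tensorHom_def]

instance (G : P ⥤ P) [G.Braided] (H : Q ⥤ Q) [H.Braided] (θ : G ⋙ F ⟶ F ⋙ H)
    [NatTrans.IsMonoidal θ] (g : G ≅ 𝟭 P) (h : H ≅ 𝟭 Q) [NatTrans.IsMonoidal h.hom]
    (comm : ∀ p, θ.app p ≫ h.hom.app (F.obj p) = F.map (g.hom.app p)) :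
    NatTrans.IsMonoidal (mapId G H θ g h comm).hom where
  unit := (ofHom_comp (X := 𝟙_ _) (Y := (map G H θ).obj (𝟙_ _)) (Z := 𝟙_ _) (ε H)
      (h.hom.app (𝟙_ Q))).symm.trans
    ((congrArg (ofHom (X := 𝟙_ (CokerObj F)) (Y := 𝟙_ (CokerObj F)))
      (NatTrans.IsMonoidal.unit (τ := h.hom))).trans (ofHom_id _))
  tensor X Y := by
    refine (ofHom_comp (X := (map G H θ).obj X ⊗ (map G H θ).obj Y)
      (Y := (map G H θ).obj (X ⊗ Y)) (Z := X ⊗ Y) (μ H X.as Y.as)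
      (h.hom.app (X.as ⊗ Y.as))).symm.trans
      ((congrArg (ofHom (X := (map G H θ).obj X ⊗ (map G H θ).obj Y) (Y := X ⊗ Y))
      (NatTrans.IsMonoidal.tensor (τ := h.hom) X.as Y.as)).trans ?_)
    refine Eq.trans ?_ (Category.comp_id _).symm
    refine Eq.trans ?_ (ofHom_tensorHom (X := (map G H θ).obj X) (X' := (map G H θ).obj Y)
      (Y := X) (Y' := Y) (h.hom.app X.as) (h.hom.app Y.as)).symm
    exact congrArg ofHom (Category.comp_id _)

instance (G₁ : P ⥤ P') [G₁.Braided] (H₁ : Q ⥤ Q') [H₁.Braided] (θ₁ : G₁ ⋙ F' ⟶ F ⋙ H₁)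
    [NatTrans.IsMonoidal θ₁] (G₂ : P' ⥤ P'') [G₂.Braided] (H₂ : Q' ⥤ Q'') [H₂.Braided]
    (θ₂ : G₂ ⋙ F'' ⟶ F' ⋙ H₂) [NatTrans.IsMonoidal θ₂]
    (G : P ⥤ P'') [G.Braided] (H : Q ⥤ Q'') [H.Braided] (θ : G ⋙ F'' ⟶ F ⋙ H)
    [NatTrans.IsMonoidal θ] (g : G ≅ G₁ ⋙ G₂) (h : H ≅ H₁ ⋙ H₂) [NatTrans.IsMonoidal h.hom]
    (comm : ∀ p, θ.app p ≫ h.hom.app (F.obj p) =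
      F''.map (g.hom.app p) ≫ θ₂.app (G₁.obj p) ≫ H₂.map (θ₁.app p)) :
    NatTrans.IsMonoidal (mapComp G₁ H₁ θ₁ G₂ H₂ θ₂ G H θ g h comm).hom where
  unit := by
    refine (ofHom_comp (X := 𝟙_ _) (Y := (map G H θ).obj (𝟙_ _))
      (Z := (map G₂ H₂ θ₂).obj ((map G₁ H₁ θ₁).obj (𝟙_ _))) (ε H)
      (h.hom.app (𝟙_ Q))).symm.trans
      ((congrArg (ofHom (X := 𝟙_ (CokerObj F''))
        (Y := (map G₂ H₂ θ₂).obj ((map G₁ H₁ θ₁).obj (𝟙_ _))))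
      (NatTrans.IsMonoidal.unit (τ := h.hom))).trans ?_)
    have h1 := map_ofHom G₂ H₂ θ₂ (X := 𝟙_ _) (Y := (map G₁ H₁ θ₁).obj (𝟙_ _)) (ε H₁)
    refine Eq.trans ?_ (congrArg (fun t => ofHom (X := 𝟙_ (CokerObj F''))
      (Y := (map G₂ H₂ θ₂).obj (𝟙_ _)) (ε H₂) ≫ t) h1.symm)
    exact ofHom_comp (X := 𝟙_ (CokerObj F'')) (Y := (map G₂ H₂ θ₂).obj (𝟙_ _))
      (Z := (map G₂ H₂ θ₂).obj ((map G₁ H₁ θ₁).obj (𝟙_ _))) (ε H₂) (H₂.map (ε H₁))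
  tensor X Y := by
    refine (ofHom_comp (X := (map G H θ).obj X ⊗ (map G H θ).obj Y)
      (Y := (map G H θ).obj (X ⊗ Y)) (Z := (map G₂ H₂ θ₂).obj ((map G₁ H₁ θ₁).obj (X ⊗ Y)))
      (μ H X.as Y.as) (h.hom.app (X.as ⊗ Y.as))).symm.trans
      ((congrArg (ofHom (X := (map G H θ).obj X ⊗ (map G H θ).obj Y)
        (Y := (map G₂ H₂ θ₂).obj ((map G₁ H₁ θ₁).obj (X ⊗ Y))))
      (NatTrans.IsMonoidal.tensor (τ := h.hom) X.as Y.as)).trans ?_)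
    have h1 := map_ofHom G₂ H₂ θ₂ (X := (map G₁ H₁ θ₁).obj X ⊗ (map G₁ H₁ θ₁).obj Y)
      (Y := (map G₁ H₁ θ₁).obj (X ⊗ Y)) (μ H₁ X.as Y.as)
    have h2 := ofHom_comp (X := (map G₂ H₂ θ₂).obj ((map G₁ H₁ θ₁).obj X) ⊗
        (map G₂ H₂ θ₂).obj ((map G₁ H₁ θ₁).obj Y))
      (Y := (map G₂ H₂ θ₂).obj ((map G₁ H₁ θ₁).obj X ⊗ (map G₁ H₁ θ₁).obj Y))
      (Z := (map G₂ H₂ θ₂).obj ((map G₁ H₁ θ₁).obj (X ⊗ Y)))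
      (μ H₂ (H₁.obj X.as) (H₁.obj Y.as)) (H₂.map (μ H₁ X.as Y.as))
    have h3 := h2.trans (congrArg (fun t => ofHom (X := (map G₂ H₂ θ₂).obj ((map G₁ H₁ θ₁).obj X) ⊗
        (map G₂ H₂ θ₂).obj ((map G₁ H₁ θ₁).obj Y))
      (Y := (map G₂ H₂ θ₂).obj ((map G₁ H₁ θ₁).obj X ⊗ (map G₁ H₁ θ₁).obj Y))
      (μ H₂ (H₁.obj X.as) (H₁.obj Y.as)) ≫ t) h1.symm)
    have h4 := ofHom_tensorHom (X := (map G H θ).obj X) (X' := (map G H θ).obj Y)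
      (Y := (map G₂ H₂ θ₂).obj ((map G₁ H₁ θ₁).obj X))
      (Y' := (map G₂ H₂ θ₂).obj ((map G₁ H₁ θ₁).obj Y)) (h.hom.app X.as) (h.hom.app Y.as)
    refine Eq.trans ?_ (congrArg₂ (fun s t => s ≫ t) h4.symm h3)
    exact ofHom_comp (X := (map G H θ).obj X ⊗ (map G H θ).obj Y)
      (Y := (map G₂ H₂ θ₂).obj ((map G₁ H₁ θ₁).obj X) ⊗
        (map G₂ H₂ θ₂).obj ((map G₁ H₁ θ₁).obj Y))
      (Z := (map G₂ H₂ θ₂).obj ((map G₁ H₁ θ₁).obj (X ⊗ Y))) (h.hom.app X.as ⊗ₘ h.hom.app Y.as) _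

end CokerObj
end Coker

section Ker
open Functor.LaxMonoidal Functor.OplaxMonoidal Functor.Monoidal

variable {P : Type u₁} [Category.{v₁} P] [MonoidalCategory P] [SymmetricCategory P]
  {Q : Type u₂} [Category.{v₂} Q] [MonoidalCategory Q] [SymmetricCategory Q]
  {P' : Type u₁'} [Category.{v₁'} P'] [MonoidalCategory P'] [SymmetricCategory P']
  {Q' : Type u₂'} [Category.{v₂'} Q'] [MonoidalCategory Q'] [SymmetricCategory Q']
  {P'' : Type u₁''} [Category.{v₁''} P''] [MonoidalCategory P''] [SymmetricCategory P'']
  {Q'' : Type u₂''} [Category.{v₂''} Q''] [MonoidalCategory Q''] [SymmetricCategory Q'']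

/-- Objects of the kernel of `F : P ⥤ Q`: pairs `(p, φ)` with `φ : F(p) ≅ e`. -/
structure KerObj (F : P ⥤ Q) where
  p : P
  φ : F.obj p ≅ 𝟙_ Q

namespace KerObj
variable {F : P ⥤ Q}

/-- Arrows `(p, φ) ⟶ (p', φ')` of the kernel: arrows `α : p ⟶ p'` with `φ' ∘ F(α) = φ`. -/
@[ext]
structure Hom (X Y : KerObj F) where
  hom : X.p ⟶ Y.p
  w : F.map hom ≫ Y.φ.hom = X.φ.hom

instance : Category (KerObj F) where
  Hom X Y := Hom X Y
  id X := ⟨𝟙 X.p, by simp⟩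
  comp f g := ⟨f.hom ≫ g.hom, by simp [f.w, g.w]⟩
  id_comp f := Hom.ext (Category.id_comp f.hom)
  comp_id f := Hom.ext (Category.comp_id f.hom)
  assoc f g h := Hom.ext (Category.assoc f.hom g.hom h.hom)

@[ext] lemma hom_ext {X Y : KerObj F} {f g : X ⟶ Y} (h : f.hom = g.hom) : f = g := Hom.ext h

@[simp] lemma id_hom (X : KerObj F) : Hom.hom (𝟙 X) = 𝟙 X.p := rfl
@[simp] lemma comp_hom {X Y Z : KerObj F} (f : X ⟶ Y) (g : Y ⟶ Z) :
    (f ≫ g).hom = f.hom ≫ g.hom := rfl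

/-- Isomorphisms in the kernel. -/
@[simps]
def isoMk {X Y : KerObj F} (e : X.p ≅ Y.p) (h : F.map e.hom ≫ Y.φ.hom = X.φ.hom) : X ≅ Y where
  hom := ⟨e.hom, h⟩
  inv := ⟨e.inv, by rw [← h, ← F.map_comp_assoc]; simp⟩
  hom_inv_id := Hom.ext e.hom_inv_id
  inv_hom_id := Hom.ext e.inv_hom_id

variable [F.Braided]

lemma tensor_w {X₁ Y₁ X₂ Y₂ : KerObj F} (f : X₁ ⟶ Y₁) (g : X₂ ⟶ Y₂) :
    F.map (f.hom ⊗ₘ g.hom) ≫ δ F _ _ ≫ (Y₁.φ.hom ⊗ₘ Y₂.φ.hom) ≫ (λ_ (𝟙_ Q)).hom =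
      δ F _ _ ≫ (X₁.φ.hom ⊗ₘ X₂.φ.hom) ≫ (λ_ (𝟙_ Q)).hom := by
  simp [← δ_natural_assoc, f.w, g.w]

instance : MonoidalCategoryStruct (KerObj F) where
  tensorObj X Y := ⟨X.p ⊗ Y.p, (μIso F X.p Y.p).symm ≪≫ (X.φ ⊗ᵢ Y.φ) ≪≫ λ_ (𝟙_ Q)⟩
  tensorUnit := ⟨𝟙_ P, (εIso F).symm⟩
  whiskerLeft X Y Z f := ⟨X.p ◁ f.hom, by
    simpa using tensor_w (𝟙 X) f⟩
  whiskerRight {X Y} f Z := ⟨f.hom ▷ Z.p, by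
    simpa using tensor_w f (𝟙 Z)⟩
  tensorHom {X₁ Y₁ X₂ Y₂} f g := ⟨f.hom ⊗ₘ g.hom, by simpa using tensor_w f g⟩
  associator X Y Z := isoMk (α_ X.p Y.p Z.p) (by
    have h := Functor.OplaxMonoidal.associativity F X.p Y.p Z.p
    simp only [Iso.trans_hom, Iso.symm_hom, μIso_inv, tensorIso_hom]
    simp only [MonoidalCategory.tensorHom_def, MonoidalCategory.whiskerLeft_comp, comp_whiskerRight,
      Category.assoc]
    rw [← whisker_exchange_assoc, ← reassoc_of% h]
    monoidal)
  leftUnitor X := isoMk (λ_ X.p) (by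
    simp only [Iso.trans_hom, Iso.symm_hom, μIso_inv, εIso_inv, tensorIso_hom]
    rw [← Functor.OplaxMonoidal.left_unitality_hom, MonoidalCategory.tensorHom_def]
    monoidal)
  rightUnitor X := isoMk (ρ_ X.p) (by
    simp only [Iso.trans_hom, Iso.symm_hom, μIso_inv, εIso_inv, tensorIso_hom]
    rw [← Functor.OplaxMonoidal.right_unitality_hom, MonoidalCategory.tensorHom_def']
    monoidal)

@[simp] lemma tensorObj_p (X Y : KerObj F) : (X ⊗ Y).p = X.p ⊗ Y.p := rfl
@[simp] lemma tensorObj_φ_hom (X Y : KerObj F) : (X ⊗ Y).φ.hom =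
    δ F X.p Y.p ≫ (X.φ.hom ⊗ₘ Y.φ.hom) ≫ (λ_ (𝟙_ Q)).hom := rfl
@[simp] lemma tensorUnit_p : (𝟙_ (KerObj F)).p = 𝟙_ P := rfl
@[simp] lemma tensorUnit_φ_hom : (𝟙_ (KerObj F)).φ.hom = η F := rfl
@[simp] lemma whiskerLeft_hom (X : KerObj F) {Y Z : KerObj F} (f : Y ⟶ Z) :
    (X ◁ f).hom = X.p ◁ f.hom := rfl
@[simp] lemma whiskerRight_hom (X : KerObj F) {Y Z : KerObj F} (f : Y ⟶ Z) :
    (f ▷ X).hom = f.hom ▷ X.p := rfl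
@[simp] lemma tensorHom_hom {X Y Z W : KerObj F} (f : X ⟶ Y) (g : Z ⟶ W) :
    (f ⊗ₘ g).hom = f.hom ⊗ₘ g.hom := rfl
@[simp] lemma associator_hom_hom (X Y Z : KerObj F) :
    (α_ X Y Z).hom.hom = (α_ X.p Y.p Z.p).hom := rfl
@[simp] lemma associator_inv_hom (X Y Z : KerObj F) :
    (α_ X Y Z).inv.hom = (α_ X.p Y.p Z.p).inv := rfl
@[simp] lemma leftUnitor_hom_hom (X : KerObj F) : (λ_ X).hom.hom = (λ_ X.p).hom := rfl
@[simp] lemma rightUnitor_hom_hom (X : KerObj F) : (ρ_ X).hom.hom = (ρ_ X.p).hom := rfl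

instance : MonoidalCategory (KerObj F) where
  tensorHom_def f g := hom_ext (MonoidalCategory.tensorHom_def f.hom g.hom)
  pentagon W X Y Z := hom_ext (MonoidalCategory.pentagon W.p X.p Y.p Z.p)
  associator_naturality f g h := hom_ext (MonoidalCategory.associator_naturality f.hom g.hom h.hom)
  triangle X Y := hom_ext (MonoidalCategory.triangle X.p Y.p)

instance : BraidedCategory (KerObj F) where
  braiding X Y := isoMk (β_ X.p Y.p) (by
    have h := BraidedCategory.braiding_naturality X.φ.hom Y.φ.hom
    simp only [tensorObj_φ_hom, Functor.map_braiding, Category.assoc, μ_δ_assoc]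
    rw [← reassoc_of% h, braiding_tensorUnit_left]
    monoidal)
  hexagon_forward X Y Z := hom_ext (BraidedCategory.hexagon_forward X.p Y.p Z.p)
  hexagon_reverse X Y Z := hom_ext (BraidedCategory.hexagon_reverse X.p Y.p Z.p)

@[simp] lemma braiding_hom_hom (X Y : KerObj F) : (β_ X Y).hom.hom = (β_ X.p Y.p).hom := rfl

instance : SymmetricCategory (KerObj F) where
  symmetry X Y := hom_ext (SymmetricCategory.symmetry X.p Y.p)

instance [IsStrictPicard P] [IsStrictPicard Q] : IsStrictPicard (KerObj F) where
  all_isIso {X Y} f := (isoMk (asIso f.hom) f.w).isIso_hom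
  braiding_self X := hom_ext (IsStrictPicard.braiding_self X.p)
  exists_inverse X := by
    obtain ⟨y, ⟨e⟩⟩ := IsStrictPicard.exists_inverse X.p
    -- `F(y) ≅ 1 ⊗ F(y) ≅ F(x) ⊗ F(y) ≅ F(x ⊗ y) ≅ F(1) ≅ 1`
    refine ⟨⟨y, (λ_ _).symm ≪≫ whiskerRightIso X.φ.symm (F.obj y) ≪≫ μIso F X.p y ≪≫ F.mapIso e ≪≫
      (εIso F).symm⟩, ⟨isoMk (Y := 𝟙_ _) e ?_⟩⟩
    simp [MonoidalCategory.tensorHom_def]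

end KerObj
end Ker

section Ker
open Functor.LaxMonoidal Functor.OplaxMonoidal Functor.Monoidal

variable {P : Type u₁} [Category.{v₁} P] [MonoidalCategory P] [SymmetricCategory P]
  {Q : Type u₂} [Category.{v₂} Q] [MonoidalCategory Q] [SymmetricCategory Q]
  {P' : Type u₁'} [Category.{v₁'} P'] [MonoidalCategory P'] [SymmetricCategory P']
  {Q' : Type u₂'} [Category.{v₂'} Q'] [MonoidalCategory Q'] [SymmetricCategory Q']
  {P'' : Type u₁''} [Category.{v₁''} P''] [MonoidalCategory P''] [SymmetricCategory P'']
  {Q'' : Type u₂''} [Category.{v₂''} Q''] [MonoidalCategory Q''] [SymmetricCategory Q'']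

namespace KerObj
variable {F : P ⥤ Q} [F.Braided] {F' : P' ⥤ Q'} [F'.Braided] {F'' : P'' ⥤ Q''} [F''.Braided]

lemma eqToHom_hom {X Y : KerObj F} (h : X = Y) :
    (eqToHom h).hom = eqToHom (congrArg KerObj.p h) := by
  subst h
  rfl

section
variable (G : P ⥤ P') [G.Braided] (H : Q ⥤ Q') [H.Braided] (θ : G ⋙ F' ≅ F ⋙ H)

/-- The functor between kernels induced by a square which commutes up to an isomorphism. -/
@[reducible]
def map : KerObj F ⥤ KerObj F' where
  obj X := ⟨G.obj X.p, θ.app X.p ≪≫ H.mapIso X.φ ≪≫ (εIso H).symm⟩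
  map {X Y} f := ⟨G.map f.hom, by
    have := θ.hom.naturality f.hom
    dsimp at this ⊢
    rw [reassoc_of% this, ← H.map_comp_assoc, f.w]⟩
  map_id X := hom_ext (G.map_id _)
  map_comp f g := hom_ext (G.map_comp _ _)

variable [NatTrans.IsMonoidal θ.hom]

/-- `map` is symmetric monoidal. -/
def mapCore : (map G H θ).CoreMonoidal where
  εIso := isoMk (X := 𝟙_ _) (Y := (map G H θ).obj (𝟙_ _)) (εIso G) (by
    have h := NatTrans.IsMonoidal.unit (τ := θ.hom)
    change F'.map (ε G) ≫ θ.hom.app _ ≫ H.map (η F) ≫ η H = η F'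
    rw [← cancel_epi (ε F')]
    dsimp at h
    rw [Category.assoc] at h
    rw [reassoc_of% h]
    simp)
  μIso X Y := isoMk (X := (map G H θ).obj X ⊗ (map G H θ).obj Y)
    (Y := (map G H θ).obj (X ⊗ Y)) (μIso G X.p Y.p) (by
    have h := NatTrans.IsMonoidal.tensor (τ := θ.hom) X.p Y.p
    change F'.map (μ G X.p Y.p) ≫ θ.hom.app _ ≫ H.map (δ F X.p Y.p ≫ (X.φ.hom ⊗ₘ Y.φ.hom) ≫
      (λ_ (𝟙_ Q)).hom) ≫ η H = δ F' _ _ ≫ ((θ.hom.app X.p ≫ H.map X.φ.hom ≫ η H) ⊗ₘ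
        (θ.hom.app Y.p ≫ H.map Y.φ.hom ≫ η H)) ≫ (λ_ (𝟙_ Q')).hom
    rw [← cancel_epi (μ F' _ _), μ_δ_assoc]
    dsimp at h
    rw [Category.assoc] at h
    rw [reassoc_of% h, ← H.map_comp_assoc, μ_δ_assoc, H.map_comp, Category.assoc,
      ← μ_natural_assoc]
    simp only [← MonoidalCategory.tensorHom_comp_tensorHom, Category.assoc]
    congr 2
    rw [← Functor.OplaxMonoidal.left_unitality_hom, Category.assoc, μ_δ_assoc, MonoidalCategory.tensorHom_def,
      Category.assoc]
    monoidal)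
  μIso_hom_natural_left f W := hom_ext (μ_natural_left G f.hom W.p)
  μIso_hom_natural_right W f := hom_ext (μ_natural_right G W.p f.hom)
  associativity X Y Z := hom_ext (Functor.LaxMonoidal.associativity G X.p Y.p Z.p)
  left_unitality X := hom_ext (Functor.LaxMonoidal.left_unitality G X.p)
  right_unitality X := hom_ext (Functor.LaxMonoidal.right_unitality G X.p)

instance : (map G H θ).Monoidal := (mapCore G H θ).toMonoidal

@[simp] lemma ε_map_hom : (ε (map G H θ)).hom = ε G := rfl

@[simp] lemma μ_map_hom (X Y : KerObj F) : (μ (map G H θ) X Y).hom = μ G X.p Y.p := rfl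

instance : (map G H θ).Braided where
  braided X Y := hom_ext (Functor.LaxBraided.braided (F := G) X.p Y.p)

end

/-- The isomorphism `𝟙^* ≅ id` of functors on the kernel. -/
def mapId (G : P ⥤ P) [G.Braided] (H : Q ⥤ Q) [H.Braided] (θ : G ⋙ F ≅ F ⋙ H)
    (g : G ≅ 𝟭 P) (h : H ≅ 𝟭 Q) [NatTrans.IsMonoidal h.hom]
    (comm : ∀ p, θ.hom.app p ≫ h.hom.app (F.obj p) = F.map (g.hom.app p)) :
    map G H θ ≅ 𝟭 (KerObj F) :=
  NatIso.ofComponents (fun X => isoMk (X := (map G H θ).obj X) (Y := X) (g.app X.p) (by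
    have h1 := h.hom.naturality X.φ.hom
    have h2 := NatTrans.IsMonoidal.unit (τ := h.hom)
    have h3 : h.hom.app (𝟙_ Q) = η H := by
      rw [← cancel_epi (ε H)]
      simpa using h2
    dsimp at h1
    change F.map (g.hom.app X.p) ≫ X.φ.hom = θ.hom.app X.p ≫ H.map X.φ.hom ≫ η H
    rw [← comm, Category.assoc, ← h1, h3])) (fun f => hom_ext (g.hom.naturality f.hom))

/-- The isomorphism `(f g)^* ≅ g^* f^*` of functors on the kernel. -/
def mapComp (G₁ : P ⥤ P') [G₁.Braided] (H₁ : Q ⥤ Q') [H₁.Braided] (θ₁ : G₁ ⋙ F' ≅ F ⋙ H₁)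
    (G₂ : P' ⥤ P'') [G₂.Braided] (H₂ : Q' ⥤ Q'') [H₂.Braided]
    (θ₂ : G₂ ⋙ F'' ≅ F' ⋙ H₂)
    (G : P ⥤ P'') [G.Braided] (H : Q ⥤ Q'') [H.Braided] (θ : G ⋙ F'' ≅ F ⋙ H)
    (g : G ≅ G₁ ⋙ G₂) (h : H ≅ H₁ ⋙ H₂) [NatTrans.IsMonoidal h.hom]
    (comm : ∀ p, θ.hom.app p ≫ h.hom.app (F.obj p) =
      F''.map (g.hom.app p) ≫ θ₂.hom.app (G₁.obj p) ≫ H₂.map (θ₁.hom.app p)) :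
    map G H θ ≅ map G₁ H₁ θ₁ ⋙ map G₂ H₂ θ₂ :=
  NatIso.ofComponents (fun X => isoMk (X := (map G H θ).obj X)
      (Y := (map G₁ H₁ θ₁ ⋙ map G₂ H₂ θ₂).obj X) (g.app X.p) (by
    have h1 := h.hom.naturality X.φ.hom
    have h2 := NatTrans.IsMonoidal.unit (τ := h.hom)
    have h3 : h.hom.app (𝟙_ Q) ≫ H₂.map (η H₁) ≫ η H₂ = η H := by
      rw [← cancel_epi (ε H), reassoc_of% h2]
      simp
    have h4 := comm X.p
    dsimp at h1 h2 h4
    change F''.map (g.hom.app X.p) ≫ θ₂.hom.app (G₁.obj X.p) ≫ H₂.map (θ₁.hom.app X.p ≫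
      H₁.map X.φ.hom ≫ η H₁) ≫ η H₂ = θ.hom.app X.p ≫ H.map X.φ.hom ≫ η H
    rw [Functor.map_comp, Functor.map_comp]
    simp only [Category.assoc]
    rw [← reassoc_of% h4, ← reassoc_of% h1, h3])) (fun f => hom_ext (g.hom.naturality f.hom))

instance (G : P ⥤ P) [G.Braided] (H : Q ⥤ Q) [H.Braided] (θ : G ⋙ F ≅ F ⋙ H)
    [NatTrans.IsMonoidal θ.hom] (g : G ≅ 𝟭 P) [NatTrans.IsMonoidal g.hom] (h : H ≅ 𝟭 Q)
    [NatTrans.IsMonoidal h.hom]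
    (comm : ∀ p, θ.hom.app p ≫ h.hom.app (F.obj p) = F.map (g.hom.app p)) :
    NatTrans.IsMonoidal (mapId G H θ g h comm).hom where
  unit := hom_ext (NatTrans.IsMonoidal.unit (τ := g.hom))
  tensor X Y := hom_ext (NatTrans.IsMonoidal.tensor (τ := g.hom) X.p Y.p)

instance (G₁ : P ⥤ P') [G₁.Braided] (H₁ : Q ⥤ Q') [H₁.Braided] (θ₁ : G₁ ⋙ F' ≅ F ⋙ H₁)
    [NatTrans.IsMonoidal θ₁.hom] (G₂ : P' ⥤ P'') [G₂.Braided] (H₂ : Q' ⥤ Q'') [H₂.Braided]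
    (θ₂ : G₂ ⋙ F'' ≅ F' ⋙ H₂) [NatTrans.IsMonoidal θ₂.hom]
    (G : P ⥤ P'') [G.Braided] (H : Q ⥤ Q'') [H.Braided] (θ : G ⋙ F'' ≅ F ⋙ H)
    [NatTrans.IsMonoidal θ.hom] (g : G ≅ G₁ ⋙ G₂) [NatTrans.IsMonoidal g.hom]
    (h : H ≅ H₁ ⋙ H₂) [NatTrans.IsMonoidal h.hom]
    (comm : ∀ p, θ.hom.app p ≫ h.hom.app (F.obj p) =
      F''.map (g.hom.app p) ≫ θ₂.hom.app (G₁.obj p) ≫ H₂.map (θ₁.hom.app p)) :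
    NatTrans.IsMonoidal (mapComp G₁ H₁ θ₁ G₂ H₂ θ₂ G H θ g h comm).hom where
  unit := hom_ext (NatTrans.IsMonoidal.unit (τ := g.hom))
  tensor X Y := hom_ext (NatTrans.IsMonoidal.tensor (τ := g.hom) X.p Y.p)

end KerObj
end Ker

section TwoTerm

/-- The Picard category of a homomorphism of abelian groups `d : A → B`: the objects are the
elements of `B`, the arrows `x ⟶ y` are the `k` in `A` with `d k = y - x`. -/
structure TwoTerm {A B : Type w} [AddCommGroup A] [AddCommGroup B] (d : A →+ B) where
  as : B

namespace TwoTerm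
variable {A B : Type w} [AddCommGroup A] [AddCommGroup B] {d : A →+ B}
  {A' B' : Type w} [AddCommGroup A'] [AddCommGroup B'] {d' : A' →+ B'}

/-- Arrows `x ⟶ y` are the elements `k` with `d k = y - x`. -/
@[ext]
structure Hom (x y : TwoTerm d) where
  k : A
  w : d k = y.as - x.as

instance : Category (TwoTerm d) where
  Hom x y := Hom x y
  id x := ⟨0, by simp⟩
  comp f g := ⟨f.k + g.k, by rw [map_add, f.w, g.w]; abel⟩
  id_comp f := Hom.ext (zero_add f.k)
  comp_id f := Hom.ext (add_zero f.k)
  assoc f g h := Hom.ext (add_assoc f.k g.k h.k)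

@[ext] lemma hom_ext {x y : TwoTerm d} {f g : x ⟶ y} (h : f.k = g.k) : f = g := Hom.ext h

@[simp] lemma id_k (x : TwoTerm d) : Hom.k (𝟙 x) = 0 := rfl
@[simp] lemma comp_k {x y z : TwoTerm d} (f : x ⟶ y) (g : y ⟶ z) : (f ≫ g).k = f.k + g.k := rfl

/-- The isomorphism given by `0` between equal objects. -/
@[simps]
def isoOfEq {x y : TwoTerm d} (h : x.as = y.as) : x ≅ y where
  hom := ⟨0, by simp [h]⟩
  inv := ⟨0, by simp [h]⟩

lemma eqToHom_k {x y : TwoTerm d} (h : x = y) : (eqToHom h).k = 0 := by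
  subst h
  rfl

instance : MonoidalCategoryStruct (TwoTerm d) where
  tensorObj x y := ⟨x.as + y.as⟩
  tensorUnit := ⟨0⟩
  tensorHom {x₁ y₁ x₂ y₂} f g := ⟨f.k + g.k, by
    change _ = y₁.as + y₂.as - (x₁.as + x₂.as)
    rw [map_add, f.w, g.w]
    abel⟩
  whiskerLeft x y₁ y₂ f := ⟨f.k, f.w.trans (add_sub_add_left_eq_sub y₂.as y₁.as x.as).symm⟩
  whiskerRight {x₁ x₂} f y := ⟨f.k, f.w.trans (add_sub_add_right_eq_sub x₂.as x₁.as y.as).symm⟩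
  associator x y z := isoOfEq (add_assoc _ _ _)
  leftUnitor x := isoOfEq (zero_add _)
  rightUnitor x := isoOfEq (add_zero _)

@[simp] lemma tensorObj_as (x y : TwoTerm d) : (x ⊗ y).as = x.as + y.as := rfl
@[simp] lemma tensorUnit_as : (𝟙_ (TwoTerm d)).as = 0 := rfl
@[simp] lemma tensorHom_k {x y x' y' : TwoTerm d} (f : x ⟶ y) (g : x' ⟶ y') :
    (f ⊗ₘ g).k = f.k + g.k := rfl
@[simp] lemma whiskerLeft_k (x : TwoTerm d) {y z : TwoTerm d} (f : y ⟶ z) :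
    (x ◁ f).k = f.k := rfl
@[simp] lemma whiskerRight_k (x : TwoTerm d) {y z : TwoTerm d} (f : y ⟶ z) :
    (f ▷ x).k = f.k := rfl
@[simp] lemma associator_hom_k (x y z : TwoTerm d) : (α_ x y z).hom.k = 0 := rfl
@[simp] lemma associator_inv_k (x y z : TwoTerm d) : (α_ x y z).inv.k = 0 := rfl
@[simp] lemma leftUnitor_hom_k (x : TwoTerm d) : (λ_ x).hom.k = 0 := rfl
@[simp] lemma rightUnitor_hom_k (x : TwoTerm d) : (ρ_ x).hom.k = 0 := rfl

instance : MonoidalCategory (TwoTerm d) where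
  tensorHom_comp_tensorHom _ _ _ _ := by
    ext
    simp only [comp_k, tensorHom_k]
    abel
  associator_naturality _ _ _ := by
    ext
    simp only [comp_k, tensorHom_k, associator_hom_k]
    abel

instance : BraidedCategory (TwoTerm d) where
  braiding x y := isoOfEq (add_comm _ _)

@[simp] lemma braiding_hom_k (x y : TwoTerm d) : (β_ x y).hom.k = 0 := rfl

instance : SymmetricCategory (TwoTerm d) where

instance : IsStrictPicard (TwoTerm d) where
  all_isIso f := ⟨⟨⟨-f.k, by rw [map_neg, f.w]; abel⟩, hom_ext (add_neg_cancel f.k),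
    hom_ext (neg_add_cancel f.k)⟩⟩
  braiding_self x := rfl
  exists_inverse x := ⟨⟨-x.as⟩, ⟨isoOfEq (add_neg_cancel x.as)⟩⟩

/-- The functor induced by a commutative square of abelian groups. -/
@[simps]
def map (a : A →+ A') (b : B →+ B') (h : ∀ k, d' (a k) = b (d k)) : TwoTerm d ⥤ TwoTerm d' where
  obj x := ⟨b x.as⟩
  map f := ⟨a f.k, by rw [h, f.w, map_sub]⟩

variable (a : A →+ A') (b : B →+ B') (h : ∀ k, d' (a k) = b (d k))

/-- `map` is symmetric monoidal. -/
def mapCore : (map a b h).CoreMonoidal where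
  εIso := isoOfEq (map_zero b).symm
  μIso x y := isoOfEq (map_add b _ _).symm
  μIso_hom_natural_left f _ := hom_ext ((add_zero (a f.k)).trans (zero_add (a f.k)).symm)
  μIso_hom_natural_right _ f := hom_ext ((add_zero (a f.k)).trans (zero_add (a f.k)).symm)
  left_unitality x := hom_ext (by
    change (0 : A') = 0 + (0 + a 0)
    simp)
  right_unitality x := hom_ext (by
    change (0 : A') = 0 + (0 + a 0)
    simp)

instance mapMonoidal : (map a b h).Monoidal := (mapCore a b h).toMonoidal

open Functor.LaxMonoidal in
@[simp] lemma ε_map_k : (ε (map a b h)).k = 0 := rfl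

open Functor.LaxMonoidal in
@[simp] lemma μ_map_k (x y : TwoTerm d) : (μ (map a b h) x y).k = 0 := rfl

instance mapBraided : (map a b h).Braided where

/-- Natural isomorphisms given by `0`. -/
def natIso {Φ Ψ : TwoTerm d ⥤ TwoTerm d'} (e : ∀ x, (Φ.obj x).as = (Ψ.obj x).as)
    (e' : ∀ {x y : TwoTerm d} (f : x ⟶ y), (Φ.map f).k = (Ψ.map f).k) : Φ ≅ Ψ :=
  NatIso.ofComponents (fun x => isoOfEq (e x)) (fun f => by ext; simp [e'])

@[simp] lemma natIso_hom_app_k {Φ Ψ : TwoTerm d ⥤ TwoTerm d'}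
    (e : ∀ x, (Φ.obj x).as = (Ψ.obj x).as)
    (e' : ∀ {x y : TwoTerm d} (f : x ⟶ y), (Φ.map f).k = (Ψ.map f).k) (x : TwoTerm d) :
    ((natIso e e').hom.app x).k = 0 := rfl

@[simp] lemma natIso_inv_app_k {Φ Ψ : TwoTerm d ⥤ TwoTerm d'}
    (e : ∀ x, (Φ.obj x).as = (Ψ.obj x).as)
    (e' : ∀ {x y : TwoTerm d} (f : x ⟶ y), (Φ.map f).k = (Ψ.map f).k) (x : TwoTerm d) :
    ((natIso e e').inv.app x).k = 0 := rfl

/-- Isomorphisms given by `0` are monoidal as soon as the structure isomorphisms of the functors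
are given by `0`. -/
lemma isMonoidal_of_k {Φ Ψ : TwoTerm d ⥤ TwoTerm d'} [Φ.LaxMonoidal] [Ψ.LaxMonoidal] (τ : Φ ⟶ Ψ)
    (h : ∀ x, (τ.app x).k = 0)
    (h₁ : (Functor.LaxMonoidal.ε Φ).k = 0) (h₂ : (Functor.LaxMonoidal.ε Ψ).k = 0)
    (h₃ : ∀ x y, (Functor.LaxMonoidal.μ Φ x y).k = 0)
    (h₄ : ∀ x y, (Functor.LaxMonoidal.μ Ψ x y).k = 0) : NatTrans.IsMonoidal τ where
  unit := by
    ext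
    simp [h, h₁, h₂]
  tensor x y := by
    ext
    simp [h, h₃, h₄]

/-- The identity homomorphisms induce the identity functor. -/
def mapId (a : A →+ A) (b : B →+ B) (h : ∀ k, d (a k) = b (d k)) (ha : ∀ k, a k = k)
    (hb : ∀ x, b x = x) : map a b h ≅ 𝟭 (TwoTerm d) :=
  natIso (fun x => hb x.as) (fun f => ha f.k)

instance (a : A →+ A) (b : B →+ B) (h : ∀ k, d (a k) = b (d k)) (ha : ∀ k, a k = k)
    (hb : ∀ x, b x = x) : NatTrans.IsMonoidal (mapId a b h ha hb).hom :=
  isMonoidal_of_k _ (fun _ => rfl) rfl rfl (fun _ _ => rfl) (fun _ _ => rfl)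

section Comp

variable {A₁ B₁ A₂ B₂ A₃ B₃ : Type w} [AddCommGroup A₁] [AddCommGroup B₁] [AddCommGroup A₂]
  [AddCommGroup B₂] [AddCommGroup A₃] [AddCommGroup B₃]
  {d₁ : A₁ →+ B₁} {d₂ : A₂ →+ B₂} {d₃ : A₃ →+ B₃}
  (a₁ : A →+ A₁) (b₁ : B →+ B₁) (h₁ : ∀ k, d₁ (a₁ k) = b₁ (d k))
  (a₂ : A₁ →+ A₂) (b₂ : B₁ →+ B₂) (h₂ : ∀ k, d₂ (a₂ k) = b₂ (d₁ k))

open Functor.LaxMonoidal in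
lemma ε_comp_k : (ε (map a₁ b₁ h₁ ⋙ map a₂ b₂ h₂)).k = 0 := by
  change 0 + a₂ 0 = 0
  simp

open Functor.LaxMonoidal in
lemma μ_comp_k (x y : TwoTerm d) : (μ (map a₁ b₁ h₁ ⋙ map a₂ b₂ h₂) x y).k = 0 := by
  change 0 + a₂ 0 = 0
  simp

/-- The compatibility with compositions. -/
def mapComp (a : A →+ A₂) (b : B →+ B₂) (h : ∀ k, d₂ (a k) = b (d k))
    (ha : ∀ k, a k = a₂ (a₁ k)) (hb : ∀ x, b x = b₂ (b₁ x)) :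
    map a b h ≅ map a₁ b₁ h₁ ⋙ map a₂ b₂ h₂ :=
  natIso (fun x => hb x.as) (fun f => ha f.k)

instance (a : A →+ A₂) (b : B →+ B₂) (h : ∀ k, d₂ (a k) = b (d k))
    (ha : ∀ k, a k = a₂ (a₁ k)) (hb : ∀ x, b x = b₂ (b₁ x)) :
    NatTrans.IsMonoidal (mapComp a₁ b₁ h₁ a₂ b₂ h₂ a b h ha hb).hom :=
  isMonoidal_of_k _ (fun _ => rfl) rfl (ε_comp_k ..) (fun _ _ => rfl) (fun _ _ => μ_comp_k ..)

/-- The natural isomorphism induced by a commutative square of squares. -/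
def mapSquare (a₃ : A →+ A₃) (b₃ : B →+ B₃) (h₃ : ∀ k, d₃ (a₃ k) = b₃ (d k))
    (a₄ : A₃ →+ A₂) (b₄ : B₃ →+ B₂) (h₄ : ∀ k, d₂ (a₄ k) = b₄ (d₃ k))
    (ha : ∀ k, a₂ (a₁ k) = a₄ (a₃ k)) (hb : ∀ x, b₂ (b₁ x) = b₄ (b₃ x)) :
    map a₁ b₁ h₁ ⋙ map a₂ b₂ h₂ ≅ map a₃ b₃ h₃ ⋙ map a₄ b₄ h₄ :=
  natIso (fun x => hb x.as) (fun f => ha f.k)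

instance mapSquare_isMonoidal (a₃ : A →+ A₃) (b₃ : B →+ B₃) (h₃ : ∀ k, d₃ (a₃ k) = b₃ (d k))
    (a₄ : A₃ →+ A₂) (b₄ : B₃ →+ B₂) (h₄ : ∀ k, d₂ (a₄ k) = b₄ (d₃ k))
    (ha : ∀ k, a₂ (a₁ k) = a₄ (a₃ k)) (hb : ∀ x, b₂ (b₁ x) = b₄ (b₃ x)) :
    NatTrans.IsMonoidal (mapSquare a₁ b₁ h₁ a₂ b₂ h₂ a₃ b₃ h₃ a₄ b₄ h₄ ha hb).hom :=
  isMonoidal_of_k _ (fun _ => rfl) (ε_comp_k ..) (ε_comp_k ..) (fun _ _ => μ_comp_k ..) (fun _ _ => μ_comp_k ..)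

end Comp

end TwoTerm
end TwoTerm

section Prestacks

open Bicategory


/-- A strictly commutative Picard prestack: a category fibred in groupoids over `C`, given as a
pseudofunctor, whose fibres are strictly commutative Picard categories, such that the pull-back
functors are symmetric monoidal and the isomorphisms `𝟙^* ≅ id` and `(f g)^* ≅ g^* f^*` are
compatible with the addition. (No descent condition is imposed.) -/
structure PicardPrestack (C : Type u) [Category.{v} C] where
  fib : LocallyDiscrete Cᵒᵖ ⥤ᵖ Cat.{w, w}
  [monoidal (X : LocallyDiscrete Cᵒᵖ) : MonoidalCategory (fib.obj X)]
  [symmetric (X : LocallyDiscrete Cᵒᵖ) : SymmetricCategory (fib.obj X)]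
  [picard (X : LocallyDiscrete Cᵒᵖ) : IsStrictPicard (fib.obj X)]
  [braided {X Y : LocallyDiscrete Cᵒᵖ} (f : X ⟶ Y) : (fib.map f).toFunctor.Braided]
  mapId_isMonoidal (X : LocallyDiscrete Cᵒᵖ) :
    NatTrans.IsMonoidal (F₁ := (fib.map (𝟙 X)).toFunctor) (F₂ := 𝟭 (fib.obj X))
      (fib.mapId X).hom.toNatTrans
  mapComp_isMonoidal {X Y Z : LocallyDiscrete Cᵒᵖ} (f : X ⟶ Y) (g : Y ⟶ Z) :
    NatTrans.IsMonoidal (F₁ := (fib.map (f ≫ g)).toFunctor)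
      (F₂ := (fib.map f).toFunctor ⋙ (fib.map g).toFunctor) (fib.mapComp f g).hom.toNatTrans

variable {C : Type u} [Category.{v} C]

namespace PicardPrestack

attribute [instance] monoidal symmetric picard braided

variable (P : PicardPrestack.{w} C)

/-- The pull-back functor between fibre categories. -/
abbrev pull {X Y : LocallyDiscrete Cᵒᵖ} (f : X ⟶ Y) : P.fib.obj X ⥤ P.fib.obj Y :=
  (P.fib.map f).toFunctor

/-- The isomorphism `𝟙^* ≅ id`. -/
def pullId (X : LocallyDiscrete Cᵒᵖ) : P.pull (𝟙 X) ≅ 𝟭 (P.fib.obj X) :=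
  Cat.Hom.toNatIso (P.fib.mapId X)

/-- The compatibility of pull-backs with composition. -/
def pullComp {X Y Z : LocallyDiscrete Cᵒᵖ} (f : X ⟶ Y) (g : Y ⟶ Z) :
    P.pull (f ≫ g) ≅ P.pull f ⋙ P.pull g :=
  Cat.Hom.toNatIso (P.fib.mapComp f g)

instance (X : LocallyDiscrete Cᵒᵖ) : NatTrans.IsMonoidal (P.pullId X).hom := P.mapId_isMonoidal X

instance {X Y Z : LocallyDiscrete Cᵒᵖ} (f : X ⟶ Y) (g : Y ⟶ Z) :
    NatTrans.IsMonoidal (P.pullComp f g).hom := P.mapComp_isMonoidal f g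

lemma pull_associator {X Y Z W : LocallyDiscrete Cᵒᵖ} (f : X ⟶ Y) (g : Y ⟶ Z) (h : Z ⟶ W)
    (x : P.fib.obj X) :
    (P.pullComp (f ≫ g) h).hom.app x ≫ (P.pull h).map ((P.pullComp f g).hom.app x) ≫
      (P.pullComp g h).inv.app ((P.pull f).obj x) ≫ (P.pullComp f (g ≫ h)).inv.app x =
    eqToHom (by simp) := by
  have h1 := P.fib.map₂_associator f g h
  rw [Strict.associator_eqToIso, eqToIso.hom, PrelaxFunctor.map₂_eqToHom] at h1
  have h2 := congrArg (fun t => t.toNatTrans.app x) h1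
  rw [Cat.eqToHom_app] at h2
  rw [h2]
  simp [pullComp]

lemma pull_leftUnitor {X Y : LocallyDiscrete Cᵒᵖ} (f : X ⟶ Y) (x : P.fib.obj X) :
    (P.pullComp (𝟙 X) f).hom.app x ≫ (P.pull f).map ((P.pullId X).hom.app x) =
    eqToHom (by simp) := by
  have h1 := P.fib.map₂_left_unitor f
  rw [Strict.leftUnitor_eqToIso, eqToIso.hom, PrelaxFunctor.map₂_eqToHom] at h1
  have h2 := congrArg (fun t => t.toNatTrans.app x) h1
  rw [Cat.eqToHom_app] at h2
  rw [h2]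
  simp [pullComp, pullId]

lemma pull_rightUnitor {X Y : LocallyDiscrete Cᵒᵖ} (f : X ⟶ Y) (x : P.fib.obj X) :
    (P.pullComp f (𝟙 Y)).hom.app x ≫ (P.pullId Y).hom.app ((P.pull f).obj x) =
    eqToHom (by simp) := by
  have h1 := P.fib.map₂_right_unitor f
  rw [Strict.rightUnitor_eqToIso, eqToIso.hom, PrelaxFunctor.map₂_eqToHom] at h1
  have h2 := congrArg (fun t => t.toNatTrans.app x) h1
  rw [Cat.eqToHom_app] at h2
  rw [h2]
  simp [pullComp, pullId]

end PicardPrestack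


namespace PicardPrestack

lemma eqToHom_toCatHom_app {A B : Type w} [Category.{w} A] [Category.{w} B] {F G : A ⥤ B}
    (h : F.toCatHom = G.toCatHom) (x : A) (h' : F.obj x = G.obj x) :
    (eqToHom h).toNatTrans.app x = eqToHom h' := by
  have : F = G := congrArg (fun t => t.toFunctor) h
  subst this
  rfl

section OfFibres

variable (Fib : LocallyDiscrete Cᵒᵖ → Type w) [∀ X, Category.{w} (Fib X)]
    (pull : ∀ {X Y : LocallyDiscrete Cᵒᵖ}, (X ⟶ Y) → Fib X ⥤ Fib Y)
    (pullId : ∀ X, pull (𝟙 X) ≅ 𝟭 (Fib X))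
    (pullComp : ∀ {X Y Z : LocallyDiscrete Cᵒᵖ} (f : X ⟶ Y) (g : Y ⟶ Z),
      pull (f ≫ g) ≅ pull f ⋙ pull g)
    (associator : ∀ {X Y Z W : LocallyDiscrete Cᵒᵖ} (f : X ⟶ Y) (g : Y ⟶ Z) (h : Z ⟶ W)
      (x : Fib X), (pullComp (f ≫ g) h).hom.app x ≫ (pull h).map ((pullComp f g).hom.app x) ≫
      (pullComp g h).inv.app ((pull f).obj x) ≫ (pullComp f (g ≫ h)).inv.app x =
        eqToHom (by simp))
    (leftUnitor : ∀ {X Y : LocallyDiscrete Cᵒᵖ} (f : X ⟶ Y) (x : Fib X),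
      (pullComp (𝟙 X) f).hom.app x ≫ (pull f).map ((pullId X).hom.app x) = eqToHom (by simp))
    (rightUnitor : ∀ {X Y : LocallyDiscrete Cᵒᵖ} (f : X ⟶ Y) (x : Fib X),
      (pullComp f (𝟙 Y)).hom.app x ≫ (pullId Y).hom.app ((pull f).obj x) = eqToHom (by simp))

/-- Constructor for pseudofunctors to categories from fibre categories, pull-back functors and
coherent isomorphisms. -/
def fibOfFibres : LocallyDiscrete Cᵒᵖ ⥤ᵖ Cat.{w, w} :=
  pseudofunctorOfIsLocallyDiscrete (fun X => Cat.of (Fib X)) (fun f => (pull f).toCatHom)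
    (fun X => Cat.Hom.isoMk (pullId X)) (fun f g => Cat.Hom.isoMk (pullComp f g))
    (fun {X Y Z W} f g h => by
      refine Cat.Hom₂.ext (NatTrans.ext (funext fun (x : Fib X) => ?_))
      refine Eq.trans ?_ ((associator f g h x).trans ?_)
      · change (pullComp (f ≫ g) h).hom.app x ≫ (pull h).map ((pullComp f g).hom.app x) ≫
          𝟙 _ ≫ (pullComp g h).inv.app ((pull f).obj x) ≫ (pullComp f (g ≫ h)).inv.app x = _
        rw [Category.id_comp]
      · exact (eqToHom_toCatHom_app (F := pull ((f ≫ g) ≫ h)) (G := pull (f ≫ g ≫ h)) _ x _).symm)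
    (fun {X Y} f => by
      refine Cat.Hom₂.ext (NatTrans.ext (funext fun (x : Fib X) => ?_))
      refine Eq.trans ?_ ((leftUnitor f x).trans ?_)
      · change (pullComp (𝟙 X) f).hom.app x ≫ (pull f).map ((pullId X).hom.app x) ≫ 𝟙 _ = _
        exact congrArg _ (Category.comp_id _)
      · exact (eqToHom_toCatHom_app (F := pull (𝟙 X ≫ f)) (G := pull f) _ x _).symm)
    (fun {X Y} f => by
      refine Cat.Hom₂.ext (NatTrans.ext (funext fun (x : Fib X) => ?_))
      refine Eq.trans ?_ ((rightUnitor f x).trans ?_)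
      · change (pullComp f (𝟙 Y)).hom.app x ≫ (pullId Y).hom.app ((pull f).obj x) ≫ 𝟙 _ = _
        exact congrArg _ (Category.comp_id _)
      · exact (eqToHom_toCatHom_app (F := pull (f ≫ 𝟙 Y)) (G := pull f) _ x _).symm)

/-- Constructor for Picard prestacks from Picard fibre categories, symmetric monoidal pull-back
functors and coherent monoidal isomorphisms. -/
def ofFibres [∀ X, MonoidalCategory (Fib X)] [∀ X, SymmetricCategory (Fib X)]
    [∀ X, IsStrictPicard (Fib X)]
    [∀ {X Y : LocallyDiscrete Cᵒᵖ} (f : X ⟶ Y), (pull f).Braided]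
    [∀ X, NatTrans.IsMonoidal (pullId X).hom]
    [∀ {X Y Z : LocallyDiscrete Cᵒᵖ} (f : X ⟶ Y) (g : Y ⟶ Z),
      NatTrans.IsMonoidal (pullComp f g).hom] : PicardPrestack.{w} C where
  fib := fibOfFibres Fib pull pullId pullComp associator leftUnitor rightUnitor
  monoidal X := inferInstanceAs (MonoidalCategory (Fib X))
  symmetric X := inferInstanceAs (SymmetricCategory (Fib X))
  picard X := inferInstanceAs (IsStrictPicard (Fib X))
  braided f := inferInstanceAs (pull f).Braided
  mapId_isMonoidal X := inferInstanceAs (NatTrans.IsMonoidal (pullId X).hom)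
  mapComp_isMonoidal f g := inferInstanceAs (NatTrans.IsMonoidal (pullComp f g).hom)

end OfFibres

end PicardPrestack

/-- An additive functor between Picard prestacks: a morphism of fibred categories (a strong
transformation of pseudofunctors) with symmetric monoidal structures on its components such that
the isomorphisms `F(f^* x) ≅ f^* F(x)` are compatible with the addition. -/
structure AdditiveFunctor (P Q : PicardPrestack.{w} C) where
  trans : P.fib.StrongTrans Q.fib
  [braided (X : LocallyDiscrete Cᵒᵖ) : (trans.app X).toFunctor.Braided]
  naturality_isMonoidal {X Y : LocallyDiscrete Cᵒᵖ} (f : X ⟶ Y) :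
    NatTrans.IsMonoidal (F₁ := P.pull f ⋙ (trans.app Y).toFunctor)
      (F₂ := (trans.app X).toFunctor ⋙ Q.pull f) (trans.naturality f).hom.toNatTrans

namespace AdditiveFunctor
attribute [instance] braided

variable {P Q R : PicardPrestack.{w} C} (F : AdditiveFunctor P Q)

/-- The functor between the fibres over `X`. -/
abbrev functor (X : LocallyDiscrete Cᵒᵖ) : P.fib.obj X ⥤ Q.fib.obj X := (F.trans.app X).toFunctor

/-- The isomorphism `F(f^* x) ≅ f^* F(x)`. -/
def nat {X Y : LocallyDiscrete Cᵒᵖ} (f : X ⟶ Y) :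
    P.pull f ⋙ F.functor Y ≅ F.functor X ⋙ Q.pull f := Cat.Hom.toNatIso (F.trans.naturality f)

instance {X Y : LocallyDiscrete Cᵒᵖ} (f : X ⟶ Y) : NatTrans.IsMonoidal (F.nat f).hom :=
  F.naturality_isMonoidal f

lemma nat_id {X : LocallyDiscrete Cᵒᵖ} (x : P.fib.obj X) :
    (F.nat (𝟙 X)).hom.app x ≫ (Q.pullId X).hom.app ((F.functor X).obj x) =
      (F.functor X).map ((P.pullId X).hom.app x) := by
  have := congrArg (fun t => t.toNatTrans.app x) (F.trans.naturality_id X)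
  simpa [nat, PicardPrestack.pullId, -Pseudofunctor.StrongTrans.naturality_id] using this

lemma nat_comp {X Y Z : LocallyDiscrete Cᵒᵖ} (f : X ⟶ Y) (g : Y ⟶ Z) (x : P.fib.obj X) :
    (F.nat (f ≫ g)).hom.app x ≫ (Q.pullComp f g).hom.app ((F.functor X).obj x) =
      (F.functor Z).map ((P.pullComp f g).hom.app x) ≫ (F.nat g).hom.app ((P.pull f).obj x) ≫
        (Q.pull g).map ((F.nat f).hom.app x) := by
  have := congrArg (fun t => t.toNatTrans.app x) (F.trans.naturality_comp f g)
  simpa [nat, PicardPrestack.pullComp, -Pseudofunctor.StrongTrans.naturality_comp] using this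

/-- The composite `G ∘ F` of additive functors. -/
def comp (F : AdditiveFunctor P Q) (G : AdditiveFunctor Q R) : AdditiveFunctor P R :=
  letI (X : LocallyDiscrete Cᵒᵖ) : ((F.trans.vcomp G.trans).app X).toFunctor.Braided :=
    inferInstanceAs (F.functor X ⋙ G.functor X).Braided
  { trans := F.trans.vcomp G.trans
    naturality_isMonoidal {X Y} f := inferInstanceAs (NatTrans.IsMonoidal
      ((Functor.associator (P.pull f) (F.functor Y) (G.functor Y)).inv ≫
        Functor.whiskerRight (F.nat f).hom (G.functor Y) ≫
        (Functor.associator (F.functor X) (Q.pull f) (G.functor Y)).hom ≫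
        Functor.whiskerLeft (F.functor X) (G.nat f).hom ≫
        (Functor.associator (F.functor X) (G.functor X) (R.pull f)).inv)) }

section OfFibres

variable (F : ∀ X, P.fib.obj X ⥤ Q.fib.obj X)
    (nat : ∀ {X Y : LocallyDiscrete Cᵒᵖ} (f : X ⟶ Y), P.pull f ⋙ F Y ≅ F X ⋙ Q.pull f)
    (nat_id : ∀ {X : LocallyDiscrete Cᵒᵖ} (x : P.fib.obj X),
      (nat (𝟙 X)).hom.app x ≫ (Q.pullId X).hom.app ((F X).obj x) =
        (F X).map ((P.pullId X).hom.app x))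
    (nat_comp : ∀ {X Y Z : LocallyDiscrete Cᵒᵖ} (f : X ⟶ Y) (g : Y ⟶ Z) (x : P.fib.obj X),
      (nat (f ≫ g)).hom.app x ≫ (Q.pullComp f g).hom.app ((F X).obj x) =
        (F Z).map ((P.pullComp f g).hom.app x) ≫ (nat g).hom.app ((P.pull f).obj x) ≫
          (Q.pull g).map ((nat f).hom.app x))

/-- Constructor for strong transformations from functors between the fibre categories and natural
isomorphisms satisfying the coherence conditions objectwise. -/
def transOfFibres : P.fib.StrongTrans Q.fib where
  app X := (F X).toCatHom
  naturality f := Cat.Hom.isoMk (nat f)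
  naturality_naturality {X Y f g} η := by
    obtain rfl := obj_ext_of_isDiscrete η
    obtain rfl : η = 𝟙 _ := Subsingleton.elim _ _
    rw [PrelaxFunctor.map₂_id, PrelaxFunctor.map₂_id]
    refine Cat.Hom₂.ext (NatTrans.ext (funext fun x => ?_))
    change (F Y).map (𝟙 _) ≫ (nat f).hom.app x = (nat f).hom.app x ≫ 𝟙 _
    rw [CategoryTheory.Functor.map_id, Category.id_comp, Category.comp_id]
  naturality_id X := by
    refine Cat.Hom₂.ext (NatTrans.ext (funext fun x => (nat_id x).trans ?_))
    change (F X).map _ = (F X).map _ ≫ 𝟙 _ ≫ 𝟙 _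
    rw [Category.comp_id, Category.comp_id]
    rfl
  naturality_comp {X Y Z} f g := by
    refine Cat.Hom₂.ext (NatTrans.ext (funext fun x => (nat_comp f g x).trans ?_))
    change (F Z).map ((P.pullComp f g).hom.app x) ≫ (nat g).hom.app ((P.pull f).obj x) ≫
      (Q.pull g).map ((nat f).hom.app x) = (F Z).map ((P.pullComp f g).hom.app x) ≫ 𝟙 _ ≫
        (nat g).hom.app ((P.pull f).obj x) ≫ 𝟙 _ ≫ (Q.pull g).map ((nat f).hom.app x) ≫ 𝟙 _
    rw [Category.id_comp, Category.id_comp, Category.comp_id]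

end OfFibres

/-- An isomorphism of additive functors (compatible with pull-backs and with the addition). -/
structure Iso (F G : AdditiveFunctor P Q) where
  iso (X : LocallyDiscrete Cᵒᵖ) : F.functor X ≅ G.functor X
  naturality {X Y : LocallyDiscrete Cᵒᵖ} (f : X ⟶ Y) (x : P.fib.obj X) :
    (iso Y).hom.app ((P.pull f).obj x) ≫ (G.nat f).hom.app x =
      (F.nat f).hom.app x ≫ (Q.pull f).map ((iso X).hom.app x)
  isMonoidal (X : LocallyDiscrete Cᵒᵖ) : NatTrans.IsMonoidal (iso X).hom

end AdditiveFunctor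



section CokerPre

variable {P Q : PicardPrestack.{w} C} (F : AdditiveFunctor P Q)

/-- The pull-back functors of the prestack `coker'(F)`. -/
abbrev cokerPull {X Y : LocallyDiscrete Cᵒᵖ} (f : X ⟶ Y) :
    CokerObj (F.functor X) ⥤ CokerObj (F.functor Y) :=
  CokerObj.map (P.pull f) (Q.pull f) (F.nat f).hom

/-- The Picard prestack `coker'(F)`: over `U` its objects are the objects of `Q(U)` and its arrows
`q ⟶ q'` are the isomorphism classes of pairs `(p, α)` with `p` in `P(U)` and
`α : q + F(p) ⟶ q'`. -/
def cokerPre : PicardPrestack.{w} C :=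
  PicardPrestack.ofFibres
    (fun X => CokerObj (F.functor X))
    (fun f => cokerPull F f)
    (fun X => CokerObj.mapId (P.pull (𝟙 X)) (Q.pull (𝟙 X)) (F.nat (𝟙 X)).hom
      (P.pullId X) (Q.pullId X) F.nat_id)
    (fun f g => CokerObj.mapComp (P.pull f) (Q.pull f) (F.nat f).hom
      (P.pull g) (Q.pull g) (F.nat g).hom (P.pull (f ≫ g)) (Q.pull (f ≫ g)) (F.nat (f ≫ g)).hom
      (P.pullComp f g) (Q.pullComp f g) (F.nat_comp f g))
    (fun {X Y Z W} f g h x => by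
      refine Eq.trans ?_ ((congrArg (CokerObj.ofHom
        (X := (cokerPull F ((f ≫ g) ≫ h)).obj x) (Y := (cokerPull F (f ≫ g ≫ h)).obj x))
        (Q.pull_associator f g h x.as)).trans (CokerObj.ofHom_eqToHom _))
      rw [CokerObj.ofHom_comp (Y := (cokerPull F h).obj ((cokerPull F (f ≫ g)).obj x)),
        CokerObj.ofHom_comp (X := (cokerPull F h).obj ((cokerPull F (f ≫ g)).obj x))
          (Y := (cokerPull F h).obj ((cokerPull F g).obj ((cokerPull F f).obj x))),
        CokerObj.ofHom_comp (X := (cokerPull F h).obj ((cokerPull F g).obj ((cokerPull F f).obj x)))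
          (Y := (cokerPull F (g ≫ h)).obj ((cokerPull F f).obj x)),
        ← CokerObj.map_ofHom (P.pull h) (Q.pull h) (F.nat h).hom
          (X := (cokerPull F (f ≫ g)).obj x) (Y := (cokerPull F g).obj ((cokerPull F f).obj x))]
      rfl)
    (fun {X Y} f x => by
      refine Eq.trans ?_ ((congrArg (CokerObj.ofHom
        (X := (cokerPull F (𝟙 X ≫ f)).obj x) (Y := (cokerPull F f).obj x))
        (Q.pull_leftUnitor f x.as)).trans (CokerObj.ofHom_eqToHom _))
      rw [CokerObj.ofHom_comp (Y := (cokerPull F f).obj ((cokerPull F (𝟙 X)).obj x)),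
        ← CokerObj.map_ofHom (P.pull f) (Q.pull f) (F.nat f).hom
          (X := (cokerPull F (𝟙 X)).obj x) (Y := x)]
      rfl)
    (fun {X Y} f x => by
      refine Eq.trans ?_ ((congrArg (CokerObj.ofHom
        (X := (cokerPull F (f ≫ 𝟙 Y)).obj x) (Y := (cokerPull F f).obj x))
        (Q.pull_rightUnitor f x.as)).trans (CokerObj.ofHom_eqToHom _))
      rw [CokerObj.ofHom_comp (Y := (cokerPull F (𝟙 Y)).obj ((cokerPull F f).obj x))]
      rfl)

end CokerPre


section KerPre

variable {P Q : PicardPrestack.{w} C} (F : AdditiveFunctor P Q)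

/-- The pull-back functors of the kernel. -/
abbrev kerPull {X Y : LocallyDiscrete Cᵒᵖ} (f : X ⟶ Y) :
    KerObj (F.functor X) ⥤ KerObj (F.functor Y) :=
  KerObj.map (P.pull f) (Q.pull f) (F.nat f)

/-- The kernel of `F`: over `U` its objects are the pairs `(p, φ)` with `p` in `P(U)` and
`φ : F(p) ≅ e`. -/
def ker : PicardPrestack.{w} C :=
  PicardPrestack.ofFibres
    (fun X => KerObj (F.functor X))
    (fun f => kerPull F f)
    (fun X => KerObj.mapId (P.pull (𝟙 X)) (Q.pull (𝟙 X)) (F.nat (𝟙 X))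
      (P.pullId X) (Q.pullId X) F.nat_id)
    (fun f g => KerObj.mapComp (P.pull f) (Q.pull f) (F.nat f)
      (P.pull g) (Q.pull g) (F.nat g) (P.pull (f ≫ g)) (Q.pull (f ≫ g)) (F.nat (f ≫ g))
      (P.pullComp f g) (Q.pullComp f g) (F.nat_comp f g))
    (fun f g h x => KerObj.hom_ext
      ((P.pull_associator f g h x.p).trans (KerObj.eqToHom_hom
        (X := (kerPull F ((f ≫ g) ≫ h)).obj x) (Y := (kerPull F (f ≫ g ≫ h)).obj x) _).symm))
    (fun f x => KerObj.hom_ext ((P.pull_leftUnitor f x.p).trans (KerObj.eqToHom_hom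
      (X := (kerPull F (𝟙 _ ≫ f)).obj x) (Y := (kerPull F f).obj x) _).symm))
    (fun f x => KerObj.hom_ext ((P.pull_rightUnitor f x.p).trans
      (KerObj.eqToHom_hom
      (X := (kerPull F (f ≫ 𝟙 _)).obj x) (Y := (kerPull F f).obj x) _).symm))

end KerPre

section Pst

variable {J : GrothendieckTopology C} (K L : CochainComplex (Sheaf J AddCommGrpCat.{w}) ℤ)

/-- The differential `K⁻¹(U) → K⁰(U)`. -/
abbrev diff (X : LocallyDiscrete Cᵒᵖ) :
    (K.X (-1)).obj.obj X.as →+ (K.X 0).obj.obj X.as :=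
  ((K.d (-1) 0).hom.app X.as).hom

/-- The restriction functors of `pst(K)`. -/
abbrev pstPull {X Y : LocallyDiscrete Cᵒᵖ} (f : X ⟶ Y) :
    TwoTerm (diff K X) ⥤ TwoTerm (diff K Y) :=
  TwoTerm.map ((K.X (-1)).obj.map f.as).hom ((K.X 0).obj.map f.as).hom
    (fun k => ConcreteCategory.congr_hom ((K.d (-1) 0).hom.naturality f.as) k)

/-- The Picard prestack `pst(K)`: over `U` its objects are the elements of `K⁰(U)` and its arrows
`x ⟶ y` are the elements `k` of `K⁻¹(U)` with `d k = y - x`. -/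
def pst (K : CochainComplex (Sheaf J AddCommGrpCat.{w}) ℤ) : PicardPrestack.{w} C :=
  PicardPrestack.ofFibres (fun X => TwoTerm (diff K X)) (fun f => pstPull K f)
    (fun X => TwoTerm.mapId _ _ _
      (fun k => ConcreteCategory.congr_hom ((K.X (-1)).obj.map_id X.as) k)
      (fun x => ConcreteCategory.congr_hom ((K.X 0).obj.map_id X.as) x))
    (fun f g => TwoTerm.mapComp _ _ _ _ _ _ _ _ _
      (fun k => ConcreteCategory.congr_hom ((K.X (-1)).obj.map_comp f.as g.as) k)
      (fun x => ConcreteCategory.congr_hom ((K.X 0).obj.map_comp f.as g.as) x))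
    (fun {X Y Z W} f g h x => TwoTerm.hom_ext (by
      rw [TwoTerm.eqToHom_k]
      change 0 + (((K.X (-1)).obj.map h.as).hom 0 + (0 + 0)) = 0
      simp))
    (fun f x => TwoTerm.hom_ext (by
      rw [TwoTerm.eqToHom_k]
      change 0 + ((K.X (-1)).obj.map f.as).hom 0 = 0
      simp))
    (fun f x => TwoTerm.hom_ext (by
      rw [TwoTerm.eqToHom_k]
      change 0 + 0 = 0
      simp))

variable {K L}

/-- The functors between the fibre categories induced by a morphism of complexes. -/
abbrev pstMapFib (f : K ⟶ L) (X : LocallyDiscrete Cᵒᵖ) :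
    TwoTerm (diff K X) ⥤ TwoTerm (diff L X) :=
  TwoTerm.map ((f.f (-1)).hom.app X.as).hom ((f.f 0).hom.app X.as).hom
    (fun k => ConcreteCategory.congr_hom
      (congrArg (fun t => t.hom.app X.as) (f.comm (-1) 0)) k)

/-- The compatibility of these functors with restrictions. -/
abbrev pstMapNat (f : K ⟶ L) {X Y : LocallyDiscrete Cᵒᵖ} (g : X ⟶ Y) :
    pstPull K g ⋙ pstMapFib f Y ≅ pstMapFib f X ⋙ pstPull L g :=
  TwoTerm.mapSquare _ _ _ _ _ _ _ _ _ _ _ _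
    (fun k => ConcreteCategory.congr_hom ((f.f (-1)).hom.naturality g.as) k)
    (fun x => ConcreteCategory.congr_hom ((f.f 0).hom.naturality g.as) x)

instance pstMapFib_braided (f : K ⟶ L) (X : LocallyDiscrete Cᵒᵖ) : (pstMapFib f X).Braided :=
  TwoTerm.mapBraided _ _ _

instance pstMapNat_isMonoidal (f : K ⟶ L) {X Y : LocallyDiscrete Cᵒᵖ} (g : X ⟶ Y) :
    NatTrans.IsMonoidal (pstMapNat f g).hom :=
  TwoTerm.mapSquare_isMonoidal ..

/-- The strong transformation underlying `pst(f)`. -/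
def pstTrans (f : K ⟶ L) : (pst K).fib.StrongTrans (pst L).fib :=
  AdditiveFunctor.transOfFibres (P := pst K) (Q := pst L)
    (fun X => pstMapFib f X) (fun g => pstMapNat f g)
    (fun {X} x => TwoTerm.hom_ext (by
      change 0 + 0 = ((f.f (-1)).hom.app X.as).hom 0
      simp))
    (fun {X Y Z} g h x => TwoTerm.hom_ext (by
      change 0 + 0 = ((f.f (-1)).hom.app Z.as).hom 0 +
        (0 + ((L.X (-1)).obj.map h.as).hom 0)
      simp))

/-- The additive functor `pst(f)`. -/
def pstMap (f : K ⟶ L) : AdditiveFunctor (pst K) (pst L) where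
  trans := pstTrans f
  braided X := pstMapFib_braided f X
  naturality_isMonoidal g := pstMapNat_isMonoidal f g

end Pst

/-- The additive functor `j : P ⟶ A` exhibits `A` as the stack generated by the prestack `P`:
`A` is a stack, `j` induces an isomorphism from the sheaf associated with `Hom(x, y)` to the sheaf
`Hom(j(x), j(y))` for all local objects `x`, `y`, and every object of `A` is locally isomorphic to
an object in the image of `j`. -/
structure IsGenerated (J : GrothendieckTopology C) {P A : PicardPrestack.{w} C}
    (j : AdditiveFunctor P A) : Prop where
  isStack : A.fib.IsStack J
  locally_faithful {X : LocallyDiscrete Cᵒᵖ} {x y : P.fib.obj X} (a b : x ⟶ y)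
    (h : (j.functor X).map a = (j.functor X).map b) :
    ∃ S ∈ J X.as.unop, ∀ ⦃V : C⦄ (f : V ⟶ X.as.unop), S f →
      (P.pull f.op.toLoc).map a = (P.pull f.op.toLoc).map b
  locally_full {X : LocallyDiscrete Cᵒᵖ} {x y : P.fib.obj X}
    (a : (j.functor X).obj x ⟶ (j.functor X).obj y) :
    ∃ S ∈ J X.as.unop, ∀ ⦃V : C⦄ (f : V ⟶ X.as.unop), S f →
      ∃ b : (P.pull f.op.toLoc).obj x ⟶ (P.pull f.op.toLoc).obj y,
        (j.functor _).map b ≫ (j.nat f.op.toLoc).hom.app y =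
          (j.nat f.op.toLoc).hom.app x ≫ (A.pull f.op.toLoc).map a
  locally_essSurj {X : LocallyDiscrete Cᵒᵖ} (a : A.fib.obj X) :
    ∃ S ∈ J X.as.unop, ∀ ⦃V : C⦄ (f : V ⟶ X.as.unop), S f →
      ∃ x : P.fib.obj (.mk (op V)),
        Nonempty ((j.functor _).obj x ≅ (A.pull f.op.toLoc).obj a)


end Prestacks

end PicardStack

/-! Both stack assertions reduce to assertions about `pst`. Exhibiting a stack as generated by a
prestack means being a local equivalence (locally faithful, locally full, locally essentially
surjective: `IsLocalEquiv`) whose target is a stack, and local equivalences compose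
(`IsLocalEquiv.comp`). The isomorphism F ∘ j_K ≅ j_L ∘ pst(f) is a square in which j_K and j_L are
local equivalences. It induces additive functors ker(pst f) → ker(F) and coker'(pst f) → coker'(F),
and these are again local equivalences (`kerMap_isLocalEquiv`, `cokerMap_isLocalEquiv`), because an
object, an arrow, a trivialization or a pair lifts locally along j_K and j_L. It remains to compare
ker(pst f) and coker'(pst f) with the truncated cones.

Kernel. An object of ker(pst f) over U consists of x in K⁰(U) and an arrow f⁰(x) → 0, that is, some
y in L⁻¹(U) with d y = -f⁰(x). Thus (y, x) is a section of the kernel of (d^L, f⁰). Taking sections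
is left exact, so the comparison with the truncation is already an equivalence on each fibre
(`KerDatum.toKer_isLocalEquiv`, `exists_isLocalEquiv_ker`). That ker(F) is a stack is a direct
descent argument (`ker_isStack`): objects and arrows glue in the source of F, and the
trivializations, being arrows in the target, glue there.

Cokernel. Arrows of coker'(pst f) over U are given by sections of N = L⁻¹ ⊕ K⁰ modulo the image of
K⁻¹(U) under (f⁻¹, -d^K), a quotient of presheaves. The arrows of pst(τ_{≥-1}) are given by sections
of the cokernel sheaf M, which lift to N only locally, so a functor from pst(τ_{≥-1}) can be
expected only after passing from coker' to a stack A. The prestack of N → L⁰ does map to coker'(pst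
f) (`CokerDatum.toCoker`), hence to A. This functor extends along N → M: lift a section of M locally
to N, take the images in A, and glue them. The images do not depend on the lift, because two lifts
differ locally by a section of K⁻¹, and A is a prestack (`FactorDatum.exists_represents`,
`FactorDatum.factor`). The extension is a local equivalence (`exists_isLocalEquiv_coker`).

Complexes. The cone has the terms K⁻¹ → L⁻¹ ⊕ K⁰ → L⁰ in degrees -2, -1, 0
(`exists_mappingCone_isos`). Its truncation in degrees ≥ -1 replaces the middle term by the cokernel
of the incoming differential, and the truncation of the shift in degrees ≤ 0 replaces it by the
kernel of the outgoing one. These identifications give part 3 and also feed the comparisons above.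
-/

section
-- Truncation morphisms, degree by degree
open Limits HomologicalComplex
variable {ι ι' : Type*} {c : ComplexShape ι} {c' : ComplexShape ι'} {A : Type*} [Category* A]
  [HasZeroMorphisms A] [HasZeroObject A] (K : HomologicalComplex A c') (e : c.Embedding c')
  [∀ i', K.HasHomology i']

/-- In the boundary degree the truncation has the opcycles as its term; away from it (next lemma)
nothing is changed. -/
lemma πTruncGE_f_eq_pOpcycles [e.IsTruncGE] {i : ι} {i' : ι'} (hi' : e.f i = i')
    (hi : e.BoundaryGE i) :
    (K.πTruncGE e).f i' = K.pOpcycles i' ≫ (K.truncGEXIsoOpcycles e hi' hi).inv := by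
  simp [HomologicalComplex.πTruncGE, ComplexShape.Embedding.liftExtend_f _ _ _ hi',
    restrictionToTruncGE'_f_eq_iso_hom_pOpcycles_iso_inv K e hi' hi,
    HomologicalComplex.truncGEXIsoOpcycles]
  rfl

lemma isIso_πTruncGE_f [e.IsTruncGE] {i : ι} {i' : ι'} (hi' : e.f i = i')
    (hi : ¬ e.BoundaryGE i) : IsIso ((K.πTruncGE e).f i') := by
  simp only [HomologicalComplex.πTruncGE, ComplexShape.Embedding.liftExtend_f _ _ _ hi',
    restrictionToTruncGE'_f_eq_iso_hom_iso_inv K e hi' hi, Category.assoc, Iso.inv_hom_id_assoc]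
  exact ((K.truncGE' e).extendXIso e hi' ≪≫ K.truncGE'XIso e hi' hi).isIso_inv

/-- Dual of the statement on `πTruncGE`, obtained by passing to the opposite complex, whose opcycles
are the cycles of `K`. -/
lemma ιTruncLE_f_eq_iCycles [e.IsTruncLE] {i : ι} {i' : ι'} (hi' : e.f i = i')
    (hi : e.BoundaryLE i) :
    (K.ιTruncLE e).f i' = (K.truncLEXIsoCycles e hi' hi).hom ≫ K.iCycles i' := by
  have h := πTruncGE_f_eq_pOpcycles K.op e.op hi' (by simpa)
  change ((K.op.πTruncGE e.op).f i').unop = _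
  rw [h]
  exact (congrArg (fun t => (K.op.truncGEXIsoOpcycles e.op hi' (by simpa)).inv.unop ≫ t)
    (((K.opcyclesOpIso i').unop.inv_hom_id_assoc _).symm.trans (congrArg
      (fun t => (K.opcyclesOpIso i').unop.inv ≫ t)
      (congrArg Quiver.Hom.unop (K.sc i').op_pOpcycles_opcyclesOpIso_hom)))).trans
    (Category.assoc _ _ _).symm

lemma isIso_ιTruncLE_f [e.IsTruncLE] {i : ι} {i' : ι'} (hi' : e.f i = i')
    (hi : ¬ e.BoundaryLE i) : IsIso ((K.ιTruncLE e).f i') := by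
  have h := isIso_πTruncGE_f K.op e.op hi' (by simpa)
  change IsIso ((K.op.πTruncGE e.op).f i').unop
  infer_instance
end

/-! ### The truncated mapping cone as a two-term complex -/

section
open Limits
variable {A : Type*} [Category* A] [Abelian A] (K L : CochainComplex A ℤ) (f : K ⟶ L)

lemma isIso_πTruncGE_f_of_lt (n i : ℤ) (h : n < i) : IsIso ((K.πTruncGE n).f i) := by
  obtain ⟨k, rfl⟩ := Int.le.dest h.le
  refine isIso_πTruncGE_f K (ComplexShape.embeddingUpIntGE n) (i := k) rfl ?_
  rw [ComplexShape.boundaryGE_embeddingUpIntGE_iff]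
  rintro rfl
  simp at h

lemma isIso_ιTruncLE_f_of_lt (n i : ℤ) (h : i < n) : IsIso ((K.ιTruncLE n).f i) := by
  obtain ⟨k, rfl⟩ := Int.le.dest h.le
  refine isIso_ιTruncLE_f K (ComplexShape.embeddingUpIntLE (i + k)) (i := k) (by simp) ?_
  rw [ComplexShape.boundaryLE_embeddingUpIntLE_iff]
  rintro rfl
  simp at h

/-- In degree `n`, the truncation `≥ n` is the cokernel of the differential. -/
noncomputable def isColimitπTruncGE (m n : ℤ) (h : m + 1 = n) :
    IsColimit (CokernelCofork.ofπ (f := K.d m n) ((K.πTruncGE n).f n) (by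
      rw [← (K.πTruncGE n).comm, (K.truncGE n).isZero_of_isStrictlyGE n m |>.eq_of_tgt
        ((K.πTruncGE n).f m) 0, zero_comp])) :=
  IsColimit.ofIsoColimit (K.opcyclesIsCokernel m n (by simp [← h]))
    (Cofork.ext (K.truncGEXIsoOpcycles n).symm
      (πTruncGE_f_eq_pOpcycles K (ComplexShape.embeddingUpIntGE n) (i := 0) _
        ((ComplexShape.boundaryGE_embeddingUpIntGE_iff n 0).2 rfl)).symm)

/-- In degree `n`, the truncation `≤ n` is the kernel of the differential. -/
noncomputable def isLimitιTruncLE (m n : ℤ) (h : n + 1 = m) :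
    IsLimit (KernelFork.ofι (f := K.d n m) ((K.ιTruncLE n).f n) (by
      rw [(K.ιTruncLE n).comm, (K.truncLE n).isZero_of_isStrictlyLE n m |>.eq_of_src
        ((K.ιTruncLE n).f m) 0, comp_zero])) :=
  IsLimit.ofIsoLimit (K.cyclesIsKernel n m (by simp [← h]))
    (Fork.ext (K.truncLEXIsoCycles n).symm (by
      refine (Iso.inv_comp_eq _).2 ?_
      exact ιTruncLE_f_eq_iCycles K (ComplexShape.embeddingUpIntLE n) (i := 0) _
        ((ComplexShape.boundaryLE_embeddingUpIntLE_iff n 0).2 rfl)))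

/-- Both complexes vanish outside degrees -1 and 0, so a morphism which is an isomorphism in these
two degrees is an isomorphism. -/
lemma nonempty_iso_double (T : CochainComplex A ℤ) [T.IsStrictlyGE (-1)] [T.IsStrictlyLE 0]
    {X Y : A} (d : X ⟶ Y) (e₁ : X ≅ T.X (-1)) (e₀ : Y ≅ T.X 0)
    (h : e₁.hom ≫ T.d (-1) 0 = d ≫ e₀.hom) (r : (ComplexShape.up ℤ).Rel (-1) 0) :
    Nonempty (T ≅ HomologicalComplex.double d r) := by
  let φ : HomologicalComplex.double d r ⟶ T :=
    HomologicalComplex.mkHomFromDouble r (by simp) e₁.hom e₀.hom h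
      (fun k hk => (T.isZero_of_isStrictlyLE 0 k (by simp at hk; lia)).eq_of_tgt _ _)
  have : ∀ i, IsIso (φ.f i) := by
    intro i
    by_cases h₁ : i = -1
    · subst h₁
      simp only [φ, HomologicalComplex.mkHomFromDouble_f₀]
      infer_instance
    by_cases h₀ : i = 0
    · subst h₀
      simp only [φ, HomologicalComplex.mkHomFromDouble_f₁]
      infer_instance
    · refine (HomologicalComplex.isZero_double_X d r i h₁ h₀).isIso ?_ _
      by_cases hi : 0 < i
      · exact T.isZero_of_isStrictlyLE 0 i hi
      · exact T.isZero_of_isStrictlyGE (-1) i (by lia)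
  have := HomologicalComplex.Hom.isIso_of_components φ
  exact ⟨(asIso φ).symm⟩

open CochainComplex mappingCone in
/-- The degree `-1` part of the mapping cone of `f : K ⟶ L`. -/
noncomputable def mappingConeXIsoBiprod (i j : ℤ) (h : i + 1 = j) :
    L.X i ⊞ K.X j ≅ (mappingCone f).X i where
  hom := biprod.desc ((inr f).f i) ((inl f).v j i (by lia))
  inv := biprod.lift ((snd f).v i i (add_zero i)) ((fst f).1.v i j h)
  hom_inv_id := by ext <;> simp
  inv_hom_id := by
    rw [biprod.lift_desc, add_comm]
    simpa using (mappingCone.id_X f i j h)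

open CochainComplex mappingCone in
-- The identity of the cone is the sum of its projections to the two summands followed by the
-- inclusions; here the summand coming from `L` vanishes.
lemma isIso_mappingCone_inl (i j : ℤ) (h : i + (-1) = j) (hL : IsZero (L.X j)) :
    IsIso ((inl f).v i j h) :=
  ⟨(fst f).1.v j i (by lia), by simp, by
    have h₁ := mappingCone.id_X f j i (by lia)
    rwa [hL.eq_of_src ((inr f).f j) 0, comp_zero, add_zero] at h₁⟩

open CochainComplex mappingCone in
lemma isIso_mappingCone_inr (i j : ℤ) (h : i + 1 = j) (hK : IsZero (K.X j)) :
    IsIso ((inr f).f i) :=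
  ⟨(snd f).v i i (add_zero i), by simp, by
    have h₁ := mappingCone.id_X f i j h
    rwa [hK.eq_of_tgt ((fst f).1.v i j h) 0, zero_comp, zero_add] at h₁⟩

open CochainComplex mappingCone in
-- The sign in front of `K.d` is the one in the differential of the cone.
lemma lift_comp_mappingConeXIsoBiprod_hom (i j k : ℤ) (h : i + 1 = j) (h' : j + 1 = k) :
    biprod.lift (f.f j) (-K.d j k) ≫ (mappingConeXIsoBiprod K L f j k h').hom =
      (inl f).v j i (by lia) ≫ (mappingCone f).d i j := by
  rw [inl_v_d f j i k (by lia) (by lia)]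
  simp [mappingConeXIsoBiprod, sub_eq_add_neg]

open CochainComplex mappingCone in
lemma mappingConeXIsoBiprod_hom_comp_d (i j k : ℤ) (h : i + 1 = j) (h' : j + 1 = k)
    (hK : IsZero (K.X k)) :
    (mappingConeXIsoBiprod K L f i j h).hom ≫ (mappingCone f).d i j =
      biprod.desc (L.d i j) (f.f j) ≫ (inr f).f j := by
  ext
  · simp [mappingConeXIsoBiprod]
  · simp [mappingConeXIsoBiprod, inl_v_d f j i k (by lia) (by lia), hK.eq_of_tgt (K.d j k) 0]

/-- Truncating leaves degree -1 alone and replaces degree 0 by the kernel of the outgoing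
differential, so only three consecutive terms of `S` matter. -/
lemma exists_iso_truncLE (S : CochainComplex A ℤ) {X Y Z : A} (u : X ⟶ Y) (v : Y ⟶ Z)
    (w : u ≫ v = 0) (a : X ≅ S.X (-1)) (p : Y ≅ S.X 0) (r : Z ≅ S.X 1)
    (hu : u ≫ p.hom = a.hom ≫ S.d (-1) 0) (hv : p.hom ≫ S.d 0 1 = v ≫ r.hom) :
    ∃ (e₁ : X ≅ (S.truncLE 0).X (-1)) (e₀ : kernel v ≅ (S.truncLE 0).X 0),
      e₁.hom ≫ (S.truncLE 0).d (-1) 0 = kernel.lift v u w ≫ e₀.hom := by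
  have := isIso_ιTruncLE_f_of_lt S 0 (-1) (by simp)
  let e := kernel.mapIso v (S.d 0 1) p r hv.symm
  let e' := (kernelIsKernel (S.d 0 1)).conePointUniqueUpToIso (isLimitιTruncLE S 1 0 (by simp))
  have he' : e'.hom ≫ (S.ιTruncLE 0).f 0 = kernel.ι _ :=
    (kernelIsKernel (S.d 0 1)).conePointUniqueUpToIso_hom_comp
      (isLimitιTruncLE S 1 0 (by simp)) WalkingParallelPair.zero
  have he : e.hom ≫ kernel.ι _ = kernel.ι _ ≫ p.hom := kernel.lift_ι _ _ _
  have : Mono ((S.ιTruncLE 0).f 0) := inferInstanceAs (Mono ((HomologicalComplex.ιTruncLE _ _).f 0))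
  refine ⟨a ≪≫ (asIso ((S.ιTruncLE 0).f (-1))).symm, e ≪≫ e', ?_⟩
  -- Both sides land in the truncation, which is a subobject of `S.X 0`; there the equation is `hu`.
  rw [← cancel_mono ((S.ιTruncLE 0).f 0)]
  simp only [Iso.trans_hom, Category.assoc, he', he, Iso.symm_hom, asIso_inv]
  rw [← HomologicalComplex.Hom.comm, IsIso.inv_hom_id_assoc, kernel.lift_ι_assoc, hu]

variable [K.IsStrictlyLE 0] [L.IsStrictlyGE (-1)]

open CochainComplex mappingCone in
-- The outer terms of the cone have one summand each, by the bounds on `K` and `L`. The degrees are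
-- variables so that the result also applies to indices such as `-1 + -1`, which the shift by -1
-- produces.
lemma exists_mappingCone_isos (x y z : ℤ) (hx : x = -2) (hy : y = -1) (hz : z = 0) :
    ∃ (a : K.X (-1) ≅ (mappingCone f).X x) (p : L.X (-1) ⊞ K.X 0 ≅ (mappingCone f).X y)
      (r : L.X 0 ≅ (mappingCone f).X z),
      biprod.lift (f.f (-1)) (-K.d (-1) 0) ≫ p.hom = a.hom ≫ (mappingCone f).d x y ∧
      p.hom ≫ (mappingCone f).d y z = biprod.desc (L.d (-1) 0) (f.f 0) ≫ r.hom := by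
  subst hx hy hz
  have := isIso_mappingCone_inl K L f (-1) (-2) (by simp) (L.isZero_of_isStrictlyGE (-1) (-2))
  have := isIso_mappingCone_inr K L f 0 1 (by simp) (K.isZero_of_isStrictlyLE 0 1)
  exact ⟨asIso ((inl f).v (-1) (-2) _), mappingConeXIsoBiprod K L f (-1) 0 (by simp),
    asIso ((inr f).f 0), lift_comp_mappingConeXIsoBiprod_hom K L f (-2) (-1) 0 (by simp) (by simp),
    mappingConeXIsoBiprod_hom_comp_d K L f (-1) 0 1 (by simp) (by simp)
      (K.isZero_of_isStrictlyLE 0 1)⟩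

open CochainComplex in
lemma exists_iso_truncGE_mappingCone :
    ∃ (e₁ : cokernel (biprod.lift (f.f (-1)) (-K.d (-1) 0)) ≅ ((mappingCone f).truncGE (-1)).X (-1))
      (e₀ : L.X 0 ≅ ((mappingCone f).truncGE (-1)).X 0),
      e₁.hom ≫ ((mappingCone f).truncGE (-1)).d (-1) 0 =
        cokernel.desc (biprod.lift (f.f (-1)) (-K.d (-1) 0)) (biprod.desc (L.d (-1) 0) (f.f 0))
          (by simp) ≫ e₀.hom := by
  obtain ⟨a, p, r, ha, hp⟩ := exists_mappingCone_isos K L f _ _ _ rfl rfl rfl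
  have := isIso_πTruncGE_f_of_lt (mappingCone f) (-1) 0 (by simp)
  let e := cokernel.mapIso (biprod.lift (f.f (-1)) (-K.d (-1) 0)) ((mappingCone f).d (-2) (-1))
    a p ha
  let e' := (cokernelIsCokernel ((mappingCone f).d (-2) (-1))).coconePointUniqueUpToIso
    (isColimitπTruncGE (mappingCone f) (-2) (-1) (by simp))
  have he' : cokernel.π _ ≫ e'.hom = ((mappingCone f).πTruncGE (-1)).f (-1) :=
    (cokernelIsCokernel ((mappingCone f).d (-2) (-1))).comp_coconePointUniqueUpToIso_hom
      (isColimitπTruncGE (mappingCone f) (-2) (-1) (by simp)) WalkingParallelPair.one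
  have he : cokernel.π _ ≫ e.hom = p.hom ≫ cokernel.π _ := cokernel.π_desc _ _ _
  refine ⟨e ≪≫ e', r ≪≫ asIso (((mappingCone f).πTruncGE (-1)).f 0), ?_⟩
  rw [← cancel_epi (cokernel.π _), Iso.trans_hom, Category.assoc, reassoc_of% he, reassoc_of% he',
    HomologicalComplex.Hom.comm, cokernel.π_desc_assoc, reassoc_of% hp, Iso.trans_hom, asIso_hom]

open CochainComplex in
lemma exists_iso_truncLE_mappingCone :
    ∃ (e₁ : K.X (-1) ≅ (((mappingCone f)⟦(-1 : ℤ)⟧).truncLE 0).X (-1))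
      (e₀ : kernel (biprod.desc (L.d (-1) 0) (f.f 0)) ≅
        (((mappingCone f)⟦(-1 : ℤ)⟧).truncLE 0).X 0),
      e₁.hom ≫ (((mappingCone f)⟦(-1 : ℤ)⟧).truncLE 0).d (-1) 0 =
        kernel.lift (biprod.desc (L.d (-1) 0) (f.f 0)) (biprod.lift (f.f (-1)) (-K.d (-1) 0))
          (by simp) ≫ e₀.hom := by
  have hd : ∀ i j : ℤ, ((mappingCone f)⟦(-1 : ℤ)⟧).d i j = -(mappingCone f).d (i + -1) (j + -1) := by
    intro i j
    rw [CochainComplex.shiftFunctor_obj_d', Int.negOnePow_neg, Int.negOnePow_one, Units.neg_smul,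
      one_smul]
  obtain ⟨a, p, r, ha, hp⟩ := exists_mappingCone_isos K L f (-1 + -1) (0 + -1) (1 + -1)
    (by simp) (by simp) (by simp)
  -- The shift by -1 changes the sign of every differential. Negating the two outer identifications
  -- and keeping the middle one compensates for this.
  refine exists_iso_truncLE ((mappingCone f)⟦(-1 : ℤ)⟧) (biprod.lift (f.f (-1)) (-K.d (-1) 0))
    (biprod.desc (L.d (-1) 0) (f.f 0)) (by simp) (-a) p (-r) ?_ ?_
  · rw [hd]
    change _ = (-a.hom) ≫ (-(mappingCone f).d (-1 + -1) (0 + -1))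
    rw [Preadditive.neg_comp, Preadditive.comp_neg, neg_neg]
    exact ha
  · rw [hd]
    change p.hom ≫ (-(mappingCone f).d (0 + -1) (1 + -1)) = _ ≫ (-r.hom)
    rw [Preadditive.comp_neg, Preadditive.comp_neg]
    exact congrArg _ hp

open CochainComplex in
lemma nonempty_truncGE_mappingCone_iso [L.IsStrictlyLE 0] (r : (ComplexShape.up ℤ).Rel (-1) 0) :
    Nonempty ((mappingCone f).truncGE (-1) ≅ HomologicalComplex.double
      (cokernel.desc (biprod.lift (f.f (-1)) (-K.d (-1) 0)) (biprod.desc (L.d (-1) 0) (f.f 0))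
        (by simp)) r) := by
  obtain ⟨e₁, e₀, h⟩ := exists_iso_truncGE_mappingCone K L f
  have : (mappingCone f).IsStrictlyLE 0 := by
    rw [isStrictlyLE_iff]
    intro i hi
    rw [mappingCone.isZero_X_iff]
    exact ⟨K.isZero_of_isStrictlyLE 0 _ (by lia), L.isZero_of_isStrictlyLE 0 _ (by lia)⟩
  have : ((mappingCone f).truncGE (-1)).IsStrictlyLE 0 := inferInstance
  exact nonempty_iso_double _ _ e₁ e₀ h r

open CochainComplex in
lemma nonempty_truncLE_mappingCone_iso [K.IsStrictlyGE (-1)] (r : (ComplexShape.up ℤ).Rel (-1) 0) :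
    Nonempty (((mappingCone f)⟦(-1 : ℤ)⟧).truncLE 0 ≅ HomologicalComplex.double
      (kernel.lift (biprod.desc (L.d (-1) 0) (f.f 0)) (biprod.lift (f.f (-1)) (-K.d (-1) 0))
        (by simp)) r) := by
  obtain ⟨e₁, e₀, h⟩ := exists_iso_truncLE_mappingCone K L f
  have : ((mappingCone f)⟦(-1 : ℤ)⟧).IsStrictlyGE (-1) := by
    rw [isStrictlyGE_iff]
    intro i hi
    rw [shiftFunctor_obj_X', mappingCone.isZero_X_iff]
    exact ⟨K.isZero_of_isStrictlyGE (-1) _ (by lia), L.isZero_of_isStrictlyGE (-1) _ (by lia)⟩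
  have : (((mappingCone f)⟦(-1 : ℤ)⟧).truncLE 0).IsStrictlyGE (-1) := inferInstance
  exact nonempty_iso_double _ _ e₁ e₀ h r
end

namespace PicardStack

/-! ### Properties which hold locally on a site -/

section Locally

variable {C : Type u} [Category.{v} C] {J : GrothendieckTopology C}

/-- A property of the morphisms with target `U` holds locally if it holds on a covering sieve. -/
def Locally (J : GrothendieckTopology C) {U : C} (φ : ∀ ⦃V : C⦄, (V ⟶ U) → Prop) : Prop :=
  ∃ S ∈ J U, ∀ ⦃V : C⦄ (f : V ⟶ U), S f → φ f

variable {U : C} {φ ψ : ∀ ⦃V : C⦄, (V ⟶ U) → Prop}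

lemma Locally.of_forall (h : ∀ ⦃V : C⦄ (f : V ⟶ U), φ f) : Locally J φ :=
  ⟨⊤, J.top_mem U, fun _ f _ => h f⟩

lemma Locally.mono (h : Locally J φ) (h' : ∀ ⦃V : C⦄ (f : V ⟶ U), φ f → ψ f) : Locally J ψ := by
  obtain ⟨S, hS, hφ⟩ := h
  exact ⟨S, hS, fun _ f hf => h' f (hφ f hf)⟩

lemma Locally.and (h : Locally J φ) (h' : Locally J ψ) : Locally J (fun _ f => φ f ∧ ψ f) := by
  obtain ⟨S, hS, hφ⟩ := h
  obtain ⟨T, hT, hψ⟩ := h'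
  exact ⟨S ⊓ T, J.intersection_covering hS hT, fun _ f hf => ⟨hφ f hf.1, hψ f hf.2⟩⟩

/-- Transitivity of coverings: choose a covering sieve for each member of the first one and compose.
-/
lemma Locally.trans (h : Locally J (fun _ f => Locally J (fun _ g => φ (g ≫ f)))) :
    Locally J φ := by
  obtain ⟨S, hS, h⟩ := h
  choose T hT hφ using h
  refine ⟨Sieve.bind S T, J.bind_covering hS (fun _ f hf => hT f hf), ?_⟩
  rintro V _ ⟨W, g, f, hf, hg, rfl⟩
  exact hφ f hf g hg

/-- A property which holds locally, locally holds. -/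
lemma Locally.bind (h : Locally J ψ)
    (h' : ∀ ⦃V : C⦄ (f : V ⟶ U), ψ f → Locally J (fun _ g => φ (g ≫ f))) : Locally J φ :=
  (h.mono h').trans

end Locally

variable {C : Type u} [Category.{v} C] {J : GrothendieckTopology C}
  {P Q R : PicardPrestack.{w} C}

/-! ### Equality and gluing of arrows in a prestack -/

namespace PicardPrestack

variable {X Y Z : LocallyDiscrete Cᵒᵖ}

/-- The isomorphism `(f g)^* x ≅ g^* f^* x`. -/
def pullIso (f : X ⟶ Y) (g : Y ⟶ Z) (x : P.fib.obj X) :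
    (P.pull (f ≫ g)).obj x ≅ (P.pull g).obj ((P.pull f).obj x) :=
  (P.pullComp f g).app x

lemma pullIso_naturality (f : X ⟶ Y) (g : Y ⟶ Z) {x y : P.fib.obj X} (a : x ⟶ y) :
    (P.pull (f ≫ g)).map a ≫ (pullIso f g y).hom =
      (pullIso f g x).hom ≫ (P.pull g).map ((P.pull f).map a) :=
  (P.pullComp f g).hom.naturality a

lemma pullIso_naturality_assoc (f : X ⟶ Y) (g : Y ⟶ Z) {x y : P.fib.obj X} (a : x ⟶ y)
    {z : P.fib.obj Z} (h : (P.pull g).obj ((P.pull f).obj y) ⟶ z) :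
    (P.pull (f ≫ g)).map a ≫ (pullIso f g y).hom ≫ h =
      (pullIso f g x).hom ≫ (P.pull g).map ((P.pull f).map a) ≫ h := by
  rw [← Category.assoc, pullIso_naturality, Category.assoc]

lemma map_pull_comp (f : X ⟶ Y) (g : Y ⟶ Z) {x y : P.fib.obj X} (a : x ⟶ y) :
    (P.pull (f ≫ g)).map a = (pullIso f g x).hom ≫ (P.pull g).map ((P.pull f).map a) ≫
      (pullIso f g y).inv := by
  rw [← pullIso_naturality_assoc]
  simp

/-- The isomorphism `h^* x ≅ g^* f^* x` when `h` is the composite of `f` and `g`. -/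
def pullIso' (f : X ⟶ Y) (g : Y ⟶ Z) (h : X ⟶ Z) (e : f ≫ g = h) (x : P.fib.obj X) :
    (P.pull h).obj x ≅ (P.pull g).obj ((P.pull f).obj x) :=
  (Cat.Hom.toNatIso (P.fib.mapComp' f g h e)).app x

lemma pullIso'_eq (f : X ⟶ Y) (g : Y ⟶ Z) (x : P.fib.obj X) :
    pullIso' f g _ rfl x = pullIso f g x := by
  simp [pullIso', pullIso, pullComp, Pseudofunctor.mapComp'_eq_mapComp]

lemma hom_ext_of_locally [P.fib.IsPrestack J] {x y : P.fib.obj X} {a b : x ⟶ y}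
    (h : Locally J (U := X.as.unop)
      (fun _ f => (P.pull f.op.toLoc).map a = (P.pull f.op.toLoc).map b)) : a = b := by
  obtain ⟨S, hS, h⟩ := h
  have := ((Pseudofunctor.isPrestackFor_iff _ _).1 (P.fib.isPrestackFor' S hS))
  obtain ⟨hF⟩ := this
  refine hF.map_injective (Pseudofunctor.DescentData.hom_ext fun i => h i.obj.hom i.property)

lemma exists_glue [P.fib.IsPrestack J] {x y : P.fib.obj X} (S : Sieve X.as.unop)
    (hS : S ∈ J X.as.unop)
    (a : ∀ ⦃V : C⦄ (f : V ⟶ X.as.unop), S f →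
      ((P.pull f.op.toLoc).obj x ⟶ (P.pull f.op.toLoc).obj y))
    (ha : ∀ ⦃V W : C⦄ (f : V ⟶ X.as.unop) (hf : S f) (g : W ⟶ V),
      a (g ≫ f) (S.downward_closed hf g) ≫ (PicardPrestack.pullIso f.op.toLoc g.op.toLoc y).hom =
        (PicardPrestack.pullIso f.op.toLoc g.op.toLoc x).hom ≫ (P.pull g.op.toLoc).map (a f hf)) :
    ∃ b : x ⟶ y, ∀ ⦃V : C⦄ (f : V ⟶ X.as.unop) (hf : S f),
      (P.pull f.op.toLoc).map b = a f hf := by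
  obtain ⟨hF⟩ := ((Pseudofunctor.isPrestackFor_iff _ _).1 (P.fib.isPrestackFor' S hS))
  -- A morphism of descent data must agree for any two members of the sieve on a common refinement
  -- `h`. It suffices to express the restriction of each member through the arrow `a h` of the
  -- family itself.
  have ha' : ∀ ⦃V W : C⦄ (f : V ⟶ X.as.unop) (hf : S f) (g : W ⟶ V) (h : W ⟶ X.as.unop)
      (e : g ≫ f = h), (P.pull g.op.toLoc).map (a f hf) =
        (pullIso' f.op.toLoc g.op.toLoc h.op.toLoc (by subst e; rfl) x).inv ≫
        a h (e ▸ S.downward_closed hf g) ≫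
        (pullIso' f.op.toLoc g.op.toLoc h.op.toLoc (by subst e; rfl) y).hom := by
    intro V W f hf g h e
    subst e
    have h1 := ha f hf g
    erw [pullIso'_eq, pullIso'_eq, h1]
    simp
  let φ : (P.fib.toDescentData (fun (f : S.arrows.category) ↦ f.obj.hom)).obj x ⟶
      (P.fib.toDescentData (fun (f : S.arrows.category) ↦ f.obj.hom)).obj y :=
    { hom i := a i.obj.hom i.property
      comm W q i₁ i₂ f₁ f₂ h₁ h₂ := by
        have e₁ := ha' i₁.obj.hom i₁.property f₁ q h₁
        have e₂ := ha' i₂.obj.hom i₂.property f₂ q h₂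
        have w₁ : i₁.obj.hom.op.toLoc ≫ f₁.op.toLoc = q.op.toLoc := by subst h₁; rfl
        have w₂ : i₂.obj.hom.op.toLoc ≫ f₂.op.toLoc = q.op.toLoc := by rw [← h₂]; rfl
        refine (congrArg (fun t => t ≫ _) e₁).trans (Eq.trans ?_ (congrArg (fun t => _ ≫ t) e₂).symm)
        change (_ ≫ _ ≫ (pullIso' _ _ _ w₁ y).hom) ≫
            (pullIso' _ _ _ w₁ y).inv ≫ (pullIso' _ _ _ w₂ y).hom =
          ((pullIso' _ _ _ w₁ x).inv ≫ (pullIso' _ _ _ w₂ x).hom) ≫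
            (pullIso' _ _ _ w₂ x).inv ≫ _ ≫ _
        simp }
  refine ⟨hF.preimage φ, fun V f hf => ?_⟩
  have := congrArg (fun t => t.hom ⟨Over.mk f, hf⟩) (hF.map_preimage φ)
  exact this

end PicardPrestack

/-! ### Local lifts of arrows along additive functors, and local equivalences -/

namespace AdditiveFunctor

variable {X Y Z : LocallyDiscrete Cᵒᵖ} (j : AdditiveFunctor P Q) (k : AdditiveFunctor Q R)

/-- The isomorphism `j (f^* x) ≅ f^* (j x)`. -/
def natIso (f : X ⟶ Y) (x : P.fib.obj X) :
    (j.functor Y).obj ((P.pull f).obj x) ≅ (Q.pull f).obj ((j.functor X).obj x) :=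
  (j.nat f).app x

lemma natIso_naturality (f : X ⟶ Y) {x y : P.fib.obj X} (a : x ⟶ y) :
    (j.functor Y).map ((P.pull f).map a) ≫ (j.natIso f y).hom =
      (j.natIso f x).hom ≫ (Q.pull f).map ((j.functor X).map a) :=
  (j.nat f).hom.naturality a

lemma natIso_naturality_assoc (f : X ⟶ Y) {x y : P.fib.obj X} (a : x ⟶ y)
    {z : Q.fib.obj Y} (h : (Q.pull f).obj ((j.functor X).obj y) ⟶ z) :
    (j.functor Y).map ((P.pull f).map a) ≫ (j.natIso f y).hom ≫ h =
      (j.natIso f x).hom ≫ (Q.pull f).map ((j.functor X).map a) ≫ h := by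
  rw [← Category.assoc, natIso_naturality, Category.assoc]

lemma natIso_pullIso (f : X ⟶ Y) (g : Y ⟶ Z) (x : P.fib.obj X) :
    (j.natIso (f ≫ g) x).hom ≫ (PicardPrestack.pullIso f g ((j.functor X).obj x)).hom =
      (j.functor Z).map (PicardPrestack.pullIso f g x).hom ≫
        (j.natIso g ((P.pull f).obj x)).hom ≫ (Q.pull g).map (j.natIso f x).hom :=
  j.nat_comp f g x

lemma natIso_pullIso_assoc (f : X ⟶ Y) (g : Y ⟶ Z) (x : P.fib.obj X) {z : Q.fib.obj Z}
    (h : (Q.pull g).obj ((Q.pull f).obj ((j.functor X).obj x)) ⟶ z) :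
    (j.natIso (f ≫ g) x).hom ≫ (PicardPrestack.pullIso f g ((j.functor X).obj x)).hom ≫ h =
      (j.functor Z).map (PicardPrestack.pullIso f g x).hom ≫
        (j.natIso g ((P.pull f).obj x)).hom ≫ (Q.pull g).map (j.natIso f x).hom ≫ h := by
  rw [← Category.assoc, natIso_pullIso, Category.assoc, Category.assoc]

lemma comp_natIso_hom (f : X ⟶ Y) (x : P.fib.obj X) : ((j.comp k).natIso f x).hom =
    (k.functor Y).map (j.natIso f x).hom ≫ (k.natIso f ((j.functor X).obj x)).hom := by
  change 𝟙 _ ≫ (k.functor Y).map ((j.nat f).hom.app x) ≫ 𝟙 _ ≫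
    (k.nat f).hom.app ((j.functor X).obj x) ≫ 𝟙 _ = _
  simp only [Category.id_comp]
  exact congrArg _ (Category.comp_id _)

/-- The arrow `b` over `Y` is sent by `j` to the restriction of `a` along `f : X ⟶ Y`. -/
def Lifts (f : X ⟶ Y) {x y : P.fib.obj X} (b : (P.pull f).obj x ⟶ (P.pull f).obj y)
    (a : (j.functor X).obj x ⟶ (j.functor X).obj y) : Prop :=
  (j.functor Y).map b ≫ (j.natIso f y).hom = (j.natIso f x).hom ≫ (Q.pull f).map a

variable {j k}

lemma lifts_iff {f : X ⟶ Y} {x y : P.fib.obj X} {b : (P.pull f).obj x ⟶ (P.pull f).obj y}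
    {a : (j.functor X).obj x ⟶ (j.functor X).obj y} : j.Lifts f b a ↔
    (j.functor Y).map b = (j.natIso f x).hom ≫ (Q.pull f).map a ≫ (j.natIso f y).inv := by
  rw [Lifts, ← cancel_mono (j.natIso f y).hom]
  simp

lemma lifts_map (f : X ⟶ Y) {x y : P.fib.obj X} (a : x ⟶ y) :
    j.Lifts f ((P.pull f).map a) ((j.functor X).map a) := natIso_naturality j f a

lemma Lifts.comp {f : X ⟶ Y} {x y z : P.fib.obj X} {b : (P.pull f).obj x ⟶ (P.pull f).obj y}
    {a : (j.functor X).obj x ⟶ (j.functor X).obj y}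
    {b' : (P.pull f).obj y ⟶ (P.pull f).obj z}
    {a' : (j.functor X).obj y ⟶ (j.functor X).obj z} (h : j.Lifts f b a) (h' : j.Lifts f b' a') :
    j.Lifts f (b ≫ b') (a ≫ a') := by
  unfold Lifts at *
  simp only [Functor.map_comp, Category.assoc]
  rw [h', reassoc_of% h]

/-- Lifting in two stages, first over `Y` and then over `Z`. The arrow `b` need not be the
restriction of an arrow over `X`; in `IsLocalEquiv.comp` it is itself only a local lift along the
second functor. -/
lemma map_trans {f : X ⟶ Y} {g : Y ⟶ Z} {x y : P.fib.obj X}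
    {b : (Q.pull f).obj ((j.functor X).obj x) ⟶ (Q.pull f).obj ((j.functor X).obj y)}
    {c : (P.pull g).obj ((P.pull f).obj x) ⟶ (P.pull g).obj ((P.pull f).obj y)}
    (h : j.Lifts g c ((j.natIso f x).hom ≫ b ≫ (j.natIso f y).inv)) :
    (j.functor Z).map ((PicardPrestack.pullIso f g x).hom ≫ c ≫
      (PicardPrestack.pullIso f g y).inv) ≫ (j.natIso (f ≫ g) y).hom =
    (j.natIso (f ≫ g) x).hom ≫ (PicardPrestack.pullIso f g _).hom ≫ (Q.pull g).map b ≫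
      (PicardPrestack.pullIso f g _).inv := by
  unfold Lifts at h
  rw [← cancel_mono (PicardPrestack.pullIso f g ((j.functor X).obj y)).hom]
  simp only [Functor.map_comp, Category.assoc] at h ⊢
  rw [natIso_pullIso, Iso.map_inv_hom_id_assoc, reassoc_of% h,
    natIso_pullIso_assoc, Iso.map_inv_hom_id, Category.comp_id, Iso.inv_hom_id, Category.comp_id]

lemma Lifts.trans {f : X ⟶ Y} {g : Y ⟶ Z} {x y : P.fib.obj X}
    {a : (j.functor X).obj x ⟶ (j.functor X).obj y}
    {c : (P.pull g).obj ((P.pull f).obj x) ⟶ (P.pull g).obj ((P.pull f).obj y)}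
    (h : j.Lifts g c ((j.natIso f x).hom ≫ (Q.pull f).map a ≫ (j.natIso f y).inv)) :
    j.Lifts (f ≫ g) ((PicardPrestack.pullIso f g x).hom ≫ c ≫
      (PicardPrestack.pullIso f g y).inv) a := by
  refine (map_trans h).trans ?_
  rw [← PicardPrestack.map_pull_comp]

lemma Lifts.restrict {f : X ⟶ Y} {x y : P.fib.obj X} {b : (P.pull f).obj x ⟶ (P.pull f).obj y}
    {a : (j.functor X).obj x ⟶ (j.functor X).obj y} (h : j.Lifts f b a) (g : Y ⟶ Z) :
    j.Lifts (f ≫ g) ((PicardPrestack.pullIso f g x).hom ≫ (P.pull g).map b ≫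
      (PicardPrestack.pullIso f g y).inv) a := by
  refine Lifts.trans ?_
  rw [← lifts_iff.1 h]
  exact lifts_map _ _

/-- The comparison isomorphism of a composite is the image of that of `j` followed by that of `k`,
so the two lifting equations can be pasted. -/
lemma Lifts.of_comp {f : X ⟶ Y} {x y : P.fib.obj X} {c : (P.pull f).obj x ⟶ (P.pull f).obj y}
    {b : (Q.pull f).obj ((j.functor X).obj x) ⟶ (Q.pull f).obj ((j.functor X).obj y)}
    {a : (k.functor X).obj ((j.functor X).obj x) ⟶ (k.functor X).obj ((j.functor X).obj y)}
    (h : (j.functor Y).map c ≫ (j.natIso f y).hom = (j.natIso f x).hom ≫ b)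
    (h' : k.Lifts f b a) : (j.comp k).Lifts f c a := by
  unfold Lifts at *
  refine (congrArg (fun t => _ ≫ t) (comp_natIso_hom j k f y)).trans
    (Eq.trans ?_ (congrArg (fun t => t ≫ _) (comp_natIso_hom j k f x)).symm)
  change (k.functor Y).map ((j.functor Y).map c) ≫ (k.functor Y).map (j.natIso f y).hom ≫
    (k.natIso f ((j.functor X).obj y)).hom = ((k.functor Y).map (j.natIso f x).hom ≫
      (k.natIso f ((j.functor X).obj x)).hom) ≫ (R.pull f).map a
  rw [Category.assoc, ← h', ← Functor.map_comp_assoc, h, Functor.map_comp_assoc]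

end AdditiveFunctor

/-- The local conditions in the definition of the stack generated by a prestack: `j` is locally
faithful, locally full and locally essentially surjective. -/
structure IsLocalEquiv (J : GrothendieckTopology C) (j : AdditiveFunctor P Q) : Prop where
  faithful {X : LocallyDiscrete Cᵒᵖ} {x y : P.fib.obj X} (a b : x ⟶ y)
    (h : (j.functor X).map a = (j.functor X).map b) : Locally J (U := X.as.unop)
      (fun _ f => (P.pull f.op.toLoc).map a = (P.pull f.op.toLoc).map b)
  full {X : LocallyDiscrete Cᵒᵖ} {x y : P.fib.obj X}
    (a : (j.functor X).obj x ⟶ (j.functor X).obj y) : Locally J (U := X.as.unop)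
      (fun _ f => ∃ b, j.Lifts f.op.toLoc b a)
  essSurj {X : LocallyDiscrete Cᵒᵖ} (a : Q.fib.obj X) : Locally J (U := X.as.unop)
    (fun V f => ∃ x : P.fib.obj (.mk (op V)),
      Nonempty ((j.functor _).obj x ≅ (Q.pull f.op.toLoc).obj a))

lemma IsGenerated.isLocalEquiv {j : AdditiveFunctor P Q} (h : IsGenerated J j) :
    IsLocalEquiv J j where
  faithful := h.locally_faithful
  full := h.locally_full
  essSurj := h.locally_essSurj

lemma IsLocalEquiv.isGenerated {j : AdditiveFunctor P Q} (h : IsLocalEquiv J j)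
    (hQ : Q.fib.IsStack J) : IsGenerated J j where
  isStack := hQ
  locally_faithful := h.faithful
  locally_full := h.full
  locally_essSurj := h.essSurj

namespace IsLocalEquiv

open AdditiveFunctor

variable {j : AdditiveFunctor P Q} {k : AdditiveFunctor Q R}

lemma map_pull_eq {X Y : LocallyDiscrete Cᵒᵖ} (f : X ⟶ Y) {x y : P.fib.obj X} {a b : x ⟶ y}
    (h : (Q.pull f).map ((j.functor X).map a) = (Q.pull f).map ((j.functor X).map b)) :
    (j.functor Y).map ((P.pull f).map a) = (j.functor Y).map ((P.pull f).map b) := by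
  rw [← cancel_mono (j.natIso f y).hom, natIso_naturality, natIso_naturality, h]

/-- A form of local faithfulness whose hypothesis is local too; this makes it usable for composites,
where the other functor already costs a covering. -/
lemma faithful' (h : IsLocalEquiv J j) {X : LocallyDiscrete Cᵒᵖ} {x y : P.fib.obj X} (a b : x ⟶ y)
    (hab : Locally J (U := X.as.unop) (fun _ f => (Q.pull f.op.toLoc).map ((j.functor X).map a) =
      (Q.pull f.op.toLoc).map ((j.functor X).map b))) : Locally J (U := X.as.unop)
      (fun _ f => (P.pull f.op.toLoc).map a = (P.pull f.op.toLoc).map b) :=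
  hab.bind fun V f hf => (h.faithful _ _ (map_pull_eq f.op.toLoc hf)).mono fun W g hg => by
    change (P.pull (f.op.toLoc ≫ g.op.toLoc)).map a = (P.pull (f.op.toLoc ≫ g.op.toLoc)).map b
    rw [PicardPrestack.map_pull_comp, PicardPrestack.map_pull_comp, hg]

/-- Each condition is applied first for `k` and then, over the members of the resulting covering,
for `j`. -/
lemma comp (hj : IsLocalEquiv J j) (hk : IsLocalEquiv J k) : IsLocalEquiv J (j.comp k) where
  faithful a b h := hj.faithful' a b (hk.faithful _ _ h)
  full {X x y} a := (hk.full a).bind fun V f ⟨b, hb⟩ =>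
    (hj.full ((j.natIso f.op.toLoc x).hom ≫ b ≫ (j.natIso f.op.toLoc y).inv)).mono
      fun W g ⟨c, hc⟩ => ⟨(PicardPrestack.pullIso f.op.toLoc g.op.toLoc x).hom ≫ c ≫
          (PicardPrestack.pullIso f.op.toLoc g.op.toLoc y).inv,
        Lifts.of_comp (map_trans hc) (hb.restrict g.op.toLoc)⟩
  essSurj a := (hk.essSurj a).bind fun V f ⟨b, ⟨e⟩⟩ => (hj.essSurj b).mono fun W g ⟨c, ⟨e'⟩⟩ =>
    ⟨c, ⟨(k.functor _).mapIso e' ≪≫ k.natIso g.op.toLoc b ≪≫ (R.pull g.op.toLoc).mapIso e ≪≫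
      (PicardPrestack.pullIso f.op.toLoc g.op.toLoc a).symm⟩⟩

end IsLocalEquiv

end PicardStack

/-! ### The functor between kernels induced by a square -/

namespace PicardStack

variable {C : Type u} [Category.{v} C] {J : GrothendieckTopology C}

open Functor.LaxMonoidal Functor.OplaxMonoidal Functor.Monoidal

namespace AdditiveFunctor

variable {P Q : PicardPrestack.{w} C} (j : AdditiveFunctor P Q)

/-- Monoidality of the comparison isomorphism at the unit, rewritten with the inverses `η`, since
trivializations in a kernel point towards the unit. -/
lemma natIso_unit {X Y : LocallyDiscrete Cᵒᵖ} (f : X ⟶ Y) :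
    (j.natIso f (𝟙_ (P.fib.obj X))).hom ≫ (Q.pull f).map (η (j.functor X)) ≫ η (Q.pull f) =
      (j.functor Y).map (η (P.pull f)) ≫ η (j.functor Y) := by
  have h := NatTrans.IsMonoidal.unit (τ := (j.nat f).hom)
  have h1 : ε (P.pull f ⋙ j.functor Y) = ε (j.functor Y) ≫ (j.functor Y).map (ε (P.pull f)) := rfl
  have h2 : ε (j.functor X ⋙ Q.pull f) = ε (Q.pull f) ≫ (Q.pull f).map (ε (j.functor X)) := rfl
  rw [h1, h2] at h
  rw [← cancel_epi ((j.functor Y).map (ε (P.pull f))), ← cancel_epi (ε (j.functor Y))]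
  have h3 : ε (j.functor Y) ≫ (j.functor Y).map (ε (P.pull f)) ≫ (j.natIso f (𝟙_ _)).hom =
    ε (Q.pull f) ≫ (Q.pull f).map (ε (j.functor X)) := by rw [← h]; simp [natIso]
  rw [reassoc_of% h3, ← Functor.map_comp_assoc, ← Functor.map_comp_assoc]
  simp

end AdditiveFunctor

namespace AdditiveFunctor

variable {P' Q' P Q : PicardPrestack.{w} C} {jP : AdditiveFunctor P' P} {jQ : AdditiveFunctor Q' Q}
  {F' : AdditiveFunctor P' Q'} {F : AdditiveFunctor P Q}

namespace Iso

variable (θ : Iso (jP.comp F) (F'.comp jQ))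

/-- The isomorphism of functors between fibres given by a square of additive functors. -/
def fibIso (X : LocallyDiscrete Cᵒᵖ) :
    jP.functor X ⋙ F.functor X ≅ F'.functor X ⋙ jQ.functor X := θ.iso X

instance (X : LocallyDiscrete Cᵒᵖ) : NatTrans.IsMonoidal (θ.fibIso X).hom := θ.isMonoidal X

/-- The isomorphism `F (jP x) ≅ jQ (F' x)` of a square of additive functors. -/
def square (X : LocallyDiscrete Cᵒᵖ) (x : P'.fib.obj X) :
    (F.functor X).obj ((jP.functor X).obj x) ≅ (jQ.functor X).obj ((F'.functor X).obj x) :=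
  (θ.iso X).app x

lemma square_naturality {X : LocallyDiscrete Cᵒᵖ} {x y : P'.fib.obj X} (a : x ⟶ y) :
    (F.functor X).map ((jP.functor X).map a) ≫ (θ.square X y).hom =
      (θ.square X x).hom ≫ (jQ.functor X).map ((F'.functor X).map a) :=
  (θ.iso X).hom.naturality a

lemma square_pull {X Y : LocallyDiscrete Cᵒᵖ} (f : X ⟶ Y) (x : P'.fib.obj X) :
    (θ.square Y ((P'.pull f).obj x)).hom ≫ (jQ.functor Y).map (F'.natIso f x).hom ≫
      (jQ.natIso f ((F'.functor X).obj x)).hom =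
    (F.functor Y).map (jP.natIso f x).hom ≫ (F.natIso f ((jP.functor X).obj x)).hom ≫
      (Q.pull f).map (θ.square X x).hom := by
  have h := θ.naturality f x
  have h1 := comp_natIso_hom F' jQ f x
  have h2 := comp_natIso_hom jP F f x
  change (θ.square Y ((P'.pull f).obj x)).hom ≫ ((F'.comp jQ).natIso f x).hom =
    ((jP.comp F).natIso f x).hom ≫ (Q.pull f).map (θ.square X x).hom at h
  rw [h1, h2] at h
  exact h.trans (Category.assoc _ _ _)

lemma square_pull_assoc {X Y : LocallyDiscrete Cᵒᵖ} (f : X ⟶ Y) (x : P'.fib.obj X)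
    {z : Q.fib.obj Y} (h : (Q.pull f).obj ((jQ.functor X).obj ((F'.functor X).obj x)) ⟶ z) :
    (θ.square Y ((P'.pull f).obj x)).hom ≫ (jQ.functor Y).map (F'.natIso f x).hom ≫
      (jQ.natIso f ((F'.functor X).obj x)).hom ≫ h =
    (F.functor Y).map (jP.natIso f x).hom ≫ (F.natIso f ((jP.functor X).obj x)).hom ≫
      (Q.pull f).map (θ.square X x).hom ≫ h := by
  simpa only [Category.assoc] using congrArg (fun t => t ≫ h) (θ.square_pull f x)

end Iso

end AdditiveFunctor

namespace KerObj

variable {P' Q' P Q : PicardPrestack.{w} C} {jP : AdditiveFunctor P' P} {jQ : AdditiveFunctor Q' Q}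
  {F' : AdditiveFunctor P' Q'} {F : AdditiveFunctor P Q}
  (θ : AdditiveFunctor.Iso (jP.comp F) (F'.comp jQ))

/-- The functor between the fibres of the kernels. -/
abbrev fibMap (X : LocallyDiscrete Cᵒᵖ) : KerObj (F'.functor X) ⥤ KerObj (F.functor X) :=
  KerObj.map (jP.functor X) (jQ.functor X) (θ.fibIso X)

lemma fibMap_φ {X : LocallyDiscrete Cᵒᵖ} (x : KerObj (F'.functor X)) :
    ((fibMap θ X).obj x).φ.hom =
      (θ.square X x.p).hom ≫ (jQ.functor X).map x.φ.hom ≫ η (jQ.functor X) := rfl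

lemma kerPull_φ {X Y : LocallyDiscrete Cᵒᵖ} (f : X ⟶ Y) (x : KerObj (F.functor X)) :
    ((kerPull F f).obj x).φ.hom =
      (F.natIso f x.p).hom ≫ (Q.pull f).map x.φ.hom ≫ η (Q.pull f) := rfl

/-- This is the condition for the comparison isomorphism of `jP` to be an arrow of the kernel. It
combines the compatibility of the square with pull-back and the unit condition for `jQ`. -/
lemma fibMapNat_w {X Y : LocallyDiscrete Cᵒᵖ} (f : X ⟶ Y) (x : KerObj (F'.functor X)) :
    (F.functor Y).map (jP.natIso f x.p).hom ≫ ((kerPull F f).obj ((fibMap θ X).obj x)).φ.hom =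
      ((fibMap θ Y).obj ((kerPull F' f).obj x)).φ.hom := by
  rw [fibMap_φ, kerPull_φ, kerPull_φ, fibMap_φ]
  change (F.functor Y).map (jP.natIso f x.p).hom ≫
    (F.natIso f ((jP.functor X).obj x.p)).hom ≫ _ =
    (θ.square Y ((P'.pull f).obj x.p)).hom ≫ _
  simp only [Functor.map_comp, Category.assoc]
  rw [← AdditiveFunctor.Iso.square_pull_assoc, ← AdditiveFunctor.natIso_naturality_assoc,
    AdditiveFunctor.natIso_unit]

/-- The compatibility of the functors between the fibres of the kernels with pull-backs. -/
def fibMapNat {X Y : LocallyDiscrete Cᵒᵖ} (f : X ⟶ Y) :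
    kerPull F' f ⋙ fibMap θ Y ≅ fibMap θ X ⋙ kerPull F f :=
  NatIso.ofComponents (fun x => isoMk (X := (fibMap θ Y).obj ((kerPull F' f).obj x))
    (Y := (kerPull F f).obj ((fibMap θ X).obj x)) (jP.natIso f x.p) (fibMapNat_w θ f x))
    (fun a => hom_ext (jP.natIso_naturality f a.hom))

instance {X Y : LocallyDiscrete Cᵒᵖ} (f : X ⟶ Y) : NatTrans.IsMonoidal (fibMapNat θ f).hom where
  unit := hom_ext (NatTrans.IsMonoidal.unit (τ := (jP.nat f).hom))
  tensor x y := hom_ext (NatTrans.IsMonoidal.tensor (τ := (jP.nat f).hom) x.p y.p)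

end KerObj

variable {P' Q' P Q : PicardPrestack.{w} C} {jP : AdditiveFunctor P' P} {jQ : AdditiveFunctor Q' Q}
  {F' : AdditiveFunctor P' Q'} {F : AdditiveFunctor P Q}

/-- The additive functor between kernels induced by a square of additive functors. -/
def kerMap (θ : AdditiveFunctor.Iso (jP.comp F) (F'.comp jQ)) :
    AdditiveFunctor (ker F') (ker F) :=
  { trans := AdditiveFunctor.transOfFibres (P := ker F') (Q := ker F)
      (fun X => KerObj.fibMap θ X) (fun f => KerObj.fibMapNat θ f)
      (fun x => KerObj.hom_ext (jP.nat_id x.p))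
      (fun f g x => KerObj.hom_ext (jP.nat_comp f g x.p))
    braided X := inferInstanceAs (KerObj.fibMap θ X).Braided
    naturality_isMonoidal f := inferInstanceAs (NatTrans.IsMonoidal (KerObj.fibMapNat θ f).hom) }

end PicardStack

/-! ### The induced functor between kernels is a local equivalence -/

namespace PicardStack

variable {C : Type u} [Category.{v} C] {J : GrothendieckTopology C}
  {P' Q' P Q : PicardPrestack.{w} C} {jP : AdditiveFunctor P' P} {jQ : AdditiveFunctor Q' Q}
  {F' : AdditiveFunctor P' Q'} {F : AdditiveFunctor P Q}

open Functor.LaxMonoidal Functor.OplaxMonoidal Functor.Monoidal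

namespace KerObj

lemma lifts_kerMap (θ : AdditiveFunctor.Iso (jP.comp F) (F'.comp jQ))
    {X Y : LocallyDiscrete Cᵒᵖ} (f : X ⟶ Y) {x y : KerObj (F'.functor X)}
    (b : (kerPull F' f).obj x ⟶ (kerPull F' f).obj y) (a : (fibMap θ X).obj x ⟶ (fibMap θ X).obj y)
    (h : jP.Lifts f (x := x.p) (y := y.p) b.hom a.hom) :
    (kerMap θ).Lifts f (x := x) (y := y) b a :=
  hom_ext h

/-- If the image in `ker F` of an arrow `b` of `P'` is an arrow, then `b` is an arrow of `ker F'`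
up to `jQ`. -/
lemma map_w_of_lifts (θ : AdditiveFunctor.Iso (jP.comp F) (F'.comp jQ))
    {X Y : LocallyDiscrete Cᵒᵖ} (f : X ⟶ Y) {x y : KerObj (F'.functor X)}
    (b : (P'.pull f).obj x.p ⟶ (P'.pull f).obj y.p) (a : (fibMap θ X).obj x ⟶ (fibMap θ X).obj y)
    (h : jP.Lifts f (x := x.p) (y := y.p) b a.hom) :
    (jQ.functor Y).map ((F'.functor Y).map b ≫ ((kerPull F' f).obj y).φ.hom) =
      (jQ.functor Y).map ((kerPull F' f).obj x).φ.hom := by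
  have h1 := fibMapNat_w θ f x
  have h2 := fibMapNat_w θ f y
  have h3 := ((kerPull F f).map a).w
  rw [fibMap_φ θ ((kerPull F' f).obj x)] at h1
  rw [fibMap_φ θ ((kerPull F' f).obj y)] at h2
  have h4 := θ.square_naturality b
  rw [← cancel_mono (η (jQ.functor Y)),
    ← cancel_epi (θ.square Y ((kerPull F' f).obj x).p).hom, ← h1, Functor.map_comp, Category.assoc]
  change (θ.square Y ((P'.pull f).obj x.p)).hom ≫ (jQ.functor Y).map ((F'.functor Y).map b) ≫ _ = _
  rw [← reassoc_of% h4]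
  refine (congrArg (fun t => _ ≫ t) h2.symm).trans ?_
  rw [← h3, ← Functor.map_comp_assoc, ← Functor.map_comp_assoc]
  exact congrArg (fun t => (F.functor Y).map t ≫ _) h

-- The trivialization of a pull-back is the pulled-back one between fixed isomorphisms, so the
-- equation may be checked after `Q'.pull g` alone.
lemma pull_w {X Y : LocallyDiscrete Cᵒᵖ} (g : X ⟶ Y) {x y : KerObj (F'.functor X)} (b : x.p ⟶ y.p)
    (h : (Q'.pull g).map ((F'.functor X).map b ≫ y.φ.hom) = (Q'.pull g).map x.φ.hom) :
    (F'.functor Y).map ((P'.pull g).map b) ≫ ((kerPull F' g).obj y).φ.hom =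
      ((kerPull F' g).obj x).φ.hom := by
  rw [kerPull_φ, kerPull_φ, AdditiveFunctor.natIso_naturality_assoc, ← h, Functor.map_comp,
    Category.assoc]

/-- An isomorphism from an object in the image of `kerMap` to a pull-back of an object of the
kernel, constructed from a lift of an arrow along `jQ`. -/
lemma exists_iso_of_lifts (θ : AdditiveFunctor.Iso (jP.comp F) (F'.comp jQ))
    {X Y : LocallyDiscrete Cᵒᵖ} (g : X ⟶ Y) (z : KerObj (F.functor X)) (x : P'.fib.obj X)
    (e : (jP.functor X).obj x ≅ z.p)
    (b : (Q'.pull g).obj ((F'.functor X).obj x) ⟶ (Q'.pull g).obj (𝟙_ _))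
    (h : jQ.Lifts g b ((θ.square X x).inv ≫ (F.functor X).map e.hom ≫ z.φ.hom ≫
      ε (jQ.functor X))) :
    ∃ y : KerObj (F'.functor Y), Nonempty ((fibMap θ Y).obj y ≅ (kerPull F g).obj z) := by
  have : IsIso b := IsGroupoid.all_isIso b
  -- The trivialization is F'(g^*x) ≅ g^*F'(x) ≅ g^*e ≅ e, with the lifted arrow `b` in the middle.
  refine ⟨⟨(P'.pull g).obj x, F'.natIso g x ≪≫ asIso b ≪≫ (εIso (Q'.pull g)).symm⟩,
    ⟨isoMk (jP.natIso g x ≪≫ (P.pull g).mapIso e) ?_⟩⟩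
  rw [fibMap_φ, kerPull_φ]
  change _ = (θ.square Y ((P'.pull g).obj x)).hom ≫ (jQ.functor Y).map
    ((F'.natIso g x).hom ≫ b ≫ η (Q'.pull g)) ≫ η (jQ.functor Y)
  change (F.functor Y).map ((jP.natIso g x).hom ≫ (P.pull g).map e.hom) ≫ _ = _
  have h1 := AdditiveFunctor.lifts_iff.1 h
  have h2 := jQ.natIso_unit g
  rw [← Iso.eq_inv_comp] at h2
  simp only [Functor.map_comp, Category.assoc] at h1 ⊢
  rw [h1]
  simp only [Category.assoc]
  rw [← h2, θ.square_pull_assoc, AdditiveFunctor.natIso_naturality_assoc]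
  simp only [Category.assoc, ← Functor.map_comp_assoc, ε_η, Category.comp_id, Iso.hom_inv_id_assoc]

end KerObj

/-- Faithfulness is that of `jP`. For fullness, lift the underlying arrow along `jP`; its
compatibility with the trivializations holds after applying `jQ`, hence locally by the faithfulness
of `jQ`. For objects, lift the underlying object along `jP` and then its trivialization, an arrow
between objects in the image of `jQ`, by the fullness of `jQ`. -/
lemma kerMap_isLocalEquiv (θ : AdditiveFunctor.Iso (jP.comp F) (F'.comp jQ))
    (hP : IsLocalEquiv J jP) (hQ : IsLocalEquiv J jQ) : IsLocalEquiv J (kerMap θ) where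
  faithful {X} x y a b h := (hP.faithful (KerObj.Hom.hom a) (KerObj.Hom.hom b)
    (congrArg KerObj.Hom.hom h)).mono fun V f hf => KerObj.hom_ext hf
  full {X x y} a := (hP.full (KerObj.Hom.hom a)).bind fun V f ⟨b, hb⟩ =>
    (hQ.faithful _ _ (KerObj.map_w_of_lifts θ f.op.toLoc b a hb)).mono fun W g hg => by
      let c : (kerPull F' g.op.toLoc).obj ((kerPull F' f.op.toLoc).obj x) ⟶
          (kerPull F' g.op.toLoc).obj ((kerPull F' f.op.toLoc).obj y) :=
        ⟨(P'.pull g.op.toLoc).map b, KerObj.pull_w (x := (kerPull F' f.op.toLoc).obj x)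
          (y := (kerPull F' f.op.toLoc).obj y) g.op.toLoc b hg⟩
      exact ⟨(PicardPrestack.pullIso (P := ker F') f.op.toLoc g.op.toLoc x).hom ≫ c ≫
        (PicardPrestack.pullIso (P := ker F') f.op.toLoc g.op.toLoc y).inv,
        KerObj.lifts_kerMap θ _ _ _ (AdditiveFunctor.Lifts.restrict hb g.op.toLoc)⟩
  essSurj {X} (a : KerObj (F.functor X)) := (hP.essSurj a.p).bind fun V f ⟨x, ⟨e⟩⟩ =>
    (hQ.full (X := .mk (op V)) (x := (F'.functor _).obj x) (y := 𝟙_ _)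
      ((θ.square _ x).inv ≫ (F.functor _).map e.hom ≫ ((kerPull F f.op.toLoc).obj a).φ.hom ≫
        ε (jQ.functor _))).mono fun W g ⟨b, hb⟩ => by
      obtain ⟨y, ⟨i⟩⟩ := KerObj.exists_iso_of_lifts θ g.op.toLoc ((kerPull F f.op.toLoc).obj a) x e
        b hb
      exact ⟨y, ⟨i ≪≫ (PicardPrestack.pullIso (P := ker F) f.op.toLoc g.op.toLoc a).symm⟩⟩

end PicardStack

/-! ### The kernel of a functor between stacks is a stack -/

namespace PicardStack

variable {C : Type u} [Category.{v} C] {J : GrothendieckTopology C}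
  {P Q : PicardPrestack.{w} C}

open Functor.LaxMonoidal Functor.OplaxMonoidal Functor.Monoidal

namespace PicardPrestack

variable {X Y Z : LocallyDiscrete Cᵒᵖ}

lemma pullIso'_unit (f : X ⟶ Y) (g : Y ⟶ Z) (h : X ⟶ Z) (e : f ≫ g = h) :
    (pullIso' f g h e (𝟙_ (P.fib.obj X))).hom ≫ (P.pull g).map (η (P.pull f)) ≫ η (P.pull g) =
      η (P.pull h) := by
  subst e
  rw [pullIso'_eq]
  have h1 := NatTrans.IsMonoidal.unit (τ := (P.pullComp f g).hom)
  have h2 : ε (P.pull f ⋙ P.pull g) = ε (P.pull g) ≫ (P.pull g).map (ε (P.pull f)) := rfl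
  rw [h2] at h1
  rw [← cancel_epi (ε (P.pull (f ≫ g)))]
  have h3 : ε (P.pull (f ≫ g)) ≫ (pullIso f g (𝟙_ (P.fib.obj X))).hom =
    ε (P.pull g) ≫ (P.pull g).map (ε (P.pull f)) := h1
  rw [reassoc_of% h3, ← Functor.map_comp_assoc]
  simp

lemma natIso_pullIso' (j : AdditiveFunctor P Q) (f : X ⟶ Y) (g : Y ⟶ Z) (h : X ⟶ Z)
    (e : f ≫ g = h) (x : P.fib.obj X) :
    (j.natIso h x).hom ≫ (pullIso' f g h e ((j.functor X).obj x)).hom =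
      (j.functor Z).map (pullIso' f g h e x).hom ≫
        (j.natIso g ((P.pull f).obj x)).hom ≫ (Q.pull g).map (j.natIso f x).hom := by
  subst e
  rw [pullIso'_eq, pullIso'_eq]
  exact j.natIso_pullIso f g x

variable {F : AdditiveFunctor P Q}

lemma pullIso'_ker_hom (f : X ⟶ Y) (g : Y ⟶ Z) (h : X ⟶ Z) (e : f ≫ g = h)
    (x : KerObj (F.functor X)) :
    KerObj.Hom.hom (pullIso' (P := ker F) f g h e x).hom = (pullIso' f g h e x.p).hom := by
  subst e
  exact (congrArg (fun t => KerObj.Hom.hom t.hom) (pullIso'_eq (P := ker F) f g x)).trans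
    (congrArg Iso.hom (pullIso'_eq f g x.p)).symm

lemma pullIso'_ker_inv (f : X ⟶ Y) (g : Y ⟶ Z) (h : X ⟶ Z) (e : f ≫ g = h)
    (x : KerObj (F.functor X)) :
    KerObj.Hom.hom (pullIso' (P := ker F) f g h e x).inv = (pullIso' f g h e x.p).inv := by
  subst e
  exact (congrArg (fun t => KerObj.Hom.hom t.inv) (pullIso'_eq (P := ker F) f g x)).trans
    (congrArg Iso.inv (pullIso'_eq f g x.p)).symm

end PicardPrestack

open PicardPrestack

namespace ker

variable {F : AdditiveFunctor P Q} {ι : Type*} {S : C} {X : ι → C} {f : ∀ i, X i ⟶ S}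

/-- The descent datum for the source of `F` underlying a descent datum for the kernel. -/
def descentData (D : (ker F).fib.DescentData f) : P.fib.DescentData f where
  obj i := KerObj.p (D.obj i)
  hom Y q i₁ i₂ f₁ f₂ h₁ h₂ := KerObj.Hom.hom (D.hom q f₁ f₂ h₁ h₂)
  pullHom_hom Y' Y g q q' hq i₁ i₂ f₁ f₂ hf₁ hf₂ gf₁ gf₂ hgf₁ hgf₂ := by
    rw [← D.pullHom_hom g q q' hq f₁ f₂ hf₁ hf₂ gf₁ gf₂ hgf₁ hgf₂]
    refine Eq.trans ?_ (congrArg₂ (fun s t => s ≫ (P.pull g.op.toLoc).map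
      (KerObj.Hom.hom (D.hom q f₁ f₂ hf₁ hf₂)) ≫ t)
      (pullIso'_ker_hom f₁.op.toLoc g.op.toLoc gf₁.op.toLoc (by subst hgf₁; rfl) (D.obj i₁)).symm
      (pullIso'_ker_inv f₂.op.toLoc g.op.toLoc gf₂.op.toLoc (by subst hgf₂; rfl) (D.obj i₂)).symm)
    rfl
  hom_self Y q i g h := congrArg KerObj.Hom.hom (D.hom_self q g h)
  hom_comp Y q i₁ i₂ i₃ f₁ f₂ f₃ h₁ h₂ h₃ :=
    congrArg KerObj.Hom.hom (D.hom_comp q f₁ f₂ f₃ h₁ h₂ h₃)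

lemma toDescentData_hom_hom (k : KerObj (F.functor (.mk (op S)))) ⦃Y : C⦄ (q : Y ⟶ S) ⦃i₁ i₂ : ι⦄
    (f₁ : Y ⟶ X i₁) (f₂ : Y ⟶ X i₂) (h₁ : f₁ ≫ f i₁ = q) (h₂ : f₂ ≫ f i₂ = q) :
    KerObj.Hom.hom ((((ker F).fib.toDescentData f).obj k).hom q f₁ f₂ h₁ h₂) =
      ((P.fib.toDescentData f).obj k.p).hom q f₁ f₂ h₁ h₂ :=
  congrArg₂ (fun s t => s ≫ t)
    (pullIso'_ker_inv (f i₁).op.toLoc f₁.op.toLoc q.op.toLoc (by subst h₁; rfl) k)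
    (pullIso'_ker_hom (f i₂).op.toLoc f₂.op.toLoc q.op.toLoc (by rw [← h₂]; rfl) k)

instance [(P.fib.toDescentData f).Faithful] : ((ker F).fib.toDescentData f).Faithful where
  map_injective {x y} a b h := KerObj.hom_ext ((P.fib.toDescentData f).map_injective
    (Pseudofunctor.DescentData.hom_ext fun i =>
      congrArg (fun t => KerObj.Hom.hom (t.hom i)) h))

/-- Converse of `KerObj.pull_w`: the isomorphisms surrounding the pulled-back trivializations
cancel. -/
lemma pull_eq_of_w {X Y : LocallyDiscrete Cᵒᵖ} (g : X ⟶ Y) {x y : KerObj (F.functor X)}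
    (a : x.p ⟶ y.p) (h : (F.functor Y).map ((P.pull g).map a) ≫ ((kerPull F g).obj y).φ.hom =
      ((kerPull F g).obj x).φ.hom) :
    (Q.pull g).map ((F.functor X).map a ≫ y.φ.hom) = (Q.pull g).map x.φ.hom := by
  rw [KerObj.kerPull_φ, KerObj.kerPull_φ, F.natIso_naturality_assoc, cancel_epi] at h
  rwa [← Category.assoc, cancel_mono, ← Functor.map_comp] at h

-- The underlying arrows glue in `P`. That the glued arrow respects the trivializations is an
-- equation between arrows of `Q`, which may be checked locally.
instance [(P.fib.toDescentData f).Full] [(Q.fib.toDescentData f).Faithful] :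
    ((ker F).fib.toDescentData f).Full where
  map_surjective {x y} φ := by
    let ψ : (P.fib.toDescentData f).obj (KerObj.p x) ⟶ (P.fib.toDescentData f).obj (KerObj.p y) :=
      { hom i := KerObj.Hom.hom (φ.hom i)
        comm Y q i₁ i₂ f₁ f₂ h₁ h₂ := by
          rw [← toDescentData_hom_hom (F := F) x, ← toDescentData_hom_hom (F := F) y]
          exact congrArg KerObj.Hom.hom (φ.comm q f₁ f₂ h₁ h₂) }
    obtain ⟨a, ha⟩ := (P.fib.toDescentData f).map_surjective ψ
    have ha' (i : ι) : (P.pull (f i).op.toLoc).map a = KerObj.Hom.hom (φ.hom i) :=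
      congrArg (fun t => t.hom i) ha
    refine ⟨⟨a, (Q.fib.toDescentData f).map_injective
      (Pseudofunctor.DescentData.hom_ext fun i => ?_)⟩,
      Pseudofunctor.DescentData.hom_ext fun i => KerObj.hom_ext (ha' i)⟩
    have h := KerObj.Hom.w (φ.hom i)
    rw [← ha' i] at h
    exact pull_eq_of_w (F := F) (f i).op.toLoc (x := x) (y := y) a h

/-- The objects of a descent datum for the kernel. -/
def datumObj (D : (ker F).fib.DescentData f) (i : ι) : KerObj (F.functor (.mk (op (X i)))) :=
  D.obj i

/-- The arrows of a descent datum for the kernel. -/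
def datumHom (D : (ker F).fib.DescentData f) {Y : C} (q : Y ⟶ S) {i₁ i₂ : ι}
    (f₁ : Y ⟶ X i₁) (f₂ : Y ⟶ X i₂) (h₁ : f₁ ≫ f i₁ = q) (h₂ : f₂ ≫ f i₂ = q) :
    (kerPull F f₁.op.toLoc).obj (datumObj D i₁) ⟶ (kerPull F f₂.op.toLoc).obj (datumObj D i₂) :=
  D.hom q f₁ f₂ h₁ h₂

section

variable (D : (ker F).fib.DescentData f) (p : P.fib.obj (.mk (op S)))
    (e : (P.fib.toDescentData f).obj p ≅ descentData D)

/-- The components of an isomorphism from `p` to the descent datum underlying a descent datum for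
the kernel. -/
def localIso (i : ι) : (P.pull (f i).op.toLoc).obj p ≅ (datumObj D i).p :=
  ⟨e.hom.hom i, e.inv.hom i, congrArg (fun t => t.hom i) e.hom_inv_id,
    congrArg (fun t => t.hom i) e.inv_hom_id⟩

lemma localIso_comm {Y : C} (q : Y ⟶ S) {i₁ i₂ : ι}
    (f₁ : Y ⟶ X i₁) (f₂ : Y ⟶ X i₂) (h₁ : f₁ ≫ f i₁ = q) (h₂ : f₂ ≫ f i₂ = q)
    (w₁ : (f i₁).op.toLoc ≫ f₁.op.toLoc = q.op.toLoc)
    (w₂ : (f i₂).op.toLoc ≫ f₂.op.toLoc = q.op.toLoc) :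
    (pullIso' (f i₁).op.toLoc f₁.op.toLoc q.op.toLoc w₁ p).hom ≫
      (P.pull f₁.op.toLoc).map (localIso D p e i₁).hom ≫ (datumHom D q f₁ f₂ h₁ h₂).hom =
    (pullIso' (f i₂).op.toLoc f₂.op.toLoc q.op.toLoc w₂ p).hom ≫
      (P.pull f₂.op.toLoc).map (localIso D p e i₂).hom := by
  have h : (P.pull f₁.op.toLoc).map (localIso D p e i₁).hom ≫ (datumHom D q f₁ f₂ h₁ h₂).hom =
    ((pullIso' (f i₁).op.toLoc f₁.op.toLoc q.op.toLoc w₁ p).inv ≫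
      (pullIso' (f i₂).op.toLoc f₂.op.toLoc q.op.toLoc w₂ p).hom) ≫
      (P.pull f₂.op.toLoc).map (localIso D p e i₂).hom := e.hom.comm q f₁ f₂ h₁ h₂
  rw [h, Category.assoc, Iso.hom_inv_id_assoc]

/-- The local trivializations of `F p` given by an isomorphism from `p` to the descent datum
underlying a descent datum for the kernel. -/
def localTriv (i : ι) :
    (Q.pull (f i).op.toLoc).obj ((F.functor _).obj p) ⟶
      (Q.pull (f i).op.toLoc).obj (𝟙_ (Q.fib.obj (.mk (op S)))) :=
  (F.natIso (f i).op.toLoc p).inv ≫ (F.functor _).map (localIso D p e i).hom ≫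
    (datumObj D i).φ.hom ≫ ε (Q.pull (f i).op.toLoc)

/-- Rewrites the restriction of the local trivialization in terms of the trivialization of the
pulled-back member of the datum; in this form different indices can be compared. -/
lemma localTriv_w {Y : C} (q : Y ⟶ S) (i : ι)
    (g : Y ⟶ X i) (w : (f i).op.toLoc ≫ g.op.toLoc = q.op.toLoc) :
    (pullIso' (f i).op.toLoc g.op.toLoc q.op.toLoc w ((F.functor _).obj p)).hom ≫
      (Q.pull g.op.toLoc).map (localTriv D p e i) ≫
      (pullIso' (f i).op.toLoc g.op.toLoc q.op.toLoc w (𝟙_ (Q.fib.obj _))).inv =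
    (F.natIso q.op.toLoc p).inv ≫ (F.functor _).map
      ((pullIso' (f i).op.toLoc g.op.toLoc q.op.toLoc w p).hom ≫
        (P.pull g.op.toLoc).map (localIso D p e i).hom) ≫
      ((kerPull F g.op.toLoc).obj (datumObj D i)).φ.hom ≫ ε (Q.pull q.op.toLoc) := by
  have h1 := natIso_pullIso' F (f i).op.toLoc g.op.toLoc q.op.toLoc w p
  have h2 := pullIso'_unit (P := Q) (f i).op.toLoc g.op.toLoc q.op.toLoc w
  rw [← cancel_epi (F.natIso q.op.toLoc p).hom, reassoc_of% h1,
    ← cancel_mono (η (Q.pull q.op.toLoc)), KerObj.kerPull_φ, localTriv]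
  simp only [Category.assoc, ← h2, Functor.map_comp, Iso.inv_hom_id_assoc, Iso.hom_inv_id_assoc,
    Iso.map_hom_inv_id_assoc, ε_η, Category.comp_id]
  rw [← Functor.map_comp_assoc (Q.pull g.op.toLoc) (ε _), ε_η, CategoryTheory.Functor.map_id,
    Category.id_comp]
  rw [← F.natIso_naturality_assoc]
  rw [h2, ε_η, Category.comp_id]

/-- The transition arrows of the datum are arrows of the kernel, so they respect the
trivializations. -/
lemma localTriv_comm {Y : C} (q : Y ⟶ S) {i₁ i₂ : ι}
    (f₁ : Y ⟶ X i₁) (f₂ : Y ⟶ X i₂) (h₁ : f₁ ≫ f i₁ = q) (h₂ : f₂ ≫ f i₂ = q)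
    (w₁ : (f i₁).op.toLoc ≫ f₁.op.toLoc = q.op.toLoc)
    (w₂ : (f i₂).op.toLoc ≫ f₂.op.toLoc = q.op.toLoc) :
    (pullIso' (f i₁).op.toLoc f₁.op.toLoc q.op.toLoc w₁ ((F.functor _).obj p)).hom ≫
      (Q.pull f₁.op.toLoc).map (localTriv D p e i₁) ≫
      (pullIso' (f i₁).op.toLoc f₁.op.toLoc q.op.toLoc w₁ (𝟙_ (Q.fib.obj _))).inv =
    (pullIso' (f i₂).op.toLoc f₂.op.toLoc q.op.toLoc w₂ ((F.functor _).obj p)).hom ≫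
      (Q.pull f₂.op.toLoc).map (localTriv D p e i₂) ≫
      (pullIso' (f i₂).op.toLoc f₂.op.toLoc q.op.toLoc w₂ (𝟙_ (Q.fib.obj _))).inv := by
  rw [localTriv_w, localTriv_w, ← localIso_comm D p e q f₁ f₂ h₁ h₂ w₁ w₂,
    ← (datumHom D q f₁ f₂ h₁ h₂).w]
  simp only [Functor.map_comp, Category.assoc]

end

-- Glue the underlying objects to `p` in `P`. The trivializations then form a morphism of descent
-- data from F(p) to the unit, which fullness for `Q` turns into an arrow `φ`; it is invertible
-- because the fibres are groupoids.
instance [(P.fib.toDescentData f).EssSurj] [(Q.fib.toDescentData f).Full] :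
    ((ker F).fib.toDescentData f).EssSurj where
  mem_essImage D := by
    obtain ⟨p, ⟨e⟩⟩ := Functor.EssSurj.mem_essImage (F := P.fib.toDescentData f) (descentData D)
    let ψ : (Q.fib.toDescentData f).obj ((F.functor _).obj p) ⟶
        (Q.fib.toDescentData f).obj (𝟙_ (Q.fib.obj (.mk (op S)))) :=
      { hom i := localTriv D p e i
        comm Y q i₁ i₂ f₁ f₂ h₁ h₂ := by
          have w₁ : (f i₁).op.toLoc ≫ f₁.op.toLoc = q.op.toLoc := by subst h₁; rfl
          have w₂ : (f i₂).op.toLoc ≫ f₂.op.toLoc = q.op.toLoc := by rw [← h₂]; rfl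
          have h := localTriv_comm D p e q f₁ f₂ h₁ h₂ w₁ w₂
          change (Q.pull f₁.op.toLoc).map (localTriv D p e i₁) ≫
            (pullIso' _ _ _ w₁ (𝟙_ _)).inv ≫ (pullIso' _ _ _ w₂ (𝟙_ _)).hom =
            ((pullIso' _ _ _ w₁ _).inv ≫ (pullIso' _ _ _ w₂ _).hom) ≫
            (Q.pull f₂.op.toLoc).map (localTriv D p e i₂)
          rw [← cancel_epi (pullIso' _ _ _ w₁ ((F.functor _).obj p)).hom, reassoc_of% h]
          simp }
    obtain ⟨φ, hφ⟩ := (Q.fib.toDescentData f).map_surjective ψ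
    have hφ' (i : ι) : (Q.pull (f i).op.toLoc).map φ = localTriv D p e i :=
      congrArg (fun t => t.hom i) hφ
    have : IsIso φ := IsGroupoid.all_isIso φ
    refine ⟨(⟨p, asIso φ⟩ : KerObj (F.functor _)), ⟨Pseudofunctor.DescentData.isoMk
      (fun i => KerObj.isoMk (X := (kerPull F (f i).op.toLoc).obj ⟨p, asIso φ⟩)
        (Y := datumObj D i) (localIso D p e i) ?_) ?_⟩⟩
    · rw [KerObj.kerPull_φ]
      change _ = (F.natIso (f i).op.toLoc p).hom ≫ (Q.pull (f i).op.toLoc).map φ ≫ _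
      rw [hφ' i, localTriv]
      simp only [Category.assoc, Iso.hom_inv_id_assoc, ε_η]
      rw [Category.comp_id]
    · intro Y q i₁ i₂ f₁ f₂ h₁ h₂
      refine KerObj.hom_ext ((e.hom.comm q f₁ f₂ h₁ h₂).trans ?_)
      rw [← toDescentData_hom_hom (F := F) ⟨p, asIso φ⟩]
      rfl

end ker

lemma ker_isStack (F : AdditiveFunctor P Q) (hP : P.fib.IsStack J) (hQ : Q.fib.IsStack J) :
    (ker F).fib.IsStack J :=
  .of_isStackFor fun S R hR => by
    have h1 := (Pseudofunctor.isStackFor_iff _ _).1 (P.fib.isStackFor' R hR)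
    have h2 := (Pseudofunctor.isStackFor_iff _ _).1 (Q.fib.isStackFor' R hR)
    exact (Pseudofunctor.isStackFor_iff _ _).2 { }

end PicardStack

/-! ### Additive functors from `pst(T)` to the kernel of `pst(f)` -/

namespace PicardStack

open Functor.LaxMonoidal Functor.OplaxMonoidal Functor.Monoidal

variable {C : Type u} [Category.{v} C] {J : GrothendieckTopology C}
  {T K L : CochainComplex (Sheaf J AddCommGrpCat.{w}) ℤ}

/-- The data of a morphism from a complex `T` to the kernel of the functor given by `f : K ⟶ L`. -/
structure KerDatum (T : CochainComplex (Sheaf J AddCommGrpCat.{w}) ℤ) (f : K ⟶ L) where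
  u : T.X (-1) ⟶ K.X (-1)
  b : T.X 0 ⟶ K.X 0
  c : T.X 0 ⟶ L.X (-1)
  w : c ≫ L.d (-1) 0 = -(b ≫ f.f 0)
  d_b : T.d (-1) 0 ≫ b = u ≫ K.d (-1) 0
  d_c : T.d (-1) 0 ≫ c = -(u ≫ f.f (-1))

/-- The map on sections. -/
abbrev sec {A B : Sheaf J AddCommGrpCat.{w}} (a : A ⟶ B) (X : LocallyDiscrete Cᵒᵖ) :
    A.obj.obj X.as →+ B.obj.obj X.as := (a.hom.app X.as).hom

lemma sec_comp {A B D : Sheaf J AddCommGrpCat.{w}} (a : A ⟶ B) (b : B ⟶ D)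
    (X : LocallyDiscrete Cᵒᵖ) (x : A.obj.obj X.as) : sec (a ≫ b) X x = sec b X (sec a X x) := rfl

lemma sec_neg {A B : Sheaf J AddCommGrpCat.{w}} (a : A ⟶ B)
    (X : LocallyDiscrete Cᵒᵖ) (x : A.obj.obj X.as) : sec (-a) X x = - sec a X x := rfl

lemma sec_add {A B : Sheaf J AddCommGrpCat.{w}} (a b : A ⟶ B)
    (X : LocallyDiscrete Cᵒᵖ) (x : A.obj.obj X.as) : sec (a + b) X x = sec a X x + sec b X x := rfl

lemma sec_naturality {A B : Sheaf J AddCommGrpCat.{w}} (a : A ⟶ B) {X Y : LocallyDiscrete Cᵒᵖ}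
    (g : X ⟶ Y) (x : A.obj.obj X.as) :
    sec a Y ((A.obj.map g.as).hom x) = (B.obj.map g.as).hom (sec a X x) :=
  ConcreteCategory.congr_hom (a.hom.naturality g.as) x

namespace KerDatum

variable {f : K ⟶ L} (D : KerDatum T f)

lemma sec_w (X : LocallyDiscrete Cᵒᵖ) (m : (T.X 0).obj.obj X.as) :
    diff L X (sec D.c X m) = - sec (f.f 0) X (sec D.b X m) :=
  congrArg (fun t => sec t X m) D.w

lemma sec_d_b (X : LocallyDiscrete Cᵒᵖ) (k : (T.X (-1)).obj.obj X.as) :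
    diff K X (sec D.u X k) = sec D.b X (diff T X k) :=
  congrArg (fun t => sec t X k) D.d_b.symm

lemma sec_d_c (X : LocallyDiscrete Cᵒᵖ) (k : (T.X (-1)).obj.obj X.as) :
    sec D.c X (diff T X k) = - sec (f.f (-1)) X (sec D.u X k) :=
  congrArg (fun t => sec t X k) D.d_c

/-- The functor between fibres. -/
abbrev base (X : LocallyDiscrete Cᵒᵖ) : TwoTerm (diff T X) ⥤ TwoTerm (diff K X) :=
  TwoTerm.map (sec D.u X) (sec D.b X) (D.sec_d_b X)

/-- The trivialization of the image in `pst(L)`. -/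
def triv (X : LocallyDiscrete Cᵒᵖ) (m : TwoTerm (diff T X)) :
    (pstMapFib f X).obj ((D.base X).obj m) ≅ 𝟙_ (TwoTerm (diff L X)) where
  hom := ⟨sec D.c X m.as, by
    rw [D.sec_w]
    exact (zero_sub _).symm⟩
  inv := ⟨-sec D.c X m.as, by
    rw [map_neg, D.sec_w, neg_neg]
    exact (sub_zero _).symm⟩
  hom_inv_id := TwoTerm.hom_ext (add_neg_cancel _)
  inv_hom_id := TwoTerm.hom_ext (neg_add_cancel _)

/-- The functor to the fibre of the kernel. -/
@[reducible]
def fib (X : LocallyDiscrete Cᵒᵖ) : TwoTerm (diff T X) ⥤ KerObj ((pstMap f).functor X) where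
  obj m := ⟨(D.base X).obj m, D.triv X m⟩
  map {m m'} k := ⟨(D.base X).map k, TwoTerm.hom_ext (by
    change sec (f.f (-1)) X (sec D.u X k.k) + sec D.c X m'.as = sec D.c X m.as
    have h := D.sec_d_c X k.k
    rw [k.w, map_sub] at h
    rw [eq_add_of_sub_eq h]
    abel)⟩
  map_id m := KerObj.hom_ext ((D.base X).map_id m)
  map_comp k l := KerObj.hom_ext ((D.base X).map_comp k l)

/-- The functor to the fibre of the kernel is symmetric monoidal. -/
def core (X : LocallyDiscrete Cᵒᵖ) : (D.fib X).CoreMonoidal where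
  εIso := KerObj.isoMk (X := 𝟙_ _) (Y := (D.fib X).obj (𝟙_ _))
    (TwoTerm.mapCore (sec D.u X) (sec D.b X) (D.sec_d_b X)).εIso (TwoTerm.hom_ext (by
      change sec (f.f (-1)) X 0 + sec D.c X 0 = 0
      simp))
  μIso x y := KerObj.isoMk (X := (D.fib X).obj x ⊗ (D.fib X).obj y) (Y := (D.fib X).obj (x ⊗ y))
    ((TwoTerm.mapCore (sec D.u X) (sec D.b X) (D.sec_d_b X)).μIso x y) (TwoTerm.hom_ext (by
      change sec (f.f (-1)) X 0 + sec D.c X (x.as + y.as) =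
        0 + ((sec D.c X x.as + sec D.c X y.as) + 0)
      simp))
  μIso_hom_natural_left k z := KerObj.hom_ext
    ((TwoTerm.mapCore (sec D.u X) (sec D.b X) (D.sec_d_b X)).μIso_hom_natural_left k z)
  μIso_hom_natural_right z k := KerObj.hom_ext
    ((TwoTerm.mapCore (sec D.u X) (sec D.b X) (D.sec_d_b X)).μIso_hom_natural_right z k)
  associativity x y z := KerObj.hom_ext
    ((TwoTerm.mapCore (sec D.u X) (sec D.b X) (D.sec_d_b X)).associativity x y z)
  left_unitality x := KerObj.hom_ext
    ((TwoTerm.mapCore (sec D.u X) (sec D.b X) (D.sec_d_b X)).left_unitality x)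
  right_unitality x := KerObj.hom_ext
    ((TwoTerm.mapCore (sec D.u X) (sec D.b X) (D.sec_d_b X)).right_unitality x)

instance (X : LocallyDiscrete Cᵒᵖ) : (D.fib X).Monoidal := (D.core X).toMonoidal

instance (X : LocallyDiscrete Cᵒᵖ) : (D.fib X).Braided where
  braided x y := KerObj.hom_ext
    ((TwoTerm.mapBraided (sec D.u X) (sec D.b X) (D.sec_d_b X)).braided x y)

/-- The compatibility of the functors between fibres with pull-backs, on the level of `pst(K)`. -/
abbrev baseNat {X Y : LocallyDiscrete Cᵒᵖ} (g : X ⟶ Y) :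
    pstPull T g ⋙ D.base Y ≅ D.base X ⋙ pstPull K g :=
  TwoTerm.mapSquare _ _ _ _ _ _ _ _ _ _ _ _
    (fun k => sec_naturality D.u g k) (fun x => sec_naturality D.b g x)

/-- The compatibility of the functors between fibres with pull-backs. -/
def nat {X Y : LocallyDiscrete Cᵒᵖ} (g : X ⟶ Y) :
    pstPull T g ⋙ D.fib Y ≅ D.fib X ⋙ kerPull (pstMap f) g :=
  NatIso.ofComponents (fun m => KerObj.isoMk (X := (D.fib Y).obj ((pstPull T g).obj m))
    (Y := (kerPull (pstMap f) g).obj ((D.fib X).obj m)) ((D.baseNat g).app m)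
    (TwoTerm.hom_ext (by
      change sec (f.f (-1)) Y 0 + (0 + (((L.X (-1)).obj.map g.as).hom (sec D.c X m.as) + 0)) =
        sec D.c Y (((T.X 0).obj.map g.as).hom m.as)
      rw [sec_naturality]
      simp))) (fun k => KerObj.hom_ext ((D.baseNat g).hom.naturality k))

instance {X Y : LocallyDiscrete Cᵒᵖ} (g : X ⟶ Y) : NatTrans.IsMonoidal (D.nat g).hom where
  unit := KerObj.hom_ext (NatTrans.IsMonoidal.unit (τ := (D.baseNat g).hom))
  tensor x y := KerObj.hom_ext (NatTrans.IsMonoidal.tensor (τ := (D.baseNat g).hom) x y)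

/-- The strong transformation underlying the additive functor to the kernel of `pst(f)`. -/
def toKerTrans : (pst T).fib.StrongTrans (ker (pstMap f)).fib :=
  AdditiveFunctor.transOfFibres (P := pst T) (Q := ker (pstMap f))
    (fun X => D.fib X) (fun g => D.nat g)
    (fun {X} x => KerObj.hom_ext (TwoTerm.hom_ext (by
      change 0 + 0 = sec D.u X 0
      simp)))
    (fun {X Y Z} g h x => KerObj.hom_ext (TwoTerm.hom_ext (by
      change 0 + 0 = sec D.u Z 0 + (0 + ((K.X (-1)).obj.map h.as).hom 0)
      simp)))

/-- The additive functor to the kernel of `pst(f)`. -/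
def toKer : AdditiveFunctor (pst T) (ker (pstMap f)) where
  trans := D.toKerTrans
  braided X := inferInstanceAs (D.fib X).Braided
  naturality_isMonoidal g := inferInstanceAs (NatTrans.IsMonoidal (D.nat g).hom)

/-- The hypotheses say that, on sections, `T` is K⁻¹ in degree -1 and the group of pairs (x, y) with
d y = -f⁰(x) in degree 0. The functor is then an equivalence on every fibre, and each local
condition holds on the maximal sieve. -/
lemma toKer_isLocalEquiv
    (hu : ∀ X, Function.Bijective (sec D.u X))
    (hinj : ∀ X (m : (T.X 0).obj.obj X.as), sec D.b X m = 0 → sec D.c X m = 0 → m = 0)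
    (hsurj : ∀ X (x : (K.X 0).obj.obj X.as) (y : (L.X (-1)).obj.obj X.as),
      diff L X y = - sec (f.f 0) X x → ∃ m, sec D.b X m = x ∧ sec D.c X m = y) :
    IsLocalEquiv J D.toKer where
  faithful {X} x y a b h := by
    have : a = b := TwoTerm.hom_ext ((hu X).1 (congrArg (fun t => TwoTerm.Hom.k (KerObj.Hom.hom t)) h))
    subst this
    exact .of_forall fun _ _ => rfl
  full {X} x y a := by
    suffices h : ∃ a', (D.fib X).map a' = a by
      obtain ⟨a', rfl⟩ := h
      exact .of_forall fun V g => ⟨_, AdditiveFunctor.lifts_map (j := D.toKer) _ a'⟩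
    change (D.fib X).obj x ⟶ (D.fib X).obj y at a
    obtain ⟨k, hk⟩ := (hu X).2 a.hom.k
    have h1 : diff K X (sec D.u X k) = sec D.b X (TwoTerm.as y) - sec D.b X (TwoTerm.as x) := by
      rw [hk]; exact a.hom.w
    have h2 : sec (f.f (-1)) X (sec D.u X k) + sec D.c X (TwoTerm.as y) =
        sec D.c X (TwoTerm.as x) := by
      rw [hk]; exact congrArg TwoTerm.Hom.k a.w
    -- The section `k` is an arrow x → y of `pst(T)` because d k - (y - x) is killed by both
    -- components of the embedding of T⁰.
    refine ⟨⟨k, sub_eq_zero.1 (hinj X _ ?_ ?_)⟩, KerObj.hom_ext (TwoTerm.hom_ext hk)⟩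
    · rw [map_sub, map_sub, ← D.sec_d_b, h1, sub_self]
    · rw [map_sub, map_sub, D.sec_d_c, ← h2]
      abel
  essSurj {X} (a : KerObj (pstMapFib f X)) := by
    obtain ⟨m, hm, hm'⟩ := hsurj X a.p.as a.φ.hom.k (a.φ.hom.w.trans (zero_sub _))
    let x : TwoTerm (diff T X) := ⟨m⟩
    have e : (D.fib X).obj x ≅ a := KerObj.isoMk (TwoTerm.isoOfEq hm) (TwoTerm.hom_ext (by
      change sec (f.f (-1)) X 0 + a.φ.hom.k = sec D.c X m
      rw [hm', map_zero, zero_add]))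
    exact .of_forall fun V g => ⟨((pst T).pull g.op.toLoc).obj x,
      ⟨D.toKer.natIso g.op.toLoc x ≪≫ ((ker (pstMap f)).pull g.op.toLoc).mapIso e⟩⟩

end KerDatum

end PicardStack

/-! ### Sections of abelian sheaves, and the kernel of `pst(f)` as a truncated cone -/

namespace PicardStack

variable {C : Type u} [Category.{v} C] {J : GrothendieckTopology C}

section Sections

variable {A B : Sheaf J AddCommGrpCat.{w}} (X : LocallyDiscrete Cᵒᵖ)

lemma sec_bijective (a : A ⟶ B) [IsIso a] : Function.Bijective (sec a X) :=
  Function.bijective_iff_has_inverse.2 ⟨sec (inv a) X,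
    fun x => by rw [← sec_comp, IsIso.hom_inv_id]; rfl,
    fun x => by rw [← sec_comp, IsIso.inv_hom_id]; rfl⟩

lemma sec_biprod_ext [Limits.HasBinaryBiproduct A B] {x y : (A ⊞ B).obj.obj X.as}
    (h₁ : sec Limits.biprod.fst X x = sec Limits.biprod.fst X y)
    (h₂ : sec Limits.biprod.snd X x = sec Limits.biprod.snd X y) : x = y := by
  have h (z : (A ⊞ B).obj.obj X.as) : z = sec Limits.biprod.inl X (sec Limits.biprod.fst X z) +
      sec Limits.biprod.inr X (sec Limits.biprod.snd X z) := by
    rw [← sec_comp, ← sec_comp, ← sec_add, Limits.biprod.total]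
    rfl
  rw [h x, h y, h₁, h₂]

/-- Left exactness of the sections functor: it is the inclusion into presheaves followed by an
evaluation, and both preserve kernels. -/
lemma exists_sec_kernel [HasSheafify J AddCommGrpCat.{w}] (g : A ⟶ B) (x : A.obj.obj X.as)
    (h : sec g X x = 0) : ∃ y, sec (Limits.kernel.ι g) X y = x := by
  let S := ShortComplex.mk (Limits.kernel.ι g) g (by simp)
  have hS : S.Exact := ShortComplex.exact_of_f_is_kernel _ (Limits.kernelIsKernel g)
  let Φ := sheafToPresheaf J AddCommGrpCat.{w} ⋙ (evaluation _ _).obj X.as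
  have := (ShortComplex.ab_exact_iff _).1 (hS.map_of_mono_of_preservesKernel Φ
    (inferInstanceAs (Mono (Limits.kernel.ι g))) inferInstance)
  exact this x h

lemma sec_kernel_ι_injective [HasSheafify J AddCommGrpCat.{w}] (g : A ⟶ B) :
    Function.Injective (sec (Limits.kernel.ι g) X) := by
  let Φ := sheafToPresheaf J AddCommGrpCat.{w} ⋙ (evaluation _ _).obj X.as
  have : Mono (Φ.map (Limits.kernel.ι g)) := inferInstance
  exact (AddCommGrpCat.mono_iff_injective _).1 this

end Sections

variable (K L : CochainComplex (Sheaf J AddCommGrpCat.{max u v}) ℤ) (f : K ⟶ L)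
    [K.IsStrictlyLE 0] [L.IsStrictlyGE (-1)]

/-- The truncation `τ_{≤0}` of the shifted mapping cone maps to the kernel of `pst(f)`, and this
is a local equivalence. -/
lemma exists_isLocalEquiv_ker :
    ∃ j : AdditiveFunctor (pst (((CochainComplex.mappingCone f)⟦(-1 : ℤ)⟧).truncLE 0))
      (ker (pstMap f)), IsLocalEquiv J j := by
  obtain ⟨e₁, e₀, h⟩ := exists_iso_truncLE_mappingCone K L f
  have h' := (Iso.eq_inv_comp e₁).2 h
  let D : KerDatum (((CochainComplex.mappingCone f)⟦(-1 : ℤ)⟧).truncLE 0) f :=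
    -- The differential of the truncation is (f⁻¹, -d^K), whereas the K⁰-component of a kernel arrow
    -- must satisfy d(u k) = b(d k). The sign is absorbed by `u`.
    { u := -e₁.inv
      b := e₀.inv ≫ Limits.kernel.ι _ ≫ Limits.biprod.snd
      c := e₀.inv ≫ Limits.kernel.ι _ ≫ Limits.biprod.fst
      w := by
        simp only [Category.assoc]
        rw [eq_neg_iff_add_eq_zero, ← Preadditive.comp_add, ← Preadditive.comp_add,
          ← Limits.biprod.desc_eq, Limits.kernel.condition, Limits.comp_zero]
      d_b := by
        rw [h']
        simp
      d_c := by
        rw [h']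
        simp }
  have : IsIso (-e₁.inv) := ⟨-e₁.hom, by simp, by simp⟩
  refine ⟨D.toKer, D.toKer_isLocalEquiv (fun X => sec_bijective X (-e₁.inv)) ?_ ?_⟩
  · intro X m h₁ h₂
    apply (sec_bijective X e₀.inv).1
    apply sec_kernel_ι_injective
    rw [map_zero, map_zero]
    exact sec_biprod_ext X (h₂.trans (map_zero _).symm) (h₁.trans (map_zero _).symm)
  · intro X x y hxy
    -- The condition d y = -f⁰(x) says that (y, x) is killed by (d^L, f⁰), hence comes from a
    -- section of the kernel sheaf.
    obtain ⟨n, hn⟩ := exists_sec_kernel X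
      (Limits.biprod.desc (L.d (-1) 0) (f.f 0) : L.X (-1) ⊞ K.X 0 ⟶ L.X 0)
      (sec Limits.biprod.inl X y + sec Limits.biprod.inr X x) (by
        rw [map_add, ← sec_comp, ← sec_comp, Limits.biprod.inl_desc, Limits.biprod.inr_desc]
        exact eq_neg_iff_add_eq_zero.1 hxy)
    obtain ⟨m, rfl⟩ := (sec_bijective X e₀.inv).2 n
    refine ⟨m, ?_, ?_⟩
    · change sec Limits.biprod.snd X (sec (Limits.kernel.ι _) X (sec e₀.inv X m)) = x
      rw [hn, map_add, ← sec_comp, ← sec_comp, Limits.biprod.inl_snd, Limits.biprod.inr_snd]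
      exact zero_add x
    · change sec Limits.biprod.fst X (sec (Limits.kernel.ι _) X (sec e₀.inv X m)) = y
      rw [hn, map_add, ← sec_comp, ← sec_comp, Limits.biprod.inl_fst, Limits.biprod.inr_fst]
      exact add_zero y

end PicardStack

/-! ### The functor between cokernels induced by a square -/

namespace PicardStack

open Functor.LaxMonoidal Functor.OplaxMonoidal Functor.Monoidal

namespace CokerObj

section

universe v₁ v₂ u₁ u₂ v₁' v₂' u₁' u₂' v₁'' v₂'' u₁'' u₂''

variable {P : Type u₁} [Category.{v₁} P] [MonoidalCategory P] [SymmetricCategory P]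
  {Q : Type u₂} [Category.{v₂} Q] [MonoidalCategory Q] [SymmetricCategory Q]
  {P' : Type u₁'} [Category.{v₁'} P'] [MonoidalCategory P'] [SymmetricCategory P']
  {Q' : Type u₂'} [Category.{v₂'} Q'] [MonoidalCategory Q'] [SymmetricCategory Q']
  {P'' : Type u₁''} [Category.{v₁''} P''] [MonoidalCategory P''] [SymmetricCategory P'']
  {Q'' : Type u₂''} [Category.{v₂''} Q''] [MonoidalCategory Q''] [SymmetricCategory Q'']
  {F : P ⥤ Q} [F.Braided] {F' : P' ⥤ Q'} [F'.Braided] {F'' : P'' ⥤ Q''} [F''.Braided]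
  (G₁ : P ⥤ P') [G₁.Braided] (H₁ : Q ⥤ Q') [H₁.Braided] (θ₁ : G₁ ⋙ F' ⟶ F ⋙ H₁)
  [NatTrans.IsMonoidal θ₁]
  (G₂ : P' ⥤ P'') [G₂.Braided] (H₂ : Q' ⥤ Q'') [H₂.Braided] (θ₂ : G₂ ⋙ F'' ⟶ F' ⋙ H₂)
  [NatTrans.IsMonoidal θ₂]

/-- The second component of the image of a pair `(p, α)` under the functor given by a square. -/
def mapArrow {x y : Q} {p : P} (α : x ⊗ F.obj p ⟶ y) :
    H₁.obj x ⊗ F'.obj (G₁.obj p) ⟶ H₁.obj y :=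
  H₁.obj x ◁ θ₁.app p ≫ μ H₁ x (F.obj p) ≫ H₁.map α

lemma map_homMk_eq {X Y : CokerObj F} (p : P) (α : X.as ⊗ F.obj p ⟶ Y.as) :
    (map G₁ H₁ θ₁).map (homMk p α) = homMk (X := (map G₁ H₁ θ₁).obj X)
      (Y := (map G₁ H₁ θ₁).obj Y) (G₁.obj p) (mapArrow G₁ H₁ θ₁ α) := rfl

lemma mapArrow_whisker {x y : Q} {p p' : P} (c : p ⟶ p') (α : x ⊗ F.obj p' ⟶ y) :
    mapArrow G₁ H₁ θ₁ (x ◁ F.map c ≫ α) =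
      H₁.obj x ◁ F'.map (G₁.map c) ≫ mapArrow G₁ H₁ θ₁ α := by
  have := θ₁.naturality c
  dsimp at this
  simp only [mapArrow, Functor.map_comp]
  rw [← whiskerLeft_comp_assoc, this, ← μ_natural_right_assoc, whiskerLeft_comp_assoc]

/-- The passage from `H₁.map α` to `mapArrow` is composition with isomorphisms only. -/
lemma map_eq_of_mapArrow_eq [IsIso θ₁] {x y : Q} {p : P} {α β : x ⊗ F.obj p ⟶ y}
    (h : mapArrow G₁ H₁ θ₁ α = mapArrow G₁ H₁ θ₁ β) : H₁.map α = H₁.map β := by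
  have : IsIso (H₁.obj x ◁ θ₁.app p) := inferInstance
  rwa [mapArrow, mapArrow, cancel_epi, cancel_epi] at h

lemma ε_map_comp : ε (map G₁ H₁ θ₁ ⋙ map G₂ H₂ θ₂) =
    ofHom (X := 𝟙_ _) (Y := (map G₂ H₂ θ₂).obj ((map G₁ H₁ θ₁).obj (𝟙_ _)))
      (ε H₂ ≫ H₂.map (ε H₁)) := by
  have h1 := map_ofHom G₂ H₂ θ₂ (X := 𝟙_ _) (Y := (map G₁ H₁ θ₁).obj (𝟙_ _)) (ε H₁)
  refine (congrArg (fun t => ofHom (X := 𝟙_ (CokerObj F''))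
    (Y := (map G₂ H₂ θ₂).obj (𝟙_ _)) (ε H₂) ≫ t) h1).trans ?_
  exact (ofHom_comp (X := 𝟙_ (CokerObj F'')) (Y := (map G₂ H₂ θ₂).obj (𝟙_ _))
    (Z := (map G₂ H₂ θ₂).obj ((map G₁ H₁ θ₁).obj (𝟙_ _))) (ε H₂) (H₂.map (ε H₁))).symm

lemma μ_map_comp (X Y : CokerObj F) : μ (map G₁ H₁ θ₁ ⋙ map G₂ H₂ θ₂) X Y =
    ofHom (X := (map G₂ H₂ θ₂).obj ((map G₁ H₁ θ₁).obj X) ⊗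
        (map G₂ H₂ θ₂).obj ((map G₁ H₁ θ₁).obj Y))
      (Y := (map G₂ H₂ θ₂).obj ((map G₁ H₁ θ₁).obj (X ⊗ Y)))
      (μ H₂ (H₁.obj X.as) (H₁.obj Y.as) ≫ H₂.map (μ H₁ X.as Y.as)) := by
  have h1 := map_ofHom G₂ H₂ θ₂ (X := (map G₁ H₁ θ₁).obj X ⊗ (map G₁ H₁ θ₁).obj Y)
    (Y := (map G₁ H₁ θ₁).obj (X ⊗ Y)) (μ H₁ X.as Y.as)
  refine Eq.trans ?_ (ofHom_comp (X := (map G₂ H₂ θ₂).obj ((map G₁ H₁ θ₁).obj X) ⊗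
      (map G₂ H₂ θ₂).obj ((map G₁ H₁ θ₁).obj Y))
    (Y := (map G₂ H₂ θ₂).obj ((map G₁ H₁ θ₁).obj X ⊗ (map G₁ H₁ θ₁).obj Y))
    (Z := (map G₂ H₂ θ₂).obj ((map G₁ H₁ θ₁).obj (X ⊗ Y)))
    (μ H₂ (H₁.obj X.as) (H₁.obj Y.as)) (H₂.map (μ H₁ X.as Y.as))).symm
  exact congrArg (fun t => ofHom (X := (map G₂ H₂ θ₂).obj ((map G₁ H₁ θ₁).obj X) ⊗
      (map G₂ H₂ θ₂).obj ((map G₁ H₁ θ₁).obj Y))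
    (Y := (map G₂ H₂ θ₂).obj ((map G₁ H₁ θ₁).obj X ⊗ (map G₁ H₁ θ₁).obj Y))
    (μ H₂ (H₁.obj X.as) (H₁.obj Y.as)) ≫ t) h1

end

end CokerObj

variable {C : Type u} [Category.{v} C] {J : GrothendieckTopology C}

namespace AdditiveFunctor

variable {P Q : PicardPrestack.{w} C} (j : AdditiveFunctor P Q)

lemma natIso_tensor {X Y : LocallyDiscrete Cᵒᵖ} (f : X ⟶ Y) (x y : P.fib.obj X) :
    μ (j.functor Y) _ _ ≫ (j.functor Y).map (μ (P.pull f) x y) ≫ (j.natIso f (x ⊗ y)).hom =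
      ((j.natIso f x).hom ⊗ₘ (j.natIso f y).hom) ≫ μ (Q.pull f) _ _ ≫
        (Q.pull f).map (μ (j.functor X) x y) := by
  have h := NatTrans.IsMonoidal.tensor (τ := (j.nat f).hom) x y
  have h1 : μ (P.pull f ⋙ j.functor Y) x y =
    μ (j.functor Y) _ _ ≫ (j.functor Y).map (μ (P.pull f) x y) := rfl
  have h2 : μ (j.functor X ⋙ Q.pull f) x y =
    μ (Q.pull f) _ _ ≫ (Q.pull f).map (μ (j.functor X) x y) := rfl
  rw [h1, h2, Category.assoc] at h
  exact h

lemma natIso_tensor_assoc {X Y : LocallyDiscrete Cᵒᵖ} (f : X ⟶ Y) (x y : P.fib.obj X)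
    {z : Q.fib.obj Y} (h : (Q.pull f).obj ((j.functor X).obj (x ⊗ y)) ⟶ z) :
    μ (j.functor Y) _ _ ≫ (j.functor Y).map (μ (P.pull f) x y) ≫ (j.natIso f (x ⊗ y)).hom ≫ h =
      ((j.natIso f x).hom ⊗ₘ (j.natIso f y).hom) ≫ μ (Q.pull f) _ _ ≫
        (Q.pull f).map (μ (j.functor X) x y) ≫ h := by
  simpa only [Category.assoc] using congrArg (fun t => t ≫ h) (j.natIso_tensor f x y)

end AdditiveFunctor

namespace CokerObj

variable {P' Q' P Q : PicardPrestack.{w} C} {jP : AdditiveFunctor P' P} {jQ : AdditiveFunctor Q' Q}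
  {F' : AdditiveFunctor P' Q'} {F : AdditiveFunctor P Q}
  (θ : AdditiveFunctor.Iso (jP.comp F) (F'.comp jQ))

/-- The functor between the fibres of the cokernels. -/
abbrev fibMap (X : LocallyDiscrete Cᵒᵖ) : CokerObj (F'.functor X) ⥤ CokerObj (F.functor X) :=
  CokerObj.map (jP.functor X) (jQ.functor X) (θ.fibIso X).hom

/-- The action of the functor between the fibres of the cokernels on pairs. -/
abbrev fibArrow {X : LocallyDiscrete Cᵒᵖ} {x y : Q'.fib.obj X} {p : P'.fib.obj X}
    (α : x ⊗ (F'.functor X).obj p ⟶ y) :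
    (jQ.functor X).obj x ⊗ (F.functor X).obj ((jP.functor X).obj p) ⟶ (jQ.functor X).obj y :=
  mapArrow (jP.functor X) (jQ.functor X) (θ.fibIso X).hom α

/-- The action of the pull-back functors on pairs. -/
abbrev pullArrow (F : AdditiveFunctor P Q) {X Y : LocallyDiscrete Cᵒᵖ} (f : X ⟶ Y)
    {x y : Q.fib.obj X} {p : P.fib.obj X} (α : x ⊗ (F.functor X).obj p ⟶ y) :
    (Q.pull f).obj x ⊗ (F.functor Y).obj ((P.pull f).obj p) ⟶ (Q.pull f).obj y :=
  mapArrow (P.pull f) (Q.pull f) (F.nat f).hom α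

lemma fibArrow_eq {X : LocallyDiscrete Cᵒᵖ} {x y : Q'.fib.obj X} {p : P'.fib.obj X}
    (α : x ⊗ (F'.functor X).obj p ⟶ y) : fibArrow θ α =
    (jQ.functor X).obj x ◁ (θ.square X p).hom ≫ μ (jQ.functor X) _ _ ≫ (jQ.functor X).map α := rfl

lemma pullArrow_eq {X Y : LocallyDiscrete Cᵒᵖ} (f : X ⟶ Y)
    {x y : Q.fib.obj X} {p : P.fib.obj X} (α : x ⊗ (F.functor X).obj p ⟶ y) :
    pullArrow F f α = (Q.pull f).obj x ◁ (F.natIso f p).hom ≫ μ (Q.pull f) _ _ ≫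
      (Q.pull f).map α := rfl

/-- The compatibility of the actions on pairs, for lifts of arrows. -/
lemma fibArrow_of_lifts {X Y : LocallyDiscrete Cᵒᵖ} (f : X ⟶ Y) {x y : Q'.fib.obj X}
    {p : P'.fib.obj X} (b : (Q'.pull f).obj (x ⊗ (F'.functor X).obj p) ⟶ (Q'.pull f).obj y)
    (a : (jQ.functor X).obj (x ⊗ (F'.functor X).obj p) ⟶ (jQ.functor X).obj y)
    (h : jQ.Lifts f b a) :
    fibArrow θ ((Q'.pull f).obj x ◁ (F'.natIso f p).hom ≫ μ (Q'.pull f) _ _ ≫ b) ≫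
      (jQ.natIso f y).hom = ((jQ.natIso f x).hom ⊗ₘ (F.functor Y).map (jP.natIso f p).hom) ≫
        pullArrow F f ((jQ.functor X).obj x ◁ (θ.square X p).hom ≫ μ (jQ.functor X) _ _ ≫ a) := by
  rw [fibArrow_eq, pullArrow_eq]
  unfold AdditiveFunctor.Lifts at h
  simp only [Functor.map_comp, Category.assoc]
  rw [h, ← μ_natural_right_assoc, AdditiveFunctor.natIso_tensor_assoc, ← μ_natural_right_assoc]
  simp only [MonoidalCategory.tensorHom_def', Category.assoc]
  simp only [← whiskerLeft_comp_assoc, Category.assoc]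
  rw [θ.square_pull]
  simp only [MonoidalCategory.whiskerLeft_comp, Category.assoc, whisker_exchange_assoc]

lemma fibArrow_pullArrow {X Y : LocallyDiscrete Cᵒᵖ} (f : X ⟶ Y) {x y : Q'.fib.obj X}
    {p : P'.fib.obj X} (α : x ⊗ (F'.functor X).obj p ⟶ y) :
    fibArrow θ (pullArrow F' f α) ≫ (jQ.natIso f y).hom =
      ((jQ.natIso f x).hom ⊗ₘ (F.functor Y).map (jP.natIso f p).hom) ≫
        pullArrow F f (fibArrow θ α) :=
  fibArrow_of_lifts θ f _ _ (AdditiveFunctor.lifts_map f α)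

/-- The two composites are represented by pairs over jP(f^*p) and f^*jP(p); the comparison
isomorphism of `jP` identifies these pairs. Since `β'` need not be the pull-back of a pair, this
gives both the naturality in `fibMapNat` and local lifts along `cokerMap`. -/
lemma homMk_natural {X Y : LocallyDiscrete Cᵒᵖ} (f : X ⟶ Y) {x y : CokerObj (F'.functor X)}
    {p : P'.fib.obj X}
    (β' : (Q'.pull f).obj x.as ⊗ (F'.functor Y).obj ((P'.pull f).obj p) ⟶ (Q'.pull f).obj y.as)
    (β : (jQ.functor X).obj x.as ⊗ (F.functor X).obj ((jP.functor X).obj p) ⟶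
      (jQ.functor X).obj y.as)
    (h : fibArrow θ β' ≫ (jQ.natIso f y.as).hom =
      ((jQ.natIso f x.as).hom ⊗ₘ (F.functor Y).map (jP.natIso f p).hom) ≫ pullArrow F f β) :
    (fibMap θ Y).map (homMk (X := (cokerPull F' f).obj x) (Y := (cokerPull F' f).obj y) _ β') ≫
      ofHom (X := (fibMap θ Y).obj ((cokerPull F' f).obj y))
        (Y := (cokerPull F f).obj ((fibMap θ X).obj y)) (jQ.natIso f y.as).hom =
    ofHom (X := (fibMap θ Y).obj ((cokerPull F' f).obj x))
        (Y := (cokerPull F f).obj ((fibMap θ X).obj x)) (jQ.natIso f x.as).hom ≫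
      (cokerPull F f).map (homMk (X := (fibMap θ X).obj x) (Y := (fibMap θ X).obj y) _ β) := by
  rw [map_homMk_eq, map_homMk_eq, homMk_comp_ofHom, ofHom_comp_homMk]
  refine homMk_eq (jP.natIso f p) ?_
  refine Eq.trans ?_ h.symm
  rw [MonoidalCategory.tensorHom_def', Category.assoc]

/-- The compatibility of the functors between the fibres of the cokernels with pull-backs. -/
def fibMapNat {X Y : LocallyDiscrete Cᵒᵖ} (f : X ⟶ Y) :
    cokerPull F' f ⋙ fibMap θ Y ≅ fibMap θ X ⋙ cokerPull F f :=
  NatIso.ofComponents (fun x => isoOfIso (X := (fibMap θ Y).obj ((cokerPull F' f).obj x))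
    (Y := (cokerPull F f).obj ((fibMap θ X).obj x)) (jQ.natIso f x.as)) (fun {x y} a => by
      obtain ⟨p, α, rfl⟩ := homMk_surjective a
      exact homMk_natural θ f _ _ (fibArrow_pullArrow θ f α))

instance {X Y : LocallyDiscrete Cᵒᵖ} (f : X ⟶ Y) : NatTrans.IsMonoidal (fibMapNat θ f).hom where
  unit := by
    rw [ε_map_comp, ε_map_comp]
    refine (ofHom_comp (X := 𝟙_ (CokerObj (F.functor Y)))
      (Y := (fibMap θ Y).obj ((cokerPull F' f).obj (𝟙_ _)))
      (Z := (cokerPull F f).obj ((fibMap θ X).obj (𝟙_ _))) _ _).symm.trans ?_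
    exact congrArg ofHom (NatTrans.IsMonoidal.unit (τ := (jQ.nat f).hom))
  tensor x y := by
    rw [μ_map_comp, μ_map_comp]
    refine (ofHom_comp (X := (fibMap θ Y).obj ((cokerPull F' f).obj x) ⊗
        (fibMap θ Y).obj ((cokerPull F' f).obj y))
      (Y := (fibMap θ Y).obj ((cokerPull F' f).obj (x ⊗ y)))
      (Z := (cokerPull F f).obj ((fibMap θ X).obj (x ⊗ y))) _ _).symm.trans ?_
    refine (congrArg ofHom (NatTrans.IsMonoidal.tensor (τ := (jQ.nat f).hom) x.as y.as)).trans ?_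
    have h4 := ofHom_tensorHom (X := (fibMap θ Y).obj ((cokerPull F' f).obj x))
      (X' := (fibMap θ Y).obj ((cokerPull F' f).obj y))
      (Y := (cokerPull F f).obj ((fibMap θ X).obj x))
      (Y' := (cokerPull F f).obj ((fibMap θ X).obj y))
      (jQ.natIso f x.as).hom (jQ.natIso f y.as).hom
    refine Eq.trans ?_ (congrArg (fun t => t ≫ _) h4.symm)
    exact ofHom_comp (X := (fibMap θ Y).obj ((cokerPull F' f).obj x) ⊗
        (fibMap θ Y).obj ((cokerPull F' f).obj y))
      (Y := (cokerPull F f).obj ((fibMap θ X).obj x) ⊗ (cokerPull F f).obj ((fibMap θ X).obj y))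
      (Z := (cokerPull F f).obj ((fibMap θ X).obj (x ⊗ y))) _ _

end CokerObj

variable {P' Q' P Q : PicardPrestack.{w} C} {jP : AdditiveFunctor P' P} {jQ : AdditiveFunctor Q' Q}
  {F' : AdditiveFunctor P' Q'} {F : AdditiveFunctor P Q}

/-- The strong transformation underlying the additive functor between cokernels induced by a square
of additive functors. -/
def cokerMapTrans (θ : AdditiveFunctor.Iso (jP.comp F) (F'.comp jQ)) :
    (cokerPre F').fib.StrongTrans (cokerPre F).fib :=
  AdditiveFunctor.transOfFibres (P := cokerPre F') (Q := cokerPre F)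
    (fun X => CokerObj.fibMap θ X) (fun f => CokerObj.fibMapNat θ f)
    (fun {X} x => by
      refine Eq.trans ?_ ((congrArg CokerObj.ofHom (jQ.nat_id (CokerObj.as x))).trans
        (CokerObj.map_ofHom (jP.functor X) (jQ.functor X) (θ.fibIso X).hom
          (X := (cokerPull F' (𝟙 X)).obj x) (Y := x) ((Q'.pullId X).hom.app (CokerObj.as x))).symm)
      exact (CokerObj.ofHom_comp (X := (CokerObj.fibMap θ X).obj ((cokerPull F' (𝟙 X)).obj x))
        (Y := (cokerPull F (𝟙 X)).obj ((CokerObj.fibMap θ X).obj x))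
        (Z := (CokerObj.fibMap θ X).obj x) _ _).symm)
    (fun {X Y Z} f g x => by
      have h1 := CokerObj.ofHom_comp
        (X := (CokerObj.fibMap θ Z).obj ((cokerPull F' (f ≫ g)).obj x))
        (Y := (cokerPull F (f ≫ g)).obj ((CokerObj.fibMap θ X).obj x))
        (Z := (cokerPull F g).obj ((cokerPull F f).obj ((CokerObj.fibMap θ X).obj x)))
        ((jQ.nat (f ≫ g)).hom.app (CokerObj.as x))
        ((Q.pullComp f g).hom.app ((jQ.functor X).obj (CokerObj.as x)))
      have h2 := CokerObj.map_ofHom (jP.functor Z) (jQ.functor Z) (θ.fibIso Z).hom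
          (X := (cokerPull F' (f ≫ g)).obj x) (Y := (cokerPull F' g).obj ((cokerPull F' f).obj x))
          ((Q'.pullComp f g).hom.app (CokerObj.as x))
      have h3 := CokerObj.map_ofHom (P.pull g) (Q.pull g) (F.nat g).hom
          (X := (CokerObj.fibMap θ Y).obj ((cokerPull F' f).obj x))
          (Y := (cokerPull F f).obj ((CokerObj.fibMap θ X).obj x))
          ((jQ.nat f).hom.app (CokerObj.as x))
      refine h1.symm.trans ((congrArg CokerObj.ofHom (jQ.nat_comp f g (CokerObj.as x))).trans ?_)
      refine Eq.trans ?_ (congrArg₂ (fun s t => s ≫ CokerObj.ofHom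
        (X := (CokerObj.fibMap θ Z).obj ((cokerPull F' g).obj ((cokerPull F' f).obj x)))
        (Y := (cokerPull F g).obj ((CokerObj.fibMap θ Y).obj ((cokerPull F' f).obj x)))
        ((jQ.nat g).hom.app ((Q'.pull f).obj (CokerObj.as x))) ≫ t) h2.symm h3.symm)
      refine (CokerObj.ofHom_comp
        (X := (CokerObj.fibMap θ Z).obj ((cokerPull F' (f ≫ g)).obj x))
        (Y := (CokerObj.fibMap θ Z).obj ((cokerPull F' g).obj ((cokerPull F' f).obj x)))
        (Z := (cokerPull F g).obj ((cokerPull F f).obj ((CokerObj.fibMap θ X).obj x)))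
        _ _).trans ?_
      exact congrArg (fun t => _ ≫ t) (CokerObj.ofHom_comp
        (X := (CokerObj.fibMap θ Z).obj ((cokerPull F' g).obj ((cokerPull F' f).obj x)))
        (Y := (cokerPull F g).obj ((CokerObj.fibMap θ Y).obj ((cokerPull F' f).obj x)))
        (Z := (cokerPull F g).obj ((cokerPull F f).obj ((CokerObj.fibMap θ X).obj x))) _ _))

/-- The additive functor between cokernels induced by a square of additive functors. -/
def cokerMap (θ : AdditiveFunctor.Iso (jP.comp F) (F'.comp jQ)) :
    AdditiveFunctor (cokerPre F') (cokerPre F) where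
  trans := cokerMapTrans θ
  braided X := inferInstanceAs (CokerObj.fibMap θ X).Braided
  naturality_isMonoidal f := inferInstanceAs (NatTrans.IsMonoidal (CokerObj.fibMapNat θ f).hom)

end PicardStack

/-! ### The induced functor between cokernels is a local equivalence -/

namespace PicardStack

open Functor.LaxMonoidal Functor.OplaxMonoidal Functor.Monoidal

variable {C : Type u} [Category.{v} C] {J : GrothendieckTopology C}
  {P' Q' P Q : PicardPrestack.{w} C} {jP : AdditiveFunctor P' P} {jQ : AdditiveFunctor Q' Q}
  {F' : AdditiveFunctor P' Q'} {F : AdditiveFunctor P Q}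

lemma PicardPrestack.map_pull_comp_congr {X Y Z : LocallyDiscrete Cᵒᵖ} (f : X ⟶ Y) (g : Y ⟶ Z)
    {x y : P.fib.obj X} {a b : x ⟶ y}
    (h : (P.pull g).map ((P.pull f).map a) = (P.pull g).map ((P.pull f).map b)) :
    (P.pull (f ≫ g)).map a = (P.pull (f ≫ g)).map b := by
  rw [map_pull_comp, map_pull_comp, h]

namespace CokerObj

variable (θ : AdditiveFunctor.Iso (jP.comp F) (F'.comp jQ))

lemma fibArrow_whisker {X : LocallyDiscrete Cᵒᵖ} {x y : Q'.fib.obj X} {p p' : P'.fib.obj X}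
    (c : p ⟶ p') (α : x ⊗ (F'.functor X).obj p' ⟶ y) :
    fibArrow θ (x ◁ (F'.functor X).map c ≫ α) =
      (jQ.functor X).obj x ◁ (F.functor X).map ((jP.functor X).map c) ≫ fibArrow θ α :=
  mapArrow_whisker (jP.functor X) (jQ.functor X) (θ.fibIso X).hom c α

lemma pullArrow_whisker (F : AdditiveFunctor P Q) {X Y : LocallyDiscrete Cᵒᵖ} (f : X ⟶ Y)
    {x y : Q.fib.obj X} {p p' : P.fib.obj X} (c : p ⟶ p') (α : x ⊗ (F.functor X).obj p' ⟶ y) :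
    pullArrow F f (x ◁ (F.functor X).map c ≫ α) =
      (Q.pull f).obj x ◁ (F.functor Y).map ((P.pull f).map c) ≫ pullArrow F f α :=
  mapArrow_whisker (P.pull f) (Q.pull f) (F.nat f).hom c α

lemma map_eq_of_fibArrow_eq {X : LocallyDiscrete Cᵒᵖ} {x y : Q'.fib.obj X} {p : P'.fib.obj X}
    {α β : x ⊗ (F'.functor X).obj p ⟶ y} (h : fibArrow θ α = fibArrow θ β) :
    (jQ.functor X).map α = (jQ.functor X).map β :=
  map_eq_of_mapArrow_eq (jP.functor X) (jQ.functor X) (θ.fibIso X).hom h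

/-- An isomorphism between the images of two pairs which lifts along `jP` identifies their
pull-backs up to `jQ`. -/
lemma map_pullArrow_eq_of_lifts {X Y : LocallyDiscrete Cᵒᵖ} (f : X ⟶ Y) {x y : Q'.fib.obj X}
    {p p' : P'.fib.obj X} (α : x ⊗ (F'.functor X).obj p ⟶ y) (α' : x ⊗ (F'.functor X).obj p' ⟶ y)
    (γ : (jP.functor X).obj p ⟶ (jP.functor X).obj p')
    (hγ : (jQ.functor X).obj x ◁ (F.functor X).map γ ≫ fibArrow θ α' = fibArrow θ α)
    (c : (P'.pull f).obj p ⟶ (P'.pull f).obj p') (hc : jP.Lifts f c γ) :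
    (jQ.functor Y).map ((Q'.pull f).obj x ◁ (F'.functor Y).map c ≫ pullArrow F' f α') =
      (jQ.functor Y).map (pullArrow F' f α) := by
  refine map_eq_of_fibArrow_eq θ ?_
  rw [← cancel_mono (jQ.natIso f y).hom, fibArrow_pullArrow, fibArrow_whisker, Category.assoc,
    fibArrow_pullArrow, ← hγ, pullArrow_whisker]
  unfold AdditiveFunctor.Lifts at hc
  rw [MonoidalCategory.tensorHom_def', MonoidalCategory.tensorHom_def', Category.assoc,
    Category.assoc, ← whisker_exchange_assoc, ← whiskerLeft_comp_assoc,
    ← whiskerLeft_comp_assoc, ← Functor.map_comp, ← Functor.map_comp, hc]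

/-- Two pairs whose images define the same arrow define locally the same arrow. -/
lemma locally_map_eq (hP : IsLocalEquiv J jP) (hQ : IsLocalEquiv J jQ) {X : LocallyDiscrete Cᵒᵖ}
    {x y : CokerObj (F'.functor X)} (a b : x ⟶ y) (h : (fibMap θ X).map a = (fibMap θ X).map b) :
    Locally J (U := X.as.unop) (fun _ f => ((cokerPre F').pull f.op.toLoc).map (X := x) (Y := y) a =
      ((cokerPre F').pull f.op.toLoc).map (X := x) (Y := y) b) := by
  obtain ⟨p, α, rfl⟩ := homMk_surjective a
  obtain ⟨p', α', rfl⟩ := homMk_surjective b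
  -- Equality of classes yields an isomorphism `γ` between the images of `p` and `p'`. It lifts
  -- locally along `jP`, and the lift identifies the two pairs after a further localization by the
  -- faithfulness of `jQ`.
  obtain ⟨γ, hγ⟩ := Quotient.exact h
  refine (hP.full γ.hom).bind fun V f ⟨c, hc⟩ => ?_
  refine (hQ.faithful _ _ (map_pullArrow_eq_of_lifts θ f.op.toLoc α α' γ.hom hγ c hc)).mono
    fun W g hg => ?_
  refine PicardPrestack.map_pull_comp_congr (P := cokerPre F') f.op.toLoc g.op.toLoc ?_
  have : IsIso c := IsGroupoid.all_isIso c
  refine homMk_eq ((P'.pull g.op.toLoc).mapIso (asIso c)) ?_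
  have h1 := pullArrow_whisker F' g.op.toLoc c (pullArrow F' f.op.toLoc α')
  refine h1.symm.trans ?_
  exact congrArg (fun t => _ ≫ μ _ _ _ ≫ t) hg

/-- Arrows between images are locally images. -/
lemma locally_lifts_homMk (hQ : IsLocalEquiv J jQ) {X : LocallyDiscrete Cᵒᵖ}
    {x y : CokerObj (F'.functor X)} (p : P'.fib.obj X)
    (β : (jQ.functor X).obj x.as ⊗ (F.functor X).obj ((jP.functor X).obj p) ⟶
      (jQ.functor X).obj y.as) :
    Locally J (U := X.as.unop) (fun _ f => ∃ b, (cokerMap θ).Lifts f.op.toLoc (x := x) (y := y) b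
      (homMk (X := (fibMap θ X).obj x) (Y := (fibMap θ X).obj y) _ β)) := by
  -- Transporting `β` through the square and the monoidal structure of `jQ` makes its source the
  -- image of x + F'(p), so that the fullness of `jQ` applies.
  refine (hQ.full (x := x.as ⊗ (F'.functor X).obj p) (y := y.as)
    (δ (jQ.functor X) _ _ ≫ (jQ.functor X).obj x.as ◁ (θ.square X p).inv ≫ β)).mono
    fun V f ⟨b, hb⟩ => ⟨_, homMk_natural θ f.op.toLoc
      ((Q'.pull f.op.toLoc).obj x.as ◁ (F'.natIso f.op.toLoc p).hom ≫ μ (Q'.pull f.op.toLoc) _ _ ≫ b)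
      β ?_⟩
  rw [fibArrow_of_lifts θ f.op.toLoc b _ hb]
  simp

/-- The object `p` of a representing pair need not lie in the image of `jP`, but it does so locally
up to isomorphism, and a class of pairs does not see this change; `locally_lifts_homMk` then
applies. -/
lemma locally_lifts (hP : IsLocalEquiv J jP) (hQ : IsLocalEquiv J jQ) {X : LocallyDiscrete Cᵒᵖ}
    {x y : CokerObj (F'.functor X)} (a : (fibMap θ X).obj x ⟶ (fibMap θ X).obj y) :
    Locally J (U := X.as.unop) (fun _ f =>
      ∃ b, (cokerMap θ).Lifts f.op.toLoc (x := x) (y := y) b a) := by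
  obtain ⟨p, β, rfl⟩ := homMk_surjective a
  refine (hP.essSurj p).bind fun V f ⟨p', ⟨e⟩⟩ => ?_
  -- The restriction of `β`, transported along `e` and the comparison isomorphisms of `jQ`; `key`
  -- records that (jP(p'), β') represents the restricted arrow.
  let β' := ((jQ.natIso f.op.toLoc x.as).hom ⊗ₘ (F.functor _).map e.hom) ≫
    pullArrow F f.op.toLoc β ≫ (jQ.natIso f.op.toLoc y.as).inv
  refine (locally_lifts_homMk θ hQ (x := (cokerPull F' f.op.toLoc).obj x)
    (y := (cokerPull F' f.op.toLoc).obj y) p' β').mono fun W g ⟨b, hb⟩ => ⟨_,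
      AdditiveFunctor.Lifts.trans (j := cokerMap θ) (f := f.op.toLoc) (x := x) (y := y)
        (g := g.op.toLoc) (c := b) ?_⟩
  have key : ofHom (X := (fibMap θ _).obj ((cokerPull F' f.op.toLoc).obj x))
      (Y := (cokerPull F f.op.toLoc).obj ((fibMap θ X).obj x)) (jQ.natIso f.op.toLoc x.as).hom ≫
    homMk (X := (cokerPull F f.op.toLoc).obj ((fibMap θ X).obj x))
      (Y := (cokerPull F f.op.toLoc).obj ((fibMap θ X).obj y)) _ (pullArrow F f.op.toLoc β) ≫
    ofHom (X := (cokerPull F f.op.toLoc).obj ((fibMap θ X).obj y))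
      (Y := (fibMap θ _).obj ((cokerPull F' f.op.toLoc).obj y))
      (jQ.natIso f.op.toLoc y.as).inv = homMk _ β' := by
    rw [homMk_comp_ofHom, ofHom_comp_homMk]
    symm
    refine homMk_eq e ?_
    dsimp only [β']
    rw [MonoidalCategory.tensorHom_def', Category.assoc]
  exact (congrArg (fun t => (cokerMap θ).Lifts g.op.toLoc b t) key).mpr hb

end CokerObj

/-- Objects of the cokernels are those of `Q'` and `Q`, so essential surjectivity comes from `jQ`
alone; the statements on arrows need both `jP` and `jQ`. -/
lemma cokerMap_isLocalEquiv (θ : AdditiveFunctor.Iso (jP.comp F) (F'.comp jQ))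
    (hP : IsLocalEquiv J jP) (hQ : IsLocalEquiv J jQ) : IsLocalEquiv J (cokerMap θ) where
  faithful a b h := CokerObj.locally_map_eq θ hP hQ a b h
  full a := CokerObj.locally_lifts θ hP hQ a
  essSurj {X} (a : CokerObj (F.functor X)) := (hQ.essSurj a.as).mono fun V f ⟨x, ⟨e⟩⟩ =>
    ⟨⟨x⟩, ⟨CokerObj.isoOfIso (X := (CokerObj.fibMap θ _).obj ⟨x⟩)
      (Y := (cokerPull F f.op.toLoc).obj a) e⟩⟩

end PicardStack

/-! ### The prestack of a morphism of sheaves; operations on local lifts -/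

namespace PicardStack

open Functor.LaxMonoidal Functor.OplaxMonoidal Functor.Monoidal

variable {C : Type u} [Category.{v} C] {J : GrothendieckTopology C}

section PstOf

variable {A B : Sheaf J AddCommGrpCat.{w}} (d : A ⟶ B)

/-- The restriction functors of `pstOf`. -/
abbrev pstOfPull {X Y : LocallyDiscrete Cᵒᵖ} (f : X ⟶ Y) :
    TwoTerm (sec d X) ⥤ TwoTerm (sec d Y) :=
  TwoTerm.map (A.obj.map f.as).hom (B.obj.map f.as).hom
    (fun k => ConcreteCategory.congr_hom (d.hom.naturality f.as) k)

/-- The Picard prestack of a morphism of abelian sheaves: over `U` its objects are the elements of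
`B(U)` and its arrows `x ⟶ y` are the elements `k` of `A(U)` with `d k = y - x`. -/
def pstOf : PicardPrestack.{w} C :=
  PicardPrestack.ofFibres (fun X => TwoTerm (sec d X)) (fun f => pstOfPull d f)
    (fun X => TwoTerm.mapId _ _ _
      (fun k => ConcreteCategory.congr_hom (A.obj.map_id X.as) k)
      (fun x => ConcreteCategory.congr_hom (B.obj.map_id X.as) x))
    (fun f g => TwoTerm.mapComp _ _ _ _ _ _ _ _ _
      (fun k => ConcreteCategory.congr_hom (A.obj.map_comp f.as g.as) k)
      (fun x => ConcreteCategory.congr_hom (B.obj.map_comp f.as g.as) x))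
    (fun {X Y Z W} f g h x => TwoTerm.hom_ext (by
      rw [TwoTerm.eqToHom_k]
      change 0 + ((A.obj.map h.as).hom 0 + (0 + 0)) = 0
      simp))
    (fun f x => TwoTerm.hom_ext (by
      rw [TwoTerm.eqToHom_k]
      change 0 + (A.obj.map f.as).hom 0 = 0
      simp))
    (fun f x => TwoTerm.hom_ext (by
      rw [TwoTerm.eqToHom_k]
      change 0 + 0 = 0
      simp))

end PstOf

namespace AdditiveFunctor

variable {P Q : PicardPrestack.{w} C} {j : AdditiveFunctor P Q} {X Y Z : LocallyDiscrete Cᵒᵖ}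

/-- Converse of `Lifts.trans`. -/
lemma Lifts.of_restrict {f : X ⟶ Y} {g : Y ⟶ Z} {x y : P.fib.obj X}
    {a : (j.functor X).obj x ⟶ (j.functor X).obj y}
    {c : (P.pull g).obj ((P.pull f).obj x) ⟶ (P.pull g).obj ((P.pull f).obj y)}
    (h : j.Lifts (f ≫ g) ((PicardPrestack.pullIso f g x).hom ≫ c ≫
      (PicardPrestack.pullIso f g y).inv) a) :
    j.Lifts g c ((j.natIso f x).hom ≫ (Q.pull f).map a ≫ (j.natIso f y).inv) := by
  unfold Lifts at *
  rw [← cancel_mono ((Q.pull g).map (j.natIso f y).hom),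
    ← cancel_epi ((j.functor Z).map (PicardPrestack.pullIso f g x).hom)]
  simp only [Functor.map_comp, Category.assoc, Iso.map_inv_hom_id, Category.comp_id] at h ⊢
  rw [← natIso_pullIso_assoc, ← PicardPrestack.pullIso_naturality, ← reassoc_of% h, natIso_pullIso,
    Iso.map_inv_hom_id_assoc]

lemma Lifts.whiskerRight {f : X ⟶ Y} {x y : P.fib.obj X}
    {b : (P.pull f).obj x ⟶ (P.pull f).obj y}
    {a : (j.functor X).obj x ⟶ (j.functor X).obj y} (h : j.Lifts f b a) (z : P.fib.obj X) :
    j.Lifts f (δ (P.pull f) x z ≫ b ▷ (P.pull f).obj z ≫ μ (P.pull f) y z)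
      (δ (j.functor X) x z ≫ a ▷ (j.functor X).obj z ≫ μ (j.functor X) y z) := by
  unfold Lifts at *
  have h1 := j.natIso_tensor f x z
  have h2 := j.natIso_tensor f y z
  rw [← cancel_epi ((j.functor Y).map (μ (P.pull f) x z)), ← cancel_epi (μ (j.functor Y) _ _)]
  rw [reassoc_of% h1]
  simp only [Functor.map_comp, Category.assoc]
  rw [← Functor.map_comp_assoc, μ_δ, CategoryTheory.Functor.map_id, Category.id_comp,
    ← μ_natural_left_assoc, h2, ← Functor.map_comp_assoc (Q.pull f), μ_δ,
    CategoryTheory.Functor.map_id, Category.id_comp, ← μ_natural_left_assoc,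
    MonoidalCategory.tensorHom_def, MonoidalCategory.tensorHom_def]
  simp only [Category.assoc, ← comp_whiskerRight_assoc]
  rw [whisker_exchange_assoc, ← comp_whiskerRight_assoc, h]

lemma Lifts.whiskerLeft {f : X ⟶ Y} {x y : P.fib.obj X}
    {b : (P.pull f).obj x ⟶ (P.pull f).obj y}
    {a : (j.functor X).obj x ⟶ (j.functor X).obj y} (h : j.Lifts f b a) (z : P.fib.obj X) :
    j.Lifts f (δ (P.pull f) z x ≫ (P.pull f).obj z ◁ b ≫ μ (P.pull f) z y)
      (δ (j.functor X) z x ≫ (j.functor X).obj z ◁ a ≫ μ (j.functor X) z y) := by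
  unfold Lifts at *
  have h1 := j.natIso_tensor f z x
  have h2 := j.natIso_tensor f z y
  rw [← cancel_epi ((j.functor Y).map (μ (P.pull f) z x)), ← cancel_epi (μ (j.functor Y) _ _)]
  rw [reassoc_of% h1]
  simp only [Functor.map_comp, Category.assoc]
  rw [← Functor.map_comp_assoc, μ_δ, CategoryTheory.Functor.map_id, Category.id_comp,
    ← μ_natural_right_assoc, h2, ← Functor.map_comp_assoc (Q.pull f), μ_δ,
    CategoryTheory.Functor.map_id, Category.id_comp, ← μ_natural_right_assoc,
    MonoidalCategory.tensorHom_def', MonoidalCategory.tensorHom_def']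
  simp only [Category.assoc, ← whiskerLeft_comp_assoc]
  rw [← whisker_exchange_assoc, ← whiskerLeft_comp_assoc, h]

end AdditiveFunctor

end PicardStack

/-! ### Extending a functor on arrows along a locally surjective morphism -/

namespace PicardStack

open Functor.LaxMonoidal Functor.OplaxMonoidal Functor.Monoidal

variable {C : Type u} [Category.{v} C] {J : GrothendieckTopology C}

/-- The overlap condition of `PicardPrestack.exists_glue` for arrows in the image of `G`. Only the
images of `c` and of the restriction of `b` have to agree, as independent choices of preimages
require. -/
lemma AdditiveFunctor.map_comp_pullIso {P Q : PicardPrestack.{w} C} (G : AdditiveFunctor P Q)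
    {X Y Z : LocallyDiscrete Cᵒᵖ} (f : X ⟶ Y) (g : Y ⟶ Z) {x y : P.fib.obj X}
    (c : (P.pull (f ≫ g)).obj x ⟶ (P.pull (f ≫ g)).obj y)
    (b : (P.pull f).obj x ⟶ (P.pull f).obj y)
    (h : (G.functor Z).map c = (G.functor Z).map ((PicardPrestack.pullIso f g x).hom ≫
      (P.pull g).map b ≫ (PicardPrestack.pullIso f g y).inv)) :
    ((G.natIso (f ≫ g) x).inv ≫ (G.functor Z).map c ≫ (G.natIso (f ≫ g) y).hom) ≫
        (PicardPrestack.pullIso f g _).hom =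
      (PicardPrestack.pullIso f g _).hom ≫ (Q.pull g).map
        ((G.natIso f x).inv ≫ (G.functor Y).map b ≫ (G.natIso f y).hom) := by
  rw [h, ← cancel_epi (G.natIso (f ≫ g) x).hom, natIso_pullIso_assoc]
  simp only [Functor.map_comp, Category.assoc, Iso.hom_inv_id_assoc, natIso_pullIso,
    Iso.map_inv_hom_id_assoc, Iso.map_hom_inv_id_assoc, natIso_naturality_assoc]

/-- An additive functor on `pstOf (q ≫ d)` which only depends on the images of arrows under the
locally surjective morphism `q`. -/
structure FactorDatum {N M B : Sheaf J AddCommGrpCat.{w}} (q : N ⟶ M) (d : M ⟶ B)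
    {A : PicardPrestack.{w} C} (G : AdditiveFunctor (pstOf (q ≫ d)) A) : Prop where
  surj : Presheaf.IsLocallySurjective J q.hom
  prestack : A.fib.IsPrestack J
  indep {X : LocallyDiscrete Cᵒᵖ} {x y : TwoTerm (sec (q ≫ d) X)} (a b : x ⟶ y)
    (h : sec q X a.k = sec q X b.k) : (G.functor X).map a = (G.functor X).map b

namespace FactorDatum

variable {N M B : Sheaf J AddCommGrpCat.{w}} {q : N ⟶ M} {d : M ⟶ B}
  {A : PicardPrestack.{w} C} {G : AdditiveFunctor (pstOf (q ≫ d)) A}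

section Fibre

variable {X Y : LocallyDiscrete Cᵒᵖ}

/-- An object of `pstOf d`, considered as an object of `pstOf (q ≫ d)`. -/
abbrev up (q : N ⟶ M) (x : TwoTerm (sec d X)) : TwoTerm (sec (q ≫ d) X) := ⟨x.as⟩

/-- The functor `G` on objects. -/
abbrev obj (G : AdditiveFunctor (pstOf (q ≫ d)) A) (x : TwoTerm (sec d X)) : A.fib.obj X :=
  (G.functor X).obj (up q x)

/-- The arrow `a` is locally given by all local preimages of `k` under `q`. -/
def Represents (G : AdditiveFunctor (pstOf (q ≫ d)) A) {x y : TwoTerm (sec d X)} (k : x ⟶ y)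
    (a : obj G x ⟶ obj G y) : Prop :=
  ∀ ⦃Y : LocallyDiscrete Cᵒᵖ⦄ (f : X ⟶ Y)
    (b : (pstOfPull (q ≫ d) f).obj (up q x) ⟶ (pstOfPull (q ≫ d) f).obj (up q y)),
    sec q Y b.k = (M.obj.map f.as).hom k.k → G.Lifts f (x := up q x) (y := up q y) b a

/-- The arrow over `Y` given by a preimage under `q` of the restriction of `k`. -/
def liftHom {x y : TwoTerm (sec d X)} (k : x ⟶ y) (f : X ⟶ Y) (n : N.obj.obj Y.as)
    (h : sec q Y n = (M.obj.map f.as).hom k.k) :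
    (pstOfPull (q ≫ d) f).obj (up q x) ⟶ (pstOfPull (q ≫ d) f).obj (up q y) :=
  ⟨n, (congrArg (sec d Y) h).trans ((pstOfPull d f).map k).w⟩

lemma locally_preimage (D : FactorDatum q d G) {x y : TwoTerm (sec d X)} (k : x ⟶ y) :
    Locally J (U := X.as.unop) (fun _ f =>
      ∃ b : (pstOfPull (q ≫ d) f.op.toLoc).obj (up q x) ⟶
          (pstOfPull (q ≫ d) f.op.toLoc).obj (up q y),
        sec q _ b.k = (M.obj.map f.op).hom k.k) :=
  have := D.surj
  ⟨Presheaf.imageSieve q.hom k.k, Presheaf.imageSieve_mem J q.hom k.k,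
    fun _ f h => ⟨liftHom k f.op.toLoc h.choose h.choose_spec, h.choose_spec⟩⟩

/-- Choose preimages of `k` on the sieve where they exist, apply `G` and glue in `A`. The chosen
preimages need not be compatible, but their images under `G` are, by `indep`. -/
lemma exists_represents (D : FactorDatum q d G) {x y : TwoTerm (sec d X)} (k : x ⟶ y) :
    ∃ a, Represents G k a := by
  have := D.prestack
  have := D.surj
  let S := Presheaf.imageSieve q.hom k.k
  have hS : S ∈ J X.as.unop := Presheaf.imageSieve_mem J q.hom k.k
  let b ⦃V : C⦄ (f : V ⟶ X.as.unop) (hf : S f) :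
      ((pstOf (q ≫ d)).pull f.op.toLoc).obj (up q x) ⟶
        ((pstOf (q ≫ d)).pull f.op.toLoc).obj (up q y) :=
    liftHom k f.op.toLoc hf.choose hf.choose_spec
  obtain ⟨a, ha⟩ := PicardPrestack.exists_glue (P := A) (x := obj G x) (y := obj G y) S hS
    (fun V f hf => (G.natIso f.op.toLoc (up q x)).inv ≫ (G.functor _).map (b f hf) ≫
      (G.natIso f.op.toLoc (up q y)).hom) (by
      intro V W f hf g
      refine G.map_comp_pullIso (x := up q x) (y := up q y) f.op.toLoc g.op.toLoc _ (b f hf) ?_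
      refine D.indep (x := ⟨_⟩) (y := ⟨_⟩) _ _ ?_
      refine (S.downward_closed hf g).choose_spec.trans ?_
      change (M.obj.map (g ≫ f).op).hom k.k = sec q _ (0 + ((N.obj.map g.op).hom hf.choose + 0))
      rw [zero_add, add_zero, op_comp, M.obj.map_comp]
      refine Eq.trans ?_ (sec_naturality q g.op.toLoc hf.choose).symm
      exact congrArg (M.obj.map g.op).hom hf.choose_spec.symm)
  refine ⟨a, fun Y f c h => ?_⟩
  -- The existence of `c` puts `f` in the sieve; by `indep`, `c` and the chosen preimage have the
  -- same image under `G`.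
  have hf : S f.as.unop := ⟨c.k, h⟩
  refine AdditiveFunctor.lifts_iff.2 ?_
  rw [show (A.pull f).map a = _ from ha f.as.unop hf]
  refine (D.indep c (b f.as.unop hf) (h.trans hf.choose_spec.symm)).trans ?_
  change _ = (G.natIso f (up q x)).hom ≫ ((G.natIso f (up q x)).inv ≫
    (G.functor _).map (b f.as.unop hf) ≫ (G.natIso f (up q y)).hom) ≫ (G.natIso f (up q y)).inv
  rw [Category.assoc, Iso.hom_inv_id_assoc]
  exact (Iso.eq_comp_inv _).2 rfl

/-- The functor `G` on arrows, extended to `pstOf d`. -/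
noncomputable def arr (D : FactorDatum q d G) {x y : TwoTerm (sec d X)} (k : x ⟶ y) :
    obj G x ⟶ obj G y :=
  (D.exists_represents k).choose

lemma lifts_arr (D : FactorDatum q d G) {x y : TwoTerm (sec d X)} (k : x ⟶ y) (f : X ⟶ Y)
    (b : (pstOfPull (q ≫ d) f).obj (up q x) ⟶ (pstOfPull (q ≫ d) f).obj (up q y))
    (h : sec q Y b.k = (M.obj.map f.as).hom k.k) :
    G.Lifts f (x := up q x) (y := up q y) b (D.arr k) :=
  (D.exists_represents k).choose_spec f b h

/-- The tool for all identities satisfied by `arr`: an arrow of `A` is recognized from one preimage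
of `k` on each member of a covering. -/
lemma eq_arr (D : FactorDatum q d G) {x y : TwoTerm (sec d X)} (k : x ⟶ y)
    (a : obj G x ⟶ obj G y)
    (h : Locally J (U := X.as.unop) (fun _ f =>
      ∃ b : (pstOfPull (q ≫ d) f.op.toLoc).obj (up q x) ⟶
          (pstOfPull (q ≫ d) f.op.toLoc).obj (up q y),
        sec q _ b.k = (M.obj.map f.op).hom k.k ∧
          G.Lifts f.op.toLoc (x := up q x) (y := up q y) b a)) : a = D.arr k := by
  have := D.prestack
  refine PicardPrestack.hom_ext_of_locally (h.mono fun V f ⟨b, hb, ha⟩ => ?_)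
  have ha' := D.lifts_arr k f.op.toLoc b hb
  unfold AdditiveFunctor.Lifts at ha ha'
  rwa [ha, cancel_epi] at ha'

lemma map_eq_arr (D : FactorDatum q d G) {x y : TwoTerm (sec d X)} (k : x ⟶ y)
    (a : up q x ⟶ up q y) (h : sec q X a.k = k.k) : (G.functor X).map a = D.arr k :=
  D.eq_arr k _ (.of_forall fun V f => ⟨(pstOfPull (q ≫ d) f.op.toLoc).map a,
    (sec_naturality q f.op.toLoc a.k).trans (congrArg (M.obj.map f.op).hom h),
    AdditiveFunctor.lifts_map (j := G) _ a⟩)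

lemma arr_id (D : FactorDatum q d G) (x : TwoTerm (sec d X)) : D.arr (𝟙 x) = 𝟙 _ :=
  (D.map_eq_arr (𝟙 x) (𝟙 _) (map_zero _)).symm.trans (CategoryTheory.Functor.map_id _ _)

lemma arr_comp (D : FactorDatum q d G) {x y z : TwoTerm (sec d X)} (k : x ⟶ y) (l : y ⟶ z) :
    D.arr (k ≫ l) = D.arr k ≫ D.arr l :=
  (D.eq_arr _ _ (((D.locally_preimage k).and (D.locally_preimage l)).mono
    fun V f ⟨⟨b, hb⟩, ⟨c, hc⟩⟩ => ⟨b ≫ c, by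
      change sec q _ (b.k + c.k) = (M.obj.map f.op).hom (k.k + l.k)
      rw [map_add, map_add, hb, hc], (D.lifts_arr k f.op.toLoc b hb).comp
        (D.lifts_arr l f.op.toLoc c hc)⟩)).symm

lemma arr_whiskerRight (D : FactorDatum q d G) {x y : TwoTerm (sec d X)} (k : x ⟶ y)
    (z : TwoTerm (sec d X)) : D.arr (k ▷ z) =
      δ (G.functor X) (up q x) (up q z) ≫ D.arr k ▷ obj G z ≫
        μ (G.functor X) (up q y) (up q z) :=
  (D.eq_arr _ _ ((D.locally_preimage k).mono fun V f ⟨b, hb⟩ => ⟨_, by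
      refine Eq.trans ?_ hb
      exact congrArg (sec q _) ((zero_add _).trans (add_zero b.k)),
    (D.lifts_arr k f.op.toLoc b hb).whiskerRight (up q z)⟩)).symm

lemma arr_whiskerLeft (D : FactorDatum q d G) {x y : TwoTerm (sec d X)} (k : x ⟶ y)
    (z : TwoTerm (sec d X)) : D.arr (z ◁ k) =
      δ (G.functor X) (up q z) (up q x) ≫ obj G z ◁ D.arr k ≫
        μ (G.functor X) (up q z) (up q y) :=
  (D.eq_arr _ _ ((D.locally_preimage k).mono fun V f ⟨b, hb⟩ => ⟨_, by
      refine Eq.trans ?_ hb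
      exact congrArg (sec q _) ((zero_add _).trans (add_zero b.k)),
    (D.lifts_arr k f.op.toLoc b hb).whiskerLeft (up q z)⟩)).symm

/-- A local preimage of the restriction of `k` is also a local preimage of `k`, so both sides are
recognized by the same local arrows. -/
lemma arr_pull (D : FactorDatum q d G) {x y : TwoTerm (sec d X)} (k : x ⟶ y) (f : X ⟶ Y) :
    D.arr ((pstOfPull d f).map k) ≫ (G.natIso f (up q y)).hom =
      (G.natIso f (up q x)).hom ≫ (A.pull f).map (D.arr k) := by
  refine (Iso.eq_comp_inv _).1 (Eq.trans ?_ (Category.assoc _ _ _).symm)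
  refine (D.eq_arr _ _ ((D.locally_preimage ((pstOfPull d f).map k)).mono
    fun V g ⟨b, hb⟩ => ⟨b, hb,
      AdditiveFunctor.Lifts.of_restrict (j := G) (x := up q x) (y := up q y) (c := b) ?_⟩)).symm
  refine D.lifts_arr k _ _ ?_
  refine (congrArg (sec q _) ((zero_add _).trans (add_zero b.k))).trans (hb.trans ?_)
  exact (ConcreteCategory.congr_hom (M.obj.map_comp f.as g.op) k.k).symm

end Fibre

end FactorDatum

end PicardStack

/-! ### The extension as an additive functor and as a local equivalence -/

namespace PicardStack

open Functor.LaxMonoidal Functor.OplaxMonoidal Functor.Monoidal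

variable {C : Type u} [Category.{v} C] {J : GrothendieckTopology C}

namespace FactorDatum

variable {N M B : Sheaf J AddCommGrpCat.{w}} {q : N ⟶ M} {d : M ⟶ B}
  {A : PicardPrestack.{w} C} {G : AdditiveFunctor (pstOf (q ≫ d)) A} (D : FactorDatum q d G)

/-- The extension of `G` to `pstOf d` over `X`. -/
@[reducible]
noncomputable def fib (X : LocallyDiscrete Cᵒᵖ) : TwoTerm (sec d X) ⥤ A.fib.obj X where
  obj x := obj G x
  map k := D.arr k
  map_id x := D.arr_id x
  map_comp k l := D.arr_comp k l

/-- The structural isomorphisms of the two-term prestacks are all given by the section 0, which has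
the preimage 0. The coherence of the extension is therefore inherited from `G`. -/
lemma arr_eq_map {X : LocallyDiscrete Cᵒᵖ} {x y : TwoTerm (sec d X)} (k : x ⟶ y)
    (a : up q x ⟶ up q y) (ha : a.k = 0) (hk : k.k = 0) : D.arr k = (G.functor X).map a :=
  (D.map_eq_arr k a (by rw [ha, hk, map_zero])).symm

/-- The extension of `G` to `pstOf d` is symmetric monoidal over `X`. -/
noncomputable def core (X : LocallyDiscrete Cᵒᵖ) : (D.fib X).CoreMonoidal where
  εIso := Functor.Monoidal.εIso (G.functor X)
  μIso x y := Functor.Monoidal.μIso (G.functor X) (up q x) (up q y)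
  μIso_hom_natural_left {x y} k z := by
    refine Eq.trans ?_ (congrArg (fun t => _ ≫ t) (D.arr_whiskerRight k z)).symm
    exact (μ_δ_assoc (G.functor X) (up q x) (up q z) _).symm
  μIso_hom_natural_right {x y} z k := by
    refine Eq.trans ?_ (congrArg (fun t => _ ≫ t) (D.arr_whiskerLeft k z)).symm
    exact (μ_δ_assoc (G.functor X) (up q z) (up q x) _).symm
  associativity x y z :=
    (congrArg (fun t => _ ≫ _ ≫ t) (D.arr_eq_map (α_ x y z).hom
      (α_ (up q x) (up q y) (up q z)).hom rfl rfl)).trans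
    (Functor.LaxMonoidal.associativity (G.functor X) (up q x) (up q y) (up q z))
  left_unitality x :=
    (Functor.LaxMonoidal.left_unitality (G.functor X) (up q x)).trans
      (congrArg (fun t => _ ≫ _ ≫ t) (D.arr_eq_map (λ_ x).hom (λ_ (up q x)).hom rfl rfl).symm)
  right_unitality x :=
    (Functor.LaxMonoidal.right_unitality (G.functor X) (up q x)).trans
      (congrArg (fun t => _ ≫ _ ≫ t) (D.arr_eq_map (ρ_ x).hom (ρ_ (up q x)).hom rfl rfl).symm)

noncomputable instance (X : LocallyDiscrete Cᵒᵖ) : (D.fib X).Monoidal := (D.core X).toMonoidal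

noncomputable instance (X : LocallyDiscrete Cᵒᵖ) : (D.fib X).Braided where
  braided x y :=
    (congrArg (fun t => _ ≫ t) (D.arr_eq_map (β_ x y).hom (β_ (up q x) (up q y)).hom rfl rfl)).trans
      (Functor.LaxBraided.braided (F := G.functor X) (up q x) (up q y))

/-- The compatibility of the extension of `G` with pull-backs. -/
noncomputable def nat {X Y : LocallyDiscrete Cᵒᵖ} (f : X ⟶ Y) :
    pstOfPull d f ⋙ D.fib Y ≅ D.fib X ⋙ A.pull f :=
  NatIso.ofComponents (fun x => G.natIso f (up q x)) (fun k => D.arr_pull k f)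

instance {X Y : LocallyDiscrete Cᵒᵖ} (f : X ⟶ Y) : NatTrans.IsMonoidal (D.nat f).hom where
  unit := by
    refine Eq.trans ?_ (NatTrans.IsMonoidal.unit (τ := (G.nat f).hom))
    refine congrArg (fun t => (ε (G.functor Y) ≫ t) ≫ (G.natIso f (𝟙_ _)).hom) ?_
    exact D.arr_eq_map _ _ rfl rfl
  tensor x y := by
    refine Eq.trans ?_ (NatTrans.IsMonoidal.tensor (τ := (G.nat f).hom) (up q x) (up q y))
    refine congrArg (fun t => (_ ≫ t) ≫ (G.natIso f (up q x ⊗ up q y)).hom) ?_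
    exact D.arr_eq_map _ _ rfl rfl

/-- The strong transformation underlying the extension of `G` to `pstOf d`. -/
noncomputable def trans : (pstOf d).fib.StrongTrans A.fib :=
  AdditiveFunctor.transOfFibres (P := pstOf d) (Q := A) (fun X => D.fib X) (fun f => D.nat f)
    (fun {X} x => (G.nat_id (up q x)).trans
      (D.arr_eq_map (((pstOf d).pullId X).hom.app x) _ rfl rfl).symm)
    (fun {X Y Z} f g x => (G.nat_comp f g (up q x)).trans
      (congrArg (fun t => t ≫ _ ≫ _)
        (D.arr_eq_map (((pstOf d).pullComp f g).hom.app x) _ rfl rfl).symm))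

/-- The extension of `G` to `pstOf d`. -/
noncomputable def factor : AdditiveFunctor (pstOf d) A where
  trans := D.trans
  braided X := inferInstanceAs (D.fib X).Braided
  naturality_isMonoidal f := inferInstanceAs (NatTrans.IsMonoidal (D.nat f).hom)

/-- Fullness and essential surjectivity are required of `G` itself. Faithfulness is required only up
to `q`, since `G` identifies arrows with the same image under `q`. -/
lemma factor_isLocalEquiv
    (hfaithful : ∀ {X : LocallyDiscrete Cᵒᵖ} {x y : TwoTerm (sec (q ≫ d) X)} (a b : x ⟶ y),
      (G.functor X).map a = (G.functor X).map b → Locally J (U := X.as.unop) (fun _ f =>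
        (M.obj.map f.op).hom (sec q X a.k) = (M.obj.map f.op).hom (sec q X b.k)))
    (hfull : ∀ {X : LocallyDiscrete Cᵒᵖ} {x y : TwoTerm (sec (q ≫ d) X)}
      (a : (G.functor X).obj x ⟶ (G.functor X).obj y), Locally J (U := X.as.unop)
        (fun _ f => ∃ b, G.Lifts f.op.toLoc (x := x) (y := y) b a))
    (hessSurj : ∀ {X : LocallyDiscrete Cᵒᵖ} (a : A.fib.obj X), Locally J (U := X.as.unop)
      (fun V f => ∃ x : TwoTerm (sec (q ≫ d) (.mk (op V))),
        Nonempty ((G.functor _).obj x ≅ (A.pull f.op.toLoc).obj a))) :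
    IsLocalEquiv J D.factor where
  faithful {X} (x y : TwoTerm (sec d X)) (k l : x ⟶ y) h := by
    refine ((D.locally_preimage k).and (D.locally_preimage l)).bind
      fun V f ⟨⟨b, hb⟩, ⟨c, hc⟩⟩ => ?_
    have h1 := AdditiveFunctor.lifts_iff.1 (D.lifts_arr k f.op.toLoc b hb)
    have h2 := AdditiveFunctor.lifts_iff.1 (D.lifts_arr l f.op.toLoc c hc)
    have h' : D.arr k = D.arr l := h
    rw [h'] at h1
    refine (hfaithful b c (h1.trans h2.symm)).mono fun W g hg => ?_
    rw [hb, hc] at hg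
    refine PicardPrestack.map_pull_comp_congr (P := pstOf d) f.op.toLoc g.op.toLoc ?_
    exact TwoTerm.hom_ext hg
  full {X} (x y : TwoTerm (sec d X)) a :=
    (hfull (x := up q x) (y := up q y) a).mono fun V f ⟨b, hb⟩ => by
      -- The image of `b` under `q`: on it the extension takes the value `G(b)`.
      let b' : (pstOfPull d f.op.toLoc).obj x ⟶ (pstOfPull d f.op.toLoc).obj y :=
        ⟨sec q _ b.k, b.w⟩
      refine ⟨b', ?_⟩
      refine (congrArg (fun t => t ≫ (G.natIso f.op.toLoc (up q y)).hom)
        (D.map_eq_arr b' b rfl).symm).trans hb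
  essSurj a := (hessSurj a).mono fun V f ⟨x, ⟨e⟩⟩ => ⟨⟨x.as⟩, ⟨e⟩⟩

end FactorDatum

end PicardStack

/-! ### Arrows of the cokernel of `pst(f)` as pairs of sections -/

namespace PicardStack

open Functor.LaxMonoidal Functor.OplaxMonoidal Functor.Monoidal

variable {C : Type u} [Category.{v} C] {J : GrothendieckTopology C}
  {K L : CochainComplex (Sheaf J AddCommGrpCat.{w}) ℤ} {f : K ⟶ L}

section IsPair

variable {X Y : LocallyDiscrete Cᵒᵖ} {x y z : CokerObj (pstMapFib f X)}

/-- The arrow `a` of the cokernel of `pst(f)` is given by the sections `p` of `K⁰` and `k`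
of `L⁻¹`. -/
def IsPair (a : x ⟶ y) (p : (K.X 0).obj.obj X.as) (k : (L.X (-1)).obj.obj X.as) : Prop :=
  ∃ h : diff L X k = y.as.as - (x.as.as + sec (f.f 0) X p),
    a = CokerObj.homMk (X := x) (Y := y) (⟨p⟩ : TwoTerm (diff K X)) ⟨k, h⟩

lemma exists_isPair (a : x ⟶ y) : ∃ p k, IsPair a p k := by
  obtain ⟨p, α, rfl⟩ := CokerObj.homMk_surjective a
  exact ⟨p.as, α.k, α.w, rfl⟩

namespace IsPair

variable {a : x ⟶ y} {b : y ⟶ z} {p p' : (K.X 0).obj.obj X.as}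
  {k k' : (L.X (-1)).obj.obj X.as}

lemma unique {a' : x ⟶ y} (h : IsPair a p k) (h' : IsPair a' p' k') (hp : p = p') (hk : k = k') :
    a = a' := by
  subst hp hk
  exact h.choose_spec.trans h'.choose_spec.symm

lemma congr (h : IsPair a p k) (hp : p = p') (hk : k = k') : IsPair a p' k' := by
  subst hp hk
  exact h

lemma of_homMk {p' : TwoTerm (diff K X)} (α : x.as ⊗ (pstMapFib f X).obj p' ⟶ y.as)
    (h : a = CokerObj.homMk p' α) (hp : p'.as = p) (hk : α.k = k) : IsPair a p k := by
  subst h hp hk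
  exact ⟨α.w, rfl⟩

lemma comp (ha : IsPair a p k) (hb : IsPair b p' k') : IsPair (a ≫ b) (p + p') (k + k') := by
  obtain ⟨h, rfl⟩ := ha
  obtain ⟨h', rfl⟩ := hb
  refine of_homMk _ (CokerObj.homMk_comp_homMk _ _ _ _) rfl ?_
  change 0 + (0 + (k + k')) = k + k'
  rw [zero_add, zero_add]

lemma ofHom (α : x.as ⟶ y.as) (hk : α.k = k) : IsPair (CokerObj.ofHom α : x ⟶ y) 0 k := by
  refine of_homMk _ rfl rfl ?_
  change 0 + (0 + α.k) = k
  rw [zero_add, zero_add, hk]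

lemma id (x : CokerObj (pstMapFib f X)) : IsPair (𝟙 x) 0 0 := by
  have h := ofHom (x := x) (y := x) (𝟙 x.as) rfl
  rwa [CokerObj.ofHom_id] at h

lemma whiskerLeft (ha : IsPair a p k) (w : CokerObj (pstMapFib f X)) : IsPair (w ◁ a) p k := by
  obtain ⟨h, rfl⟩ := ha
  refine of_homMk _ (CokerObj.whiskerLeft_homMk w _ _) rfl ?_
  change 0 + k = k
  rw [zero_add]

lemma whiskerRight (ha : IsPair a p k) (w : CokerObj (pstMapFib f X)) : IsPair (a ▷ w) p k := by
  obtain ⟨h, rfl⟩ := ha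
  refine of_homMk _ (CokerObj.homMk_whiskerRight _ _ w) rfl ?_
  change 0 + (0 + (0 + k)) = k
  rw [zero_add, zero_add, zero_add]

lemma pull (ha : IsPair a p k) (g : X ⟶ Y) : IsPair (X := Y) ((cokerPull (pstMap f) g).map a)
    (((K.X 0).obj.map g.as).hom p) (((L.X (-1)).obj.map g.as).hom k) := by
  obtain ⟨h, rfl⟩ := ha
  refine of_homMk _ (CokerObj.map_homMk _ _ _ _ _) rfl ?_
  change 0 + (0 + ((L.X (-1)).obj.map g.as).hom k) = _
  rw [zero_add, zero_add]

/-- Equal classes are related by an isomorphism p ≅ p' of `pst(K)`, that is, by a section of K⁻¹.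
Together with the converse `of_exists`, this describes the arrows as a quotient of presheaves by
K⁻¹. -/
lemma exists_of_eq {a : x ⟶ y} (h : IsPair a p k) (h' : IsPair a p' k') :
    ∃ m, diff K X m = p' - p ∧ sec (f.f (-1)) X m + k' = k := by
  obtain ⟨h, rfl⟩ := h
  obtain ⟨h', e⟩ := h'
  obtain ⟨γ, hγ⟩ := Quotient.exact e
  exact ⟨γ.hom.k, γ.hom.w, congrArg TwoTerm.Hom.k hγ⟩

lemma of_exists {a a' : x ⟶ y} (h : IsPair a p k) (h' : IsPair a' p' k')
    (m : (K.X (-1)).obj.obj X.as) (hm : diff K X m = p' - p)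
    (hm' : sec (f.f (-1)) X m + k' = k) : a = a' := by
  obtain ⟨h, rfl⟩ := h
  obtain ⟨h', rfl⟩ := h'
  let γ : (⟨p⟩ : TwoTerm (diff K X)) ⟶ ⟨p'⟩ := ⟨m, hm⟩
  have : IsIso γ := IsGroupoid.all_isIso γ
  exact CokerObj.homMk_eq (asIso γ) (TwoTerm.hom_ext hm')

end IsPair

end IsPair

/-- The data of a morphism from `pstOf d` to the prestack cokernel of the functor given by `f`. -/
structure CokerDatum {N B : Sheaf J AddCommGrpCat.{w}} (d : N ⟶ B) (f : K ⟶ L) where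
  u : N ⟶ L.X (-1)
  p : N ⟶ K.X 0
  b : B ⟶ L.X 0
  w : d ≫ b = u ≫ L.d (-1) 0 + p ≫ f.f 0

/-! ### Additive functors from a two-term prestack to the cokernel of `pst(f)` -/

namespace CokerDatum

variable {N B : Sheaf J AddCommGrpCat.{w}} {d : N ⟶ B} (D : CokerDatum d f)

lemma sec_w (X : LocallyDiscrete Cᵒᵖ) (n : N.obj.obj X.as) :
    sec D.b X (sec d X n) = diff L X (sec D.u X n) + sec (f.f 0) X (sec D.p X n) :=
  congrArg (fun t => sec t X n) D.w

/-- The functor to the fibre of the cokernel on objects. -/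
abbrev obj {X : LocallyDiscrete Cᵒᵖ} (x : TwoTerm (sec d X)) : CokerObj (pstMapFib f X) :=
  ⟨⟨sec D.b X x.as⟩⟩

/-- The functor to the fibre of the cokernel on arrows. -/
def map {X : LocallyDiscrete Cᵒᵖ} {x y : TwoTerm (sec d X)} (n : x ⟶ y) : D.obj x ⟶ D.obj y :=
  CokerObj.homMk (⟨sec D.p X n.k⟩ : TwoTerm (diff K X)) ⟨sec D.u X n.k, by
    have h := D.sec_w X n.k
    rw [n.w, map_sub] at h
    rw [eq_sub_of_add_eq h.symm]
    exact sub_sub _ _ _⟩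

lemma map_isPair {X : LocallyDiscrete Cᵒᵖ} {x y : TwoTerm (sec d X)} (n : x ⟶ y) :
    IsPair (D.map n) (sec D.p X n.k) (sec D.u X n.k) := ⟨_, rfl⟩

lemma map_isPair_zero {X : LocallyDiscrete Cᵒᵖ} {x y : TwoTerm (sec d X)} (n : x ⟶ y)
    (hn : n.k = 0) : IsPair (D.map n) 0 0 :=
  (D.map_isPair n).congr (by rw [hn, map_zero]) (by rw [hn, map_zero])

/-- The functor to the fibre of the cokernel. -/
@[reducible]
def fib (X : LocallyDiscrete Cᵒᵖ) : TwoTerm (sec d X) ⥤ CokerObj ((pstMap f).functor X) where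
  obj x := D.obj x
  map n := D.map n
  map_id x := (D.map_isPair_zero (𝟙 x) rfl).unique (.id _) rfl rfl
  map_comp m n := (D.map_isPair (m ≫ n)).unique ((D.map_isPair m).comp (D.map_isPair n))
    (map_add _ _ _) (map_add _ _ _)

/-- The isomorphism of the cokernel between equal objects. -/
abbrev isoOfEq {X : LocallyDiscrete Cᵒᵖ} {x y : CokerObj (pstMapFib f X)}
    (h : x.as.as = y.as.as) : x ≅ y :=
  CokerObj.isoOfIso (TwoTerm.isoOfEq h)

lemma isPair_isoOfEq {X : LocallyDiscrete Cᵒᵖ} {x y : CokerObj (pstMapFib f X)}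
    (h : x.as.as = y.as.as) : IsPair (isoOfEq h).hom 0 0 := .ofHom _ rfl

/-- The isomorphism between the neutral elements. -/
abbrev unitIso (X : LocallyDiscrete Cᵒᵖ) :
    𝟙_ (CokerObj (pstMapFib f X)) ≅ D.obj (𝟙_ (TwoTerm (sec d X))) :=
  isoOfEq (map_zero (sec D.b X)).symm

/-- The compatibility with sums. -/
abbrev tensorIso {X : LocallyDiscrete Cᵒᵖ} (x y : TwoTerm (sec d X)) :
    D.obj x ⊗ D.obj y ≅ D.obj (x ⊗ y) :=
  isoOfEq (map_add (sec D.b X) x.as y.as).symm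

lemma isPair_unitIso (X : LocallyDiscrete Cᵒᵖ) : IsPair (D.unitIso X).hom 0 0 :=
  isPair_isoOfEq _

lemma isPair_tensorIso {X : LocallyDiscrete Cᵒᵖ} (x y : TwoTerm (sec d X)) :
    IsPair (D.tensorIso x y).hom 0 0 := isPair_isoOfEq _

/-- Structural arrows are given by the pair (0, 0), pairs add under composition, and whiskering does
not change them. Coherence is thus an identity between sums. -/
lemma map_associator {X : LocallyDiscrete Cᵒᵖ} (x y z : TwoTerm (sec d X)) :
    (D.tensorIso x y).hom ▷ D.obj z ≫ (D.tensorIso (x ⊗ y) z).hom ≫ D.map (α_ x y z).hom =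
      (α_ (D.obj x) (D.obj y) (D.obj z)).hom ≫ D.obj x ◁ (D.tensorIso y z).hom ≫
        (D.tensorIso x (y ⊗ z)).hom :=
  IsPair.unique (((D.isPair_tensorIso x y).whiskerRight _).comp
      ((D.isPair_tensorIso (x ⊗ y) z).comp (D.map_isPair_zero (α_ x y z).hom rfl)))
    (IsPair.comp (IsPair.ofHom (k := 0) (α_ (D.obj x).as (D.obj y).as (D.obj z).as).hom rfl)
      (((D.isPair_tensorIso y z).whiskerLeft _).comp (D.isPair_tensorIso x (y ⊗ z)))) rfl rfl

lemma map_leftUnitor {X : LocallyDiscrete Cᵒᵖ} (x : TwoTerm (sec d X)) :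
    (λ_ (D.obj x)).hom = (D.unitIso X).hom ▷ D.obj x ≫ (D.tensorIso (𝟙_ _) x).hom ≫
      D.map (λ_ x).hom :=
  IsPair.unique (IsPair.ofHom (k := 0) (λ_ (D.obj x).as).hom rfl)
    (((D.isPair_unitIso X).whiskerRight _).comp
      ((D.isPair_tensorIso (𝟙_ _) x).comp (D.map_isPair_zero (λ_ x).hom rfl)))
    (by simp) (by simp)

lemma map_rightUnitor {X : LocallyDiscrete Cᵒᵖ} (x : TwoTerm (sec d X)) :
    (ρ_ (D.obj x)).hom = D.obj x ◁ (D.unitIso X).hom ≫ (D.tensorIso x (𝟙_ _)).hom ≫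
      D.map (ρ_ x).hom :=
  IsPair.unique (IsPair.ofHom (k := 0) (ρ_ (D.obj x).as).hom rfl)
    (((D.isPair_unitIso X).whiskerLeft _).comp
      ((D.isPair_tensorIso x (𝟙_ _)).comp (D.map_isPair_zero (ρ_ x).hom rfl)))
    (by simp) (by simp)

/-- The functor to the fibre of the cokernel is symmetric monoidal. -/
def core (X : LocallyDiscrete Cᵒᵖ) : (D.fib X).CoreMonoidal where
  εIso := D.unitIso X
  μIso x y := D.tensorIso x y
  μIso_hom_natural_left {x y} n z :=
    IsPair.unique (((D.map_isPair n).whiskerRight _).comp (D.isPair_tensorIso y z))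
      ((D.isPair_tensorIso x z).comp (D.map_isPair (n ▷ z)))
      ((add_zero _).trans (zero_add _).symm) ((add_zero _).trans (zero_add _).symm)
  μIso_hom_natural_right {x y} z n :=
    IsPair.unique (((D.map_isPair n).whiskerLeft _).comp (D.isPair_tensorIso z y))
      ((D.isPair_tensorIso z x).comp (D.map_isPair (z ◁ n)))
      ((add_zero _).trans (zero_add _).symm) ((add_zero _).trans (zero_add _).symm)
  associativity x y z := D.map_associator x y z
  left_unitality x := D.map_leftUnitor x
  right_unitality x := D.map_rightUnitor x

instance (X : LocallyDiscrete Cᵒᵖ) : (D.fib X).Monoidal := (D.core X).toMonoidal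

lemma isPair_ε (X : LocallyDiscrete Cᵒᵖ) :
    IsPair (x := 𝟙_ (CokerObj (pstMapFib f X))) (ε (D.fib X)) 0 0 := D.isPair_unitIso X

lemma isPair_μ {X : LocallyDiscrete Cᵒᵖ} (x y : TwoTerm (sec d X)) :
    IsPair (x := D.obj x ⊗ D.obj y) (μ (D.fib X) x y) 0 0 := D.isPair_tensorIso x y

instance (X : LocallyDiscrete Cᵒᵖ) : (D.fib X).Braided where
  braided x y := IsPair.unique (x := D.obj x ⊗ D.obj y) (y := D.obj (y ⊗ x))
    ((D.isPair_μ x y).comp (D.map_isPair_zero (β_ x y).hom rfl))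
    (IsPair.comp (IsPair.ofHom (k := 0) (β_ (D.obj x).as (D.obj y).as).hom rfl)
      (D.isPair_μ y x)) rfl rfl

lemma isPair_ε_pull {X Y : LocallyDiscrete Cᵒᵖ} (g : X ⟶ Y) :
    IsPair (x := 𝟙_ (CokerObj (pstMapFib f Y))) (ε (cokerPull (pstMap f) g)) 0 0 := .ofHom _ rfl

lemma isPair_μ_pull {X Y : LocallyDiscrete Cᵒᵖ} (g : X ⟶ Y)
    (x y : CokerObj (pstMapFib f X)) :
    IsPair (x := (cokerPull (pstMap f) g).obj x ⊗ (cokerPull (pstMap f) g).obj y)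
      (μ (cokerPull (pstMap f) g) x y) 0 0 := .ofHom _ rfl

/-- The compatibility of the functors between fibres with pull-backs. -/
def nat {X Y : LocallyDiscrete Cᵒᵖ} (g : X ⟶ Y) :
    pstOfPull d g ⋙ D.fib Y ≅ D.fib X ⋙ cokerPull (pstMap f) g :=
  NatIso.ofComponents (fun x => isoOfEq (x := D.obj ((pstOfPull d g).obj x))
    (y := (cokerPull (pstMap f) g).obj (D.obj x)) (sec_naturality D.b g x.as))
    (fun {x y} n => IsPair.unique ((D.map_isPair ((pstOfPull d g).map n)).comp (isPair_isoOfEq _))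
      ((isPair_isoOfEq _).comp ((D.map_isPair n).pull g))
      ((add_zero _).trans ((sec_naturality D.p g n.k).trans (zero_add _).symm))
      ((add_zero _).trans ((sec_naturality D.u g n.k).trans (zero_add _).symm)))

lemma isPair_nat {X Y : LocallyDiscrete Cᵒᵖ} (g : X ⟶ Y) (x : TwoTerm (sec d X)) :
    IsPair (x := D.obj ((pstOfPull d g).obj x)) ((D.nat g).hom.app x) 0 0 := isPair_isoOfEq _

instance {X Y : LocallyDiscrete Cᵒᵖ} (g : X ⟶ Y) : NatTrans.IsMonoidal (D.nat g).hom where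
  unit := IsPair.unique (x := 𝟙_ (CokerObj (pstMapFib f Y)))
    (((D.isPair_ε Y).comp (D.map_isPair_zero _ rfl)).comp (D.isPair_nat g _))
    ((isPair_ε_pull g).comp ((D.isPair_ε X).pull g)) (by simp) (by simp)
  tensor x y := IsPair.unique
    (x := D.obj ((pstOfPull d g).obj x) ⊗ D.obj ((pstOfPull d g).obj y))
    (((D.isPair_μ _ _).comp (D.map_isPair_zero _ rfl)).comp (D.isPair_nat g _))
    ((((D.isPair_nat g x).whiskerRight _).comp ((D.isPair_nat g y).whiskerLeft _)).comp
      ((isPair_μ_pull g _ _).comp ((D.isPair_μ x y).pull g))) (by simp) (by simp)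

/-- The strong transformation underlying the additive functor to the cokernel of `pst(f)`. -/
def toCokerTrans : (pstOf d).fib.StrongTrans (cokerPre (pstMap f)).fib :=
  AdditiveFunctor.transOfFibres (P := pstOf d) (Q := cokerPre (pstMap f))
    (fun X => D.fib X) (fun g => D.nat g)
    (fun {X} x => IsPair.unique (x := D.obj ((pstOfPull d (𝟙 X)).obj x)) (y := D.obj x)
      ((D.isPair_nat (𝟙 X) x).comp (IsPair.ofHom (k := 0) _ rfl)) (D.map_isPair_zero _ rfl) (by simp) (by simp))
    (fun {X Y Z} g h x => IsPair.unique (x := D.obj ((pstOfPull d (g ≫ h)).obj x))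
      (y := (cokerPull (pstMap f) h).obj ((cokerPull (pstMap f) g).obj (D.obj x)))
      ((D.isPair_nat (g ≫ h) x).comp (IsPair.ofHom (k := 0) _ rfl))
      ((D.map_isPair_zero _ rfl).comp ((D.isPair_nat h _).comp ((D.isPair_nat g x).pull h)))
      (by simp) (by simp))

/-- The additive functor to the cokernel of `pst(f)`. -/
def toCoker : AdditiveFunctor (pstOf d) (cokerPre (pstMap f)) where
  trans := D.toCokerTrans
  braided X := inferInstanceAs (D.fib X).Braided
  naturality_isMonoidal g := inferInstanceAs (NatTrans.IsMonoidal (D.nat g).hom)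

end CokerDatum

end PicardStack

/-! ### The cokernel of `pst(f)` as a truncated cone -/

namespace PicardStack

open Functor.LaxMonoidal Functor.OplaxMonoidal Functor.Monoidal

variable {C : Type u} [Category.{v} C] {J : GrothendieckTopology C}

lemma sec_biprod_lift {A B : Sheaf J AddCommGrpCat.{w}} [Limits.HasBinaryBiproduct A B]
    {X : LocallyDiscrete Cᵒᵖ} (x : A.obj.obj X.as) (y : B.obj.obj X.as) :
    sec (Limits.biprod.fst : A ⊞ B ⟶ A) X
      (sec Limits.biprod.inl X x + sec Limits.biprod.inr X y) = x ∧
    sec (Limits.biprod.snd : A ⊞ B ⟶ B) X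
      (sec Limits.biprod.inl X x + sec Limits.biprod.inr X y) = y := by
  simp only [map_add, ← sec_comp, Limits.biprod.inl_fst, Limits.biprod.inr_fst,
    Limits.biprod.inl_snd, Limits.biprod.inr_snd]
  exact ⟨add_zero x, zero_add y⟩

/-- Exactness makes `S.X₁` map epimorphically, hence locally surjectively, onto the kernel sheaf of
`S.g`, and `x` is a section of that kernel. -/
lemma locally_exists_of_exact (S : ShortComplex (Sheaf J AddCommGrpCat.{max u v})) (hS : S.Exact)
    {X : LocallyDiscrete Cᵒᵖ} (x : S.X₂.obj.obj X.as) (hx : sec S.g X x = 0) :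
    Locally J (U := X.as.unop) (fun V g => ∃ m : S.X₁.obj.obj (op V),
      sec S.f (.mk (op V)) m = (S.X₂.obj.map g.op).hom x) := by
  obtain ⟨y, rfl⟩ := exists_sec_kernel X S.g x hx
  let l := Limits.kernel.lift S.g S.f S.zero
  have : Epi l := (ShortComplex.exact_iff_epi_kernel_lift S).1 hS
  have : Sheaf.IsLocallySurjective l := (Sheaf.isLocallySurjective_iff_epi' _ l).2 this
  refine ⟨Presheaf.imageSieve l.hom y, Presheaf.imageSieve_mem J l.hom y,
    fun V g ⟨m, hm⟩ => ⟨m, ?_⟩⟩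
  have h : sec l (.mk (op V)) m = ((Limits.kernel S.g).obj.map g.op).hom y := hm
  refine Eq.trans ?_ ((congrArg (sec (Limits.kernel.ι S.g) (.mk (op V))) h).trans
    (sec_naturality (Limits.kernel.ι S.g) g.op.toLoc y))
  rw [← sec_comp, Limits.kernel.lift_ι]

variable {P Q R : PicardPrestack.{w} C}

lemma AdditiveFunctor.map_eq_of_locally (j : AdditiveFunctor P Q) [Q.fib.IsPrestack J]
    {X : LocallyDiscrete Cᵒᵖ} {x y : P.fib.obj X} {a b : x ⟶ y}
    (h : Locally J (U := X.as.unop)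
      (fun _ f => (P.pull f.op.toLoc).map a = (P.pull f.op.toLoc).map b)) :
    (j.functor X).map a = (j.functor X).map b :=
  PicardPrestack.hom_ext_of_locally (h.mono fun V f hf => by
    rw [← cancel_epi (j.natIso f.op.toLoc x).hom, ← j.natIso_naturality, ← j.natIso_naturality, hf])

namespace CokerDatum

variable {K L : CochainComplex (Sheaf J AddCommGrpCat.{w}) ℤ} {f : K ⟶ L}
  {N B : Sheaf J AddCommGrpCat.{w}} {d : N ⟶ B} (D : CokerDatum d f)

/-- By `hN` a pair of sections comes from a section `n` of `N`; the injectivity of `b` turns the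
condition on the pair into the condition that `n` is an arrow x → y. -/
lemma map_surjective {X : LocallyDiscrete Cᵒᵖ}
    (hN : ∀ u p, ∃ n, sec D.u X n = u ∧ sec D.p X n = p) (hb : Function.Injective (sec D.b X))
    {x y : TwoTerm (sec d X)} (a : D.obj x ⟶ D.obj y) : ∃ n, D.map n = a := by
  obtain ⟨p, k, ha⟩ := exists_isPair a
  obtain ⟨n, rfl, rfl⟩ := hN k p
  refine ⟨⟨n, hb ?_⟩, (D.map_isPair _).unique ha rfl rfl⟩
  rw [sec_w, map_sub, ha.choose]
  change sec D.b X y.as - (sec D.b X x.as + _) + _ = _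
  abel

lemma nonempty_iso {X : LocallyDiscrete Cᵒᵖ} (hb : Function.Surjective (sec D.b X))
    (a : CokerObj (pstMapFib f X)) : ∃ x, Nonempty (D.obj x ≅ a) := by
  obtain ⟨x, hx⟩ := hb a.as.as
  exact ⟨⟨x⟩, ⟨isoOfEq hx⟩⟩

end CokerDatum

variable (K L : CochainComplex (Sheaf J AddCommGrpCat.{max u v}) ℤ) (f : K ⟶ L)
    [K.IsStrictlyLE 0] [L.IsStrictlyGE (-1)]

/-- A stack which is locally equivalent to the prestack cokernel of `pst(f)` receives a local
equivalence from the Picard prestack of the truncation `τ_{≥-1}` of the mapping cone. -/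
lemma exists_isLocalEquiv_coker {A : PicardPrestack.{max u v} C} (hA : A.fib.IsPrestack J)
    (c : AdditiveFunctor (cokerPre (pstMap f)) A) (hc : IsLocalEquiv J c) :
    ∃ j : AdditiveFunctor (pst ((CochainComplex.mappingCone f).truncGE (-1))) A,
      IsLocalEquiv J j := by
  obtain ⟨e₁, e₀, h⟩ := exists_iso_truncGE_mappingCone K L f
  let d := ((CochainComplex.mappingCone f).truncGE (-1)).d (-1) 0
  let l := Limits.biprod.lift (f.f (-1)) (-K.d (-1) 0)
  -- The epimorphism from L⁻¹ ⊕ K⁰ to the degree -1 term of the truncation. As `pst` of the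
  -- truncation depends only on `d`, it is the target prestack of the extension along `q`.
  let q := Limits.cokernel.π l ≫ e₁.hom
  have hq : q ≫ d = Limits.biprod.desc (L.d (-1) 0) (f.f 0) ≫ e₀.hom := by
    rw [Category.assoc, h, Limits.cokernel.π_desc_assoc]
  have hlq : l ≫ q = 0 := by
    rw [← Category.assoc, Limits.cokernel.condition, Limits.zero_comp]
  let D : CokerDatum (q ≫ d) f :=
    { u := Limits.biprod.fst
      p := Limits.biprod.snd
      b := e₀.inv
      w := by rw [hq, Category.assoc, e₀.hom_inv_id, Category.comp_id, Limits.biprod.desc_eq] }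
  let S := ShortComplex.mk l q hlq
  have hS : S.Exact := S.exact_of_g_is_cokernel
    (Limits.IsColimit.ofIsoColimit (Limits.cokernelIsCokernel l) (Limits.Cofork.ext e₁))
  have : Epi q := epi_comp _ _
  have hpair {X : LocallyDiscrete Cᵒᵖ} (m : (K.X (-1)).obj.obj X.as) :
      sec D.u X (sec l X m) = sec (f.f (-1)) X m ∧ sec D.p X (sec l X m) = - diff K X m := by
    constructor
    · rw [← sec_comp, Limits.biprod.lift_fst]
    · rw [← sec_comp, Limits.biprod.lift_snd, sec_neg]
  have E : FactorDatum q d (D.toCoker.comp c) :=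
    { surj := (Sheaf.isLocallySurjective_iff_epi' _ q).2 this
      prestack := hA
      indep := fun {X x y} a b hab => by
        refine c.map_eq_of_locally (J := J) (x := D.obj x) (y := D.obj y) ?_
        -- Two sections with the same image under `q` differ locally by the image under `l` of a
        -- section `m` of K⁻¹, so they give the same arrow of coker' locally, and the same arrow of
        -- `A` because `A` is a prestack.
        refine (locally_exists_of_exact S hS (b.k - a.k)
          ((map_sub _ _ _).trans (sub_eq_zero.2 hab.symm))).mono fun V g ⟨m, hm⟩ => ?_
        have h₁ : sec D.u (.mk (op V)) (sec l _ m) = _ := congrArg (sec D.u _) hm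
        have h₂ : sec D.p (.mk (op V)) (sec l _ m) = _ := congrArg (sec D.p _) hm
        rw [(hpair m).1, map_sub, map_sub] at h₁
        rw [(hpair m).2, map_sub, map_sub] at h₂
        -- Since l(m) = (f⁻¹ m, -d m) is the difference b - a, the isomorphism from the first pair
        -- to the second is given by -m.
        refine IsPair.of_exists ((D.map_isPair a).pull g.op.toLoc)
          ((D.map_isPair b).pull g.op.toLoc) (-m) ?_ ?_
        · rw [map_neg, h₂]
          exact congrArg₂ _ (sec_naturality D.p g.op.toLoc b.k) (sec_naturality D.p g.op.toLoc a.k)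
        · rw [map_neg, h₁, neg_sub, sub_add_eq_add_sub, sub_eq_iff_eq_add]
          exact congrArg₂ _ (sec_naturality D.u g.op.toLoc a.k)
            (sec_naturality D.u g.op.toLoc b.k).symm }
  refine ⟨E.factor, E.factor_isLocalEquiv ?_ ?_ ?_⟩
  · intro X x y a b hab
    refine (hc.faithful (x := D.obj x) (y := D.obj y) _ _ hab).mono fun V g hg => ?_
    have hb := (D.map_isPair b).pull g.op.toLoc
    rw [← show (cokerPull (pstMap f) g.op.toLoc).map (D.map a) =
      (cokerPull (pstMap f) g.op.toLoc).map (D.map b) from hg] at hb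
    obtain ⟨m, hm, hm'⟩ := ((D.map_isPair a).pull g.op.toLoc).exists_of_eq hb
    -- Conversely, an identification of the two pairs exhibits the difference a - b as l(m), which
    -- `q` kills.
    have key : sec l (.mk (op V)) m =
        ((L.X (-1) ⊞ K.X 0).obj.map g.op).hom a.k - ((L.X (-1) ⊞ K.X 0).obj.map g.op).hom b.k := by
      refine sec_biprod_ext _ ?_ ?_
      · refine (hpair m).1.trans ((eq_sub_of_add_eq hm').trans ?_)
        rw [map_sub]
        exact congrArg₂ _ (sec_naturality D.u g.op.toLoc a.k).symm
          (sec_naturality D.u g.op.toLoc b.k).symm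
      · refine (hpair m).2.trans ((congrArg Neg.neg hm).trans ((neg_sub _ _).trans ?_))
        rw [map_sub]
        exact congrArg₂ _ (sec_naturality D.p g.op.toLoc a.k).symm
          (sec_naturality D.p g.op.toLoc b.k).symm
    have h0 : sec q (.mk (op V)) (sec l _ m) = 0 := congrArg (fun t => sec t (.mk (op V)) m) hlq
    rw [key, map_sub, sub_eq_zero] at h0
    exact ((sec_naturality q g.op.toLoc a.k).symm.trans h0).trans
      (sec_naturality q g.op.toLoc b.k)
  · intro X x y a
    refine (hc.full (x := D.obj x) (y := D.obj y) a).mono fun V g ⟨b, hb⟩ => ?_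
    let b' : (D.toCoker.functor _).obj (((pstOf (q ≫ d)).pull g.op.toLoc).obj x) ⟶
        (D.toCoker.functor _).obj (((pstOf (q ≫ d)).pull g.op.toLoc).obj y) :=
      (D.toCoker.natIso g.op.toLoc x).hom ≫ b ≫ (D.toCoker.natIso g.op.toLoc y).inv
    -- Lifting along `c` is local, but the functor to coker' is full on each fibre: every pair of
    -- sections is a section of the biproduct.
    obtain ⟨n, hn⟩ := D.map_surjective (x := (pstOfPull (q ≫ d) g.op.toLoc).obj x)
      (y := (pstOfPull (q ≫ d) g.op.toLoc).obj y) (fun u p => ⟨_, sec_biprod_lift u p⟩)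
      (sec_bijective _ e₀.inv).1 b'
    refine ⟨n, AdditiveFunctor.Lifts.of_comp (j := D.toCoker) (b := b) ?_ hb⟩
    refine (Iso.eq_comp_inv _).1 ?_
    exact hn.trans (Category.assoc _ _ _).symm
  · intro X a
    refine (hc.essSurj a).mono fun V g ⟨b, ⟨e⟩⟩ => ?_
    obtain ⟨x, ⟨e'⟩⟩ := D.nonempty_iso (sec_bijective _ e₀.inv).2 b
    exact ⟨x, ⟨(c.functor _).mapIso e' ≪≫ e⟩⟩

end PicardStack

theorem lemma3p3 {C : Type u} [Category.{v} C] (J : GrothendieckTopology C)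
    (K L : CochainComplex (Sheaf J AddCommGrpCat.{max u v}) ℤ)
    [K.IsStrictlyGE (-1)] [K.IsStrictlyLE 0] [L.IsStrictlyGE (-1)] [L.IsStrictlyLE 0]
    (f : K ⟶ L)
    (P Q : PicardStack.PicardPrestack.{max u v} C)
    (jK : PicardStack.AdditiveFunctor (PicardStack.pst K) P)
    (hK : PicardStack.IsGenerated J jK)
    (jL : PicardStack.AdditiveFunctor (PicardStack.pst L) Q)
    (hL : PicardStack.IsGenerated J jL)
    (F : PicardStack.AdditiveFunctor P Q)
    (hF : Nonempty (PicardStack.AdditiveFunctor.Iso (jK.comp F)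
      ((PicardStack.pstMap f).comp jL))) :
    (∃ j : PicardStack.AdditiveFunctor
        (PicardStack.pst (((CochainComplex.mappingCone f)⟦(-1 : ℤ)⟧).truncLE 0))
        (PicardStack.ker F), PicardStack.IsGenerated J j) ∧
    (∀ (A : PicardStack.PicardPrestack.{max u v} C)
        (c : PicardStack.AdditiveFunctor (PicardStack.cokerPre F) A),
        PicardStack.IsGenerated J c →
        ∃ j : PicardStack.AdditiveFunctor
          (PicardStack.pst ((CochainComplex.mappingCone f).truncGE (-1))) A,
          PicardStack.IsGenerated J j) ∧
    Nonempty (((CochainComplex.mappingCone f)⟦(-1 : ℤ)⟧).truncLE 0 ≅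
      HomologicalComplex.double
        (Limits.kernel.lift
          (Limits.biprod.desc (L.d (-1) 0) (f.f 0) : L.X (-1) ⊞ K.X 0 ⟶ L.X 0)
          (Limits.biprod.lift (f.f (-1)) (-K.d (-1) 0)) (by simp))
        (show (ComplexShape.up ℤ).Rel (-1) 0 by simp)) ∧
    Nonempty ((CochainComplex.mappingCone f).truncGE (-1) ≅
      HomologicalComplex.double
        (Limits.cokernel.desc
          (Limits.biprod.lift (f.f (-1)) (-K.d (-1) 0) : K.X (-1) ⟶ L.X (-1) ⊞ K.X 0)
          (Limits.biprod.desc (L.d (-1) 0) (f.f 0)) (by simp))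
        (show (ComplexShape.up ℤ).Rel (-1) 0 by simp)) := by
  obtain ⟨θ⟩ := hF
  refine ⟨?_, fun A c hc => ?_, nonempty_truncLE_mappingCone_iso K L f _,
    nonempty_truncGE_mappingCone_iso K L f _⟩
  · obtain ⟨j, hj⟩ := PicardStack.exists_isLocalEquiv_ker K L f
    -- The functor is the composite pst(τ_{≤0}) → ker(pst f) → ker(F).
    exact ⟨_, (hj.comp (PicardStack.kerMap_isLocalEquiv θ hK.isLocalEquiv
      hL.isLocalEquiv)).isGenerated (PicardStack.ker_isStack F hK.isStack hL.isStack)⟩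
  · have := hc.isStack
    -- The composite coker'(pst f) → coker'(F) → A is a local equivalence, so `A` may be compared
    -- with the cokernel of `pst(f)` directly.
    obtain ⟨j, hj⟩ := PicardStack.exists_isLocalEquiv_coker K L f inferInstance _
      ((PicardStack.cokerMap_isLocalEquiv θ hK.isLocalEquiv hL.isLocalEquiv).comp
        hc.isLocalEquiv)
    exact ⟨j, hj.isGenerated hc.isStack⟩
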